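/- **Theorem 4.1 (Error of the local superposition method).** Let $d\ge 1$, $0<\alpha\le\beta$, $\rho\ge 1$, $D\ge 1$ and $H_0<1$. There are constants $c,C>0$, depending only on $d,\alpha,\beta$ and on $\rho,D,H_0$, such that the following holds. *Setting.* Let $\mathcal T_H$ and $\mathcal T_h$ be conforming meshes of closed, nondegenerate parallelepipeds in $\mathbb R^d$, where $\mathcal T_h$ is a refinement of $\mathcal T_H$. Let $\Omega$ be the interior of the union of their cells, with $1/D\le\operatorname{diam}\Omega\le D$. The meshes are shape regular and quasi-uniform with mesh sizes $0<h\le H\le H_0$, $H/h\in\mathbb N$: every $K\in\mathcal T_h$ satisfies $\operatorname{diam}K\le\rho h$ and contains a ball of radius $h/\rho$, and likewise for $\mathcal T_H$ and $H$. Let $A$ be measurable with $\alpha\le A\le\beta$ a.e. in $\Omega$. For $\omega\subseteq\Omega$ write $(v,w)_\omega=\int_\omega vw$, $a_\omega(v,w)=\int_\omega A\nabla v\cdot\nabla w$, $\|v\|^2=(v,v)_\Omega$, $\|v\|_a^2=a_\Omega(v,v)$. Let $V_h$ be the space of continuous functions that vanish on $\partial\Omega$ (extended by $0$ outside $\Omega$)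 and are, on each $K\in\mathcal T_h$, polynomials of degree at most one in each affine coordinate of $K$ ($Q_1$ elements); let $V_h(\omega)$ be the subspace of functions vanishing outside $\omega$, and $I_h$ the nodal $Q_1$ interpolation on $\mathcal T_h$. For $\tau>0$ and sequences $(z^n)_{n\ge0}$ put $$\hat\partial_\tau^2z^n=\frac{z^{n+1}-2z^n+z^{n-1}}{\tau^2},\quad \widehat{z^n}=\frac{z^{n+1}+2z^n+z^{n-1}}4,\quad \|z^{n+1/2}\|_{\mathcal E}^2=\Big\|\frac{z^{n+1}-z^n}{\tau}\Big\|^2+\Big\|\frac{z^{n+1}+z^n}{2}\Big\|_a^2 .$$ Let $f_h^n\in V_h$ ($n\ge0$), and let $(u_h^n)_{n\ge0}\subset V_h$ be a Crank–Nicolson solution: $(\hat\partial^2_\tau u_h^n,v)_\Omega+a_\Omega(\widehat{u_h^n},v)=(\widehat{f_h^n},v)_\Omega$ for all $v\in V_h$, $n\ge1$. *Local superposition method.* Let $\Lambda_i$, $i=1,\dots,M$, be the nodal $Q_1$ basis functions of all vertices of $\mathcal T_H$ (boundary vertices included), $\omega_i=\operatorname{supp}\Lambda_i$. Let $\mathtt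 N_0(\omega)=\operatorname{int}\omega$, let $\mathtt N_1(\omega)=\mathtt N(\omega)$ be the interior of the union of all cells $K\in\mathcal T_h$ with $\overline\omega\cap K\ne\emptyset$, and $\mathtt N_\ell(\omega)=\mathtt N(\mathtt N_{\ell-1}(\omega))$ for $\ell\ge2$. Let $T>0$ with $n_{\rm res}:=T/\tau\in\mathbb N$, and set $\bar u_h^0=u_h^0$, $\bar u_h^1=u_h^1$. For $k=0,1,2,\dots$ and $m=k\,n_{\rm res}$, start from $\bar u_{h,i}^{m}=I_h(\Lambda_i\bar u_h^{m})$ and $\bar u_{h,i}^{m+1}=I_h(\Lambda_i\bar u_h^{m+1})$, let $\bar u_{h,i}^{n+1}\in V_h(\mathtt N_\ell(\omega_i))$ solve, for $m+1\le n\le m+n_{\rm res}$, $$(\hat\partial^2_\tau\bar u_{h,i}^n,v)_{\mathtt N_\ell(\omega_i)}+a_{\mathtt N_\ell(\omega_i)}(\widehat{\bar u_{h,i}^n},v)=(\widehat{f_{h,i}^n},v)_{\mathtt N_\ell(\omega_i)}\quad\text{for all }v\in V_h(\mathtt N_\ell(\omega_i)),\qquad f_{h,i}^n=I_h(\Lambda_if_h^n),$$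 and set $\bar u_h^n=\sum_{i=1}^M\bar u_{h,i}^n$ for $m+1<n\le m+n_{\rm res}+1$. *Claim.* Let $t_{\rm fin}>0$, $\vartheta>0$, $C_{\tau,h}=\max\{\tau/h,h/\tau\}$, $N=\lfloor t_{\rm fin}/\tau\rfloor$, and let $\ell\in\mathbb N_0$ satisfy $$\ell\ \ge\ c\,C_{\tau,h}\Big(\tfrac T\tau\log\big(C_{\tau,h}\tfrac T\tau\big)+|\log h|+|\log\vartheta|+\tfrac{t_{\rm fin}}T|\log H|\Big).$$ Then, for every $n\in\mathbb N_0$ with $n\le t_{\rm fin}/\tau$, $$\|\bar u_h^{n+1/2}-u_h^{n+1/2}\|_{\mathcal E}\ \le\ C\,\vartheta\Big(\|u_h^{1/2}\|_{\mathcal E}+\sum_{j=1}^{N}\tau\,\|\widehat{f_h^j}\|\Big).$$ -/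

import Mathlib

open MeasureTheory

noncomputable section

namespace LSM

/-- Points of `ℝ^d` with the Euclidean norm. -/
abbrev Pt (d : ℕ) : Type := EuclideanSpace ℝ (Fin d)

/-! ### Parallelepipeds and `Q₁` functions on them -/

/-- A nondegenerate parallelepiped, given by a corner and `d` linearly independent edge vectors. -/
structure Cell (d : ℕ) where
  corner : Pt d
  edge : Module.Basis (Fin d) ℝ (Pt d)

namespace Cell

variable {d : ℕ}

/-- The affine map from the reference cube to the cell. -/
def map (K : Cell d) (t : Fin d → ℝ) : Pt d := K.corner + ∑ j, t j • K.edge j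

/-- The closed parallelepiped. -/
def carrier (K : Cell d) : Set (Pt d) := K.map '' Set.Icc 0 1

/-- The `j`-th reference coordinate of a point. -/
def coord (K : Cell d) (j : Fin d) (x : Pt d) : ℝ := K.edge.repr (x - K.corner) j

/-- The `2^d` vertices, indexed by the set of reference coordinates that equal `1`. -/
def vertex (K : Cell d) (s : Finset (Fin d)) : Pt d := K.corner + ∑ j ∈ s, K.edge j

/-- On the cell, `v` is a polynomial of degree at most one in each reference coordinate. -/
def IsQ1 (K : Cell d) (v : Pt d → ℝ) : Prop :=
  ∃ c : Finset (Fin d) → ℝ, ∀ x ∈ K.carrier, v x = ∑ s, c s * ∏ j ∈ s, K.coord j x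

/-- The `Q₁` function with the same values as `g` at the vertices of the cell. -/
def interp (K : Cell d) (g : Pt d → ℝ) (x : Pt d) : ℝ :=
  ∑ s : Finset (Fin d), g (K.vertex s) *
    ∏ j, (if j ∈ s then K.coord j x else 1 - K.coord j x)

end Cell

/-! ### Meshes and finite element spaces -/

/-- A conforming mesh of parallelepipeds: the cells do not overlap, and two cells meet in a common
face (possibly empty); the faces of a polytope are its exposed subsets. -/
structure Mesh (d : ℕ) where
  cells : Finset (Cell d)
  nonoverlapping : ∀ K ∈ cells, ∀ K' ∈ cells, K ≠ K' →
    Disjoint (interior K.carrier) (interior K'.carrier)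
  conforming : ∀ K ∈ cells, ∀ K' ∈ cells, IsExposed ℝ K.carrier (K.carrier ∩ K'.carrier)

namespace Mesh

variable {d : ℕ}

/-- The union of the closed cells. -/
def closedDomain (T : Mesh d) : Set (Pt d) := ⋃ K ∈ T.cells, K.carrier

/-- The open domain `Ω` that is meshed. -/
def domain (T : Mesh d) : Set (Pt d) := interior T.closedDomain

open Classical in
/-- All vertices of the mesh, including those on the boundary. -/
def nodes (T : Mesh d) : Finset (Pt d) :=
  T.cells.biUnion fun K => Finset.univ.image K.vertex

/-- Shape regularity and quasi-uniformity with constant `ρ`, for the characteristic mesh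
size `h`. -/
def IsQuasiUniform (T : Mesh d) (ρ h : ℝ) : Prop :=
  ∀ K ∈ T.cells, Metric.diam K.carrier ≤ ρ * h ∧
    ∃ x, Metric.ball x (h / ρ) ⊆ K.carrier

/-- `T` is a refinement of `T'`. -/
def IsRefinement (T T' : Mesh d) : Prop :=
  T.closedDomain = T'.closedDomain ∧
    ∀ K ∈ T.cells, ∃ K' ∈ T'.cells, K.carrier ⊆ K'.carrier

open Classical in
/-- Nodal `Q₁` interpolation of `g`, extended by zero outside of the mesh. Since the mesh is
conforming, the value at `x` does not depend on the cell containing `x` that is used. -/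
def interp (T : Mesh d) (g : Pt d → ℝ) (x : Pt d) : ℝ :=
  if hx : ∃ K ∈ T.cells, x ∈ K.carrier then hx.choose.interp g x else 0

open Classical in
/-- The nodal `Q₁` basis function of the node `z`. -/
def hat (T : Mesh d) (z : Pt d) : Pt d → ℝ := T.interp fun y => if y = z then 1 else 0

/-- The conforming `Q₁` finite element space with zero boundary values. Its elements are extended
by zero to `ℝ^d`, so that the boundary condition is contained in the continuity. -/
def femSpace (T : Mesh d) : Set (Pt d → ℝ) :=
  {v | Continuous v ∧ (∀ x ∉ T.domain, v x = 0) ∧ ∀ K ∈ T.cells, K.IsQ1 v}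

/-- The finite element functions that vanish outside of `ω`. -/
def femSpaceOn (T : Mesh d) (ω : Set (Pt d)) : Set (Pt d → ℝ) :=
  {v | v ∈ T.femSpace ∧ ∀ x ∉ ω, v x = 0}

/-- `N(ω)`: the interior of the union of all cells that meet the closure of `ω`. -/
def patch (T : Mesh d) (ω : Set (Pt d)) : Set (Pt d) :=
  interior (⋃ K ∈ T.cells, ⋃ (_ : (closure ω ∩ K.carrier).Nonempty), K.carrier)

/-- `N_ℓ(ω)`: the patch of `ℓ` layers of cells around `ω`. -/
def layers (T : Mesh d) (ω : Set (Pt d)) : ℕ → Set (Pt d)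
  | 0 => interior ω
  | 1 => T.patch ω
  | (l + 2) => T.patch (T.layers ω (l + 1))

end Mesh

/-! ### Bilinear forms, difference quotients and the energy norm -/

variable {d : ℕ}

/-- `(v, w)_ω`, the `L²` inner product. -/
def l2Inner (ω : Set (Pt d)) (v w : Pt d → ℝ) : ℝ := ∫ x in ω, v x * w x

/-- `‖v‖_ω`, the `L²` norm. -/
def l2Norm (ω : Set (Pt d)) (v : Pt d → ℝ) : ℝ := √(l2Inner ω v v)

/-- `a_ω(v, w) = (A ∇v, ∇w)_ω`. Finite element functions are differentiable in the interior of
every cell, hence almost everywhere, and there the classical gradient is the weak one. -/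
def aForm (A : Pt d → ℝ) (ω : Set (Pt d)) (v w : Pt d → ℝ) : ℝ :=
  ∫ x in ω, A x * inner ℝ (gradient v x) (gradient w x)

/-- `τ⁻² (zⁿ⁺¹ - 2 zⁿ + zⁿ⁻¹)`, used for `n ≥ 1` only. -/
def secondDiff (τ : ℝ) (z : ℕ → Pt d → ℝ) (n : ℕ) : Pt d → ℝ :=
  fun x => (z (n + 1) x - 2 * z n x + z (n - 1) x) / τ ^ 2

/-- `(zⁿ⁺¹ + 2 zⁿ + zⁿ⁻¹) / 4`, used for `n ≥ 1` only. -/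
def avg (z : ℕ → Pt d → ℝ) (n : ℕ) : Pt d → ℝ :=
  fun x => (z (n + 1) x + 2 * z n x + z (n - 1) x) / 4

/-- The discrete energy norm `(‖D_τ zⁿ⁺¹ᐟ²‖² + ‖zⁿ⁺¹ᐟ²‖_a²)^(1/2)` over `ω`, with
`D_τ zⁿ⁺¹ᐟ² = (zⁿ⁺¹ - zⁿ) / τ` and `zⁿ⁺¹ᐟ² = (zⁿ⁺¹ + zⁿ) / 2`. -/
def energyNorm (A : Pt d → ℝ) (ω : Set (Pt d)) (τ : ℝ) (z : ℕ → Pt d → ℝ) (n : ℕ) : ℝ :=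
  √(l2Norm ω (fun x => (z (n + 1) x - z n x) / τ) ^ 2 +
    aForm A ω (fun x => (z (n + 1) x + z n x) / 2) (fun x => (z (n + 1) x + z n x) / 2))

/-! ### The Crank--Nicolson scheme and the local superposition method -/

/-- The Crank--Nicolson equation at time step `n ≥ 1` over `ω`, with test functions in `V`. -/
def CNEquation (A : Pt d → ℝ) (τ : ℝ) (ω : Set (Pt d)) (V : Set (Pt d → ℝ))
    (z g : ℕ → Pt d → ℝ) (n : ℕ) : Prop :=
  ∀ v ∈ V, l2Inner ω (secondDiff τ z n) v + aForm A ω (avg z n) v = l2Inner ω (avg g n) v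

/-- `u` is the global Crank--Nicolson solution with right-hand side `f` (and initial data
`u 0`, `u 1`). -/
structure IsCNSolution (T : Mesh d) (A : Pt d → ℝ) (τ : ℝ) (f u : ℕ → Pt d → ℝ) : Prop where
  mem : ∀ n, u n ∈ T.femSpace
  eqn : ∀ n, 1 ≤ n → CNEquation A τ T.domain T.femSpace u f n

/-- `ω_z`, the support of the coarse basis function of the coarse node `z`. -/
def coarseSupp (TH : Mesh d) (z : Pt d) : Set (Pt d) := closure (Function.support (TH.hat z))

/-- Localization of `g` by the coarse partition of unity: `I_h(Λ_z g)`. -/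
def localize (TH Th : Mesh d) (z : Pt d) (g : Pt d → ℝ) : Pt d → ℝ :=
  Th.interp fun x => TH.hat z x * g x

/-- `ubar` is produced by the local superposition method with coarse mesh `TH`, fine mesh `Th`,
`l` layers and a reset after every `nres` time steps, from the initial data `u0`, `u1` and the
right-hand side `f`. Here `w k z n` is the local solution in the `k`-th coarse time interval on the
patch around the support of the basis function of the coarse node `z`. -/
structure IsLocalSuperposition (TH Th : Mesh d) (A : Pt d → ℝ) (τ : ℝ) (nres l : ℕ)
    (u0 u1 : Pt d → ℝ) (f : ℕ → Pt d → ℝ) (ubar : ℕ → Pt d → ℝ)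
    (w : ℕ → Pt d → ℕ → Pt d → ℝ) : Prop where
  start_zero : ubar 0 = u0
  start_one : ubar 1 = u1
  /-- At a reset, the two latest global iterates are localized. -/
  local_zero : ∀ k, ∀ z ∈ TH.nodes, w k z (k * nres) = localize TH Th z (ubar (k * nres))
  local_one : ∀ k, ∀ z ∈ TH.nodes,
    w k z (k * nres + 1) = localize TH Th z (ubar (k * nres + 1))
  /-- The local solutions are finite element functions that vanish outside of their patch. -/
  local_mem : ∀ k, ∀ z ∈ TH.nodes, ∀ n, k * nres + 1 < n → n ≤ (k + 1) * nres + 1 →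
    w k z n ∈ Th.femSpaceOn (Th.layers (coarseSupp TH z) l)
  /-- The local Crank--Nicolson problems. -/
  local_eqn : ∀ k, ∀ z ∈ TH.nodes, ∀ n, k * nres + 1 ≤ n → n ≤ (k + 1) * nres →
    CNEquation A τ (Th.layers (coarseSupp TH z) l)
      (Th.femSpaceOn (Th.layers (coarseSupp TH z) l))
      (w k z) (fun m => localize TH Th z (f m)) n
  /-- The local solutions are summed up. -/
  superpose : ∀ k n, k * nres + 1 < n → n ≤ (k + 1) * nres + 1 →
    ubar n = fun x => ∑ z ∈ TH.nodes, w k z n x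

/-- `C_{τ,h}`, up to a factor. -/
def scaleRatio (τ h : ℝ) : ℝ := max (τ / h) (h / τ)

end LSM

end

noncomputable section

namespace LSM

namespace Cell

variable {d : ℕ}

/-! ### Reference coordinates -/

/-! One Crank–Nicolson step couples all unknowns through the inverse of `M + τ²/4 A`, but this
inverse decays exponentially across layers of cells. Let `W` multiply the nodal values by `(1 + δ)`
to the power of the layer index around the support of a coarse basis function. If `s` solves the
shifted problem on a patch with right-hand side `g`, then testing with `W² s` gives `‖W s‖ ≤ 4 ·
64^d ‖W g‖` (`nrm_wt_le_of_solves`), provided δ is a small multiple of `min(1, h/τ)`. The weight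
varies by at most the factor `1 + δ` on a cell. The resulting loss is linear in δ for the mass form,
which is harmless, and quadratic in δ for the stiffness form (`stiff_ge`), where the inverse
inequality costs `(τ/h)²`. This is why the first power of `C_{τ,h}` suffices in the number of
layers.

Consequently the weighted norms of a local solution grow at most by the factor `3 + 16 · 64^d` per
step (`nrm_wt_growth`). Localized data have weight one, so far away from the support the local
solution is bounded by a geometric power of the step count times `(1 + δ)^(-(l+1))`. Extended by
zero, it satisfies the global equation up to a residual of that size (`abs_residual_le`). Nodal
localization is an exact partition of unity: the local residuals add up to the residual of the
superposition, and a reset changes nothing in the global iterate (`abs_superposition_residual_le`).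

The error therefore solves the global scheme with a residual controlled by the energy at the last
reset and by the sources. Energy stability (`energy_succ_le`) and a Gronwall inequality that looks
back to the last reset (`gronwall_delay`) bound it by `(1 + ε)^n - 1` times the data, where ε is
`stepError`. The condition on the number of layers makes `n ε ≤ min(1, ϑ)`: all powers of `1/h` and
`C_{τ,h}`, the geometric growth and the number of steps are absorbed by the decay
(`exists_decay_rate`).

Since `I_h (m v)` is not the product `m v`, the estimates run through sums of absolute nodal values
on cells; these are controlled by the `L²` norm with the constant `64^d`. Conformity enters as a
statement on exposed faces. From it one derives that interpolants from neighbouring cells agree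
(`interp_eq_of_mem_inter`) and that interpolation preserves zero boundary values
(`notMem_domain_of_coord_eq`). -/

lemma map_sub_corner (K : Cell d) (t : Fin d → ℝ) :
    K.map t - K.corner = K.edge.equivFun.symm t := by
  simp [Cell.map, Module.Basis.equivFun_symm_apply]

lemma coord_map (K : Cell d) (t : Fin d → ℝ) (j : Fin d) : K.coord j (K.map t) = t j := by
  have h : K.edge.repr (K.map t - K.corner) j = K.edge.equivFun (K.map t - K.corner) j := rfl
  rw [Cell.coord, h, map_sub_corner, LinearEquiv.apply_symm_apply]

lemma map_coord (K : Cell d) (x : Pt d) : K.map (fun j => K.coord j x) = x := by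
  have h := K.edge.sum_repr (x - K.corner)
  simp only [Cell.map, Cell.coord]
  rw [h, add_sub_cancel]

lemma ext_coord (K : Cell d) {x y : Pt d} (h : ∀ j, K.coord j x = K.coord j y) : x = y := by
  rw [← K.map_coord x, ← K.map_coord y]
  congr 1
  exact funext h

lemma mem_carrier (K : Cell d) {x : Pt d} :
    x ∈ K.carrier ↔ ∀ j, K.coord j x ∈ Set.Icc (0 : ℝ) 1 := by
  constructor
  · rintro ⟨t, ht, rfl⟩ j
    rw [coord_map]
    exact ⟨ht.1 j, ht.2 j⟩
  · intro h
    exact ⟨fun j => K.coord j x, ⟨fun j => (h j).1, fun j => (h j).2⟩, K.map_coord x⟩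

lemma coord_add (K : Cell d) (x v : Pt d) (j : Fin d) :
    K.coord j (x + v) = K.coord j x + K.edge.repr v j := by
  simp only [Cell.coord]
  rw [add_sub_right_comm, map_add]
  rfl

lemma coord_add_smul_edge (K : Cell d) (x : Pt d) (c : ℝ) (j k : Fin d) :
    K.coord j (x + c • K.edge k) = K.coord j x + if j = k then c else 0 := by
  rw [coord_add, map_smul, Module.Basis.repr_self]
  by_cases h : j = k
  · subst h; simp
  · simp [h]

lemma coord_convexComb (K : Cell d) (x y : Pt d) (a b : ℝ) (hab : a + b = 1) (j : Fin d) :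
    K.coord j (a • x + b • y) = a * K.coord j x + b * K.coord j y := by
  have h : a • x + b • y - K.corner = a • (x - K.corner) + b • (y - K.corner) := by
    have : K.corner = (a + b) • K.corner := by rw [hab, one_smul]
    conv_lhs => rw [this]
    module
  simp only [Cell.coord, h, map_add, map_smul, Finsupp.add_apply, Finsupp.smul_apply, smul_eq_mul]

lemma coord_vertex (K : Cell d) (s : Finset (Fin d)) (j : Fin d) :
    K.coord j (K.vertex s) = if j ∈ s then 1 else 0 := by
  simp only [Cell.coord, Cell.vertex, add_sub_cancel_left, map_sum, Module.Basis.repr_self]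
  rw [Finsupp.finsetSum_apply]
  simp [Finsupp.single_apply]

lemma vertex_mem (K : Cell d) (s : Finset (Fin d)) : K.vertex s ∈ K.carrier := by
  rw [mem_carrier]
  intro j
  rw [coord_vertex]
  split_ifs <;> simp

lemma continuous_coord (K : Cell d) (j : Fin d) : Continuous (K.coord j) := by
  have h : K.coord j = fun x => (K.edge.coord j) (x - K.corner) := rfl
  rw [h]
  exact (LinearMap.continuous_of_finiteDimensional (K.edge.coord j)).comp
    (continuous_id.sub continuous_const)

lemma continuous_map (K : Cell d) : Continuous K.map := by
  unfold Cell.map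
  fun_prop

lemma isCompact_carrier (K : Cell d) : IsCompact K.carrier :=
  isCompact_Icc.image K.continuous_map

lemma convex_carrier (K : Cell d) : Convex ℝ K.carrier := by
  intro x hx y hy a b ha hb hab
  rw [mem_carrier] at *
  intro j
  rw [coord_convexComb K x y a b hab]
  exact convex_Icc (0 : ℝ) 1 (hx j) (hy j) ha hb hab

/-! ### The multilinear shape functions -/

/-- The multilinear function on the reference cube that is `1` at the vertex `s` and `0` at the
other vertices. -/
def shape (s : Finset (Fin d)) (t : Fin d → ℝ) : ℝ := ∏ j, if j ∈ s then t j else 1 - t j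

lemma interp_eq_sum_shape (K : Cell d) (g : Pt d → ℝ) (x : Pt d) :
    K.interp g x = ∑ s, g (K.vertex s) * shape s (fun j => K.coord j x) := rfl

lemma sum_shape (t : Fin d → ℝ) : ∑ s, shape s t = 1 := by
  have h := Finset.prod_add (fun j => t j) (fun j => 1 - t j) (Finset.univ : Finset (Fin d))
  have h1 : ∏ j : Fin d, (t j + (1 - t j)) = 1 := by simp
  rw [h1, Finset.powerset_univ] at h
  rw [h]
  refine Finset.sum_congr rfl fun s _ => ?_
  rw [shape, Finset.prod_ite]
  congr 1
  · congr 1; ext; simp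
  · congr 1; ext; simp

lemma shape_nonneg (s : Finset (Fin d)) {t : Fin d → ℝ} (ht : ∀ j, t j ∈ Set.Icc (0 : ℝ) 1) :
    0 ≤ shape s t := by
  refine Finset.prod_nonneg fun j _ => ?_
  split_ifs
  · exact (ht j).1
  · linarith [(ht j).2]

lemma shape_le_one (s : Finset (Fin d)) {t : Fin d → ℝ} (ht : ∀ j, t j ∈ Set.Icc (0 : ℝ) 1) :
    shape s t ≤ 1 := by
  rw [← sum_shape t]
  exact Finset.single_le_sum (f := fun s => shape s t) (fun s _ => shape_nonneg s ht)
    (Finset.mem_univ s)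

lemma shape_vertex (s r : Finset (Fin d)) :
    shape s (fun j => if j ∈ r then (1 : ℝ) else 0) = if s = r then 1 else 0 := by
  split_ifs with h
  · subst h
    refine Finset.prod_eq_one fun j _ => ?_
    by_cases h : j ∈ s <;> simp [h]
  · have : ∃ j, ¬ (j ∈ s ↔ j ∈ r) := by
      by_contra hc
      push Not at hc
      exact h (Finset.ext hc)
    obtain ⟨j, hj⟩ := this
    refine Finset.prod_eq_zero (Finset.mem_univ j) ?_
    by_cases h1 : j ∈ s <;> by_cases h2 : j ∈ r <;> simp_all

lemma interp_vertex (K : Cell d) (g : Pt d → ℝ) (s : Finset (Fin d)) :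
    K.interp g (K.vertex s) = g (K.vertex s) := by
  rw [interp_eq_sum_shape]
  simp only [coord_vertex, shape_vertex]
  simp

lemma interp_congr (K : Cell d) {g g' : Pt d → ℝ} (h : ∀ s, g (K.vertex s) = g' (K.vertex s))
    (x : Pt d) : K.interp g x = K.interp g' x := by
  simp [interp_eq_sum_shape, h]

lemma continuous_interp (K : Cell d) (g : Pt d → ℝ) : Continuous (K.interp g) := by
  unfold Cell.interp
  refine continuous_finsetSum _ fun s _ => continuous_const.mul
    (continuous_finsetProd _ fun j _ => ?_)
  split_ifs
  · exact K.continuous_coord j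
  · exact continuous_const.sub (K.continuous_coord j)

/-- A `Q₁` function is determined by its values at the vertices. -/
lemma IsQ1.eq_interp {K : Cell d} {v : Pt d → ℝ} (hv : K.IsQ1 v) {x : Pt d} (hx : x ∈ K.carrier) :
    v x = K.interp v x := by
  obtain ⟨c, hc⟩ := hv
  have hmon : ∀ (s r : Finset (Fin d)), ∏ j ∈ s, K.coord j (K.vertex r) =
      if s ⊆ r then 1 else 0 := by
    intro s r
    simp only [coord_vertex]
    split_ifs with h
    · exact Finset.prod_eq_one fun j hj => by simp [h hj]
    · obtain ⟨j, hj, hjr⟩ := Finset.not_subset.1 h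
      exact Finset.prod_eq_zero hj (by simp [hjr])
  -- A monomial is the sum of the shape functions of all vertices `r ⊇ s`: expand the product of `t
  -- j + e j` with `e j = 0` on `s` and `e j = 1 - t j` off `s`.
  have hsum : ∀ (s : Finset (Fin d)) (t : Fin d → ℝ),
      ∏ j ∈ s, t j = ∑ r, (if s ⊆ r then (1 : ℝ) else 0) * shape r t := by
    intro s t
    have h := Finset.prod_add (fun j => t j) (fun j => if j ∈ s then 0 else 1 - t j)
      (Finset.univ : Finset (Fin d))
    have h1 : ∏ j : Fin d, (t j + if j ∈ s then 0 else 1 - t j) = ∏ j ∈ s, t j := by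
      rw [← Finset.prod_subset (Finset.subset_univ s)]
      · exact Finset.prod_congr rfl fun j hj => by simp [hj]
      · intro j _ hj; simp [hj]
    rw [h1, Finset.powerset_univ] at h
    rw [h]
    refine Finset.sum_congr rfl fun r _ => ?_
    split_ifs with hsr
    · have hr1 : Finset.univ.filter (fun j => j ∈ r) = r := by ext; simp
      have hr2 : Finset.univ.filter (fun j => j ∉ r) = Finset.univ \ r := by ext; simp
      have hshape : shape r t = (∏ j ∈ r, t j) * ∏ j ∈ Finset.univ \ r, (1 - t j) := by
        rw [shape, Finset.prod_ite, hr1, hr2]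
      rw [one_mul, hshape]
      congr 1
      refine Finset.prod_congr rfl fun j hj => ?_
      have : j ∉ s := fun hjs => (Finset.mem_sdiff.1 hj).2 (hsr hjs)
      simp [this]
    · obtain ⟨j, hj, hjr⟩ := Finset.not_subset.1 hsr
      rw [zero_mul]
      refine mul_eq_zero_of_right _ (Finset.prod_eq_zero (i := j) (by simp [hjr]) (by simp [hj]))
  rw [hc x hx, interp_eq_sum_shape]
  have hv' : ∀ r, v (K.vertex r) = ∑ s, c s * if s ⊆ r then 1 else 0 := by
    intro r
    rw [hc _ (K.vertex_mem r)]
    simp only [hmon]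
  simp only [hv', Finset.sum_mul]
  rw [Finset.sum_comm]
  refine Finset.sum_congr rfl fun s _ => ?_
  rw [hsum s, Finset.mul_sum]
  exact Finset.sum_congr rfl fun r _ => by ring

lemma isQ1_of_eq_interp {K : Cell d} {v g : Pt d → ℝ}
    (h : ∀ x ∈ K.carrier, v x = K.interp g x) : K.IsQ1 v := by
  have hshape : ∀ s : Finset (Fin d), ∃ c : Finset (Fin d) → ℝ, ∀ t : Fin d → ℝ,
      shape s t = ∑ r, c r * ∏ j ∈ r, t j := by
    intro s
    -- Each factor of `shape s` is `±t j` plus `0` or `1`; in the expansion, `r` is the set of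
    -- indices that contribute the linear term.
    refine ⟨fun r => (∏ j ∈ r, if j ∈ s then (1 : ℝ) else -1) *
      ∏ j ∈ Finset.univ \ r, if j ∈ s then (0 : ℝ) else 1, fun t => ?_⟩
    have h := Finset.prod_add (fun j => (if j ∈ s then (1 : ℝ) else -1) * t j)
      (fun j => if j ∈ s then (0 : ℝ) else 1) (Finset.univ : Finset (Fin d))
    have h1 : shape s t = ∏ j : Fin d, ((if j ∈ s then (1 : ℝ) else -1) * t j +
        if j ∈ s then (0 : ℝ) else 1) := by
      refine Finset.prod_congr rfl fun j _ => ?_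
      split_ifs <;> ring
    rw [h1, h, Finset.powerset_univ]
    refine Finset.sum_congr rfl fun r _ => ?_
    rw [Finset.prod_mul_distrib]
    ring
  choose c hc using hshape
  refine ⟨fun r => ∑ s, g (K.vertex s) * c s r, fun x hx => ?_⟩
  rw [h x hx, interp_eq_sum_shape]
  simp only [hc, Finset.mul_sum, Finset.sum_mul]
  rw [Finset.sum_comm]
  exact Finset.sum_congr rfl fun _ _ => Finset.sum_congr rfl fun _ _ => by ring

/-- The interpolant is affine along lines parallel to an edge. -/
lemma interp_line (K : Cell d) (g : Pt d → ℝ) (x w : Pt d) (k : Fin d) (c : ℝ)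
    (hw : w = c • K.edge k) (t : ℝ) :
    K.interp g (x + t • w) = (1 - t) * K.interp g x + t * K.interp g (x + w) := by
  have hs : ∀ s : Finset (Fin d), ∃ a b : ℝ, ∀ r : ℝ,
      shape s (fun j => K.coord j (x + r • w)) = a + r * b := by
    intro s
    refine ⟨(∏ j ∈ Finset.univ.erase k, if j ∈ s then K.coord j x else 1 - K.coord j x) *
        (if k ∈ s then K.coord k x else 1 - K.coord k x),
      (∏ j ∈ Finset.univ.erase k, if j ∈ s then K.coord j x else 1 - K.coord j x) *
        (if k ∈ s then c else -c), fun r => ?_⟩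
    rw [shape, ← Finset.prod_erase_mul _ _ (Finset.mem_univ k)]
    have h1 : ∀ j ∈ Finset.univ.erase k, (if j ∈ s then K.coord j (x + r • w) else
        1 - K.coord j (x + r • w)) = if j ∈ s then K.coord j x else 1 - K.coord j x := by
      intro j hj
      have hjk : j ≠ k := Finset.ne_of_mem_erase hj
      rw [hw, smul_smul, coord_add_smul_edge, if_neg hjk, add_zero]
    rw [Finset.prod_congr rfl h1, hw, smul_smul, coord_add_smul_edge, if_pos rfl]
    split_ifs <;> ring
  choose a b hab using hs
  have h0 := fun s => hab s 0
  have h1 := fun s => hab s 1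
  simp only [zero_smul, add_zero, zero_mul, one_smul, one_mul] at h0 h1
  simp only [interp_eq_sum_shape, hab, h0, h1, Finset.mul_sum]
  rw [← Finset.sum_add_distrib]
  exact Finset.sum_congr rfl fun s _ => by ring

/-- The sum of the absolute values at the vertices. -/
def nodalSum (K : Cell d) (g : Pt d → ℝ) : ℝ := ∑ s, |g (K.vertex s)|

lemma nodalSum_nonneg (K : Cell d) (g : Pt d → ℝ) : 0 ≤ K.nodalSum g :=
  Finset.sum_nonneg fun _ _ => abs_nonneg _

lemma nodalSum_le_of_abs_le (K : Cell d) {f g : Pt d → ℝ} {c : ℝ}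
    (h : ∀ s, |f (K.vertex s)| ≤ c * |g (K.vertex s)|) : K.nodalSum f ≤ c * K.nodalSum g := by
  rw [nodalSum, nodalSum, Finset.mul_sum]
  exact Finset.sum_le_sum fun s _ => h s

lemma abs_interp_le (K : Cell d) (g : Pt d → ℝ) {x : Pt d} (hx : x ∈ K.carrier) :
    |K.interp g x| ≤ K.nodalSum g := by
  rw [interp_eq_sum_shape]
  refine (Finset.abs_sum_le_sum_abs _ _).trans (Finset.sum_le_sum fun s _ => ?_)
  have hx' := K.mem_carrier.1 hx
  rw [abs_mul, abs_of_nonneg (shape_nonneg s hx')]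
  exact mul_le_of_le_one_right (abs_nonneg _) (shape_le_one s hx')

/-- Moving from the centre of the inscribed ball by less than `r` keeps the coordinate in `[0, 1]`,
so the linear part of the coordinate is at most one on vectors shorter than `r`. -/
lemma abs_coord_sub_le (K : Cell d) {c : Pt d} {r : ℝ} (hr : 0 < r)
    (hc : Metric.ball c r ⊆ K.carrier) (j : Fin d) (x y : Pt d) :
    |K.coord j x - K.coord j y| ≤ 2 / r * dist x y := by
  have hlin : ∀ z : Pt d, ‖z‖ < r → |K.edge.repr z j| ≤ 1 := by
    intro z hz
    have h1 := K.mem_carrier.1 (hc (by simpa using hz : c + z ∈ Metric.ball c r)) j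
    have h2 := K.mem_carrier.1 (hc (Metric.mem_ball_self hr)) j
    rw [coord_add] at h1
    rw [abs_le]
    constructor <;> linarith [h1.1, h1.2, h2.1, h2.2]
  have hsub : K.coord j x - K.coord j y = K.edge.repr (x - y) j := by
    have := K.coord_add y (x - y) j
    rw [add_sub_cancel] at this
    linarith
  rw [hsub, dist_eq_norm]
  set z := x - y
  by_cases hz : z = 0
  · simp [hz]
  have hzn : 0 < ‖z‖ := norm_pos_iff.2 hz
  -- Rescaling to length `r / 2` stays strictly inside the open ball; this is the origin of the
  -- factor 2.
  have h := hlin ((r / 2 / ‖z‖) • z) (by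
    rw [norm_smul, Real.norm_of_nonneg (by positivity), div_mul_cancel₀ _ hzn.ne']
    linarith)
  rw [map_smul, Finsupp.smul_apply, smul_eq_mul, abs_mul, abs_of_nonneg (by positivity)] at h
  rw [div_div, div_mul_eq_mul_div, div_le_one (by positivity)] at h
  rw [div_mul_eq_mul_div, le_div_iff₀ hr]
  linarith

lemma abs_prod_sub_prod_le {ι : Type*} (s : Finset ι) (a b : ι → ℝ) (ha : ∀ i ∈ s, |a i| ≤ 1)
    (hb : ∀ i ∈ s, |b i| ≤ 1) : |∏ i ∈ s, a i - ∏ i ∈ s, b i| ≤ ∑ i ∈ s, |a i - b i| := by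
  classical
  induction s using Finset.induction_on with
  | empty => simp
  | insert i s hi ih =>
    rw [Finset.prod_insert hi, Finset.prod_insert hi, Finset.sum_insert hi]
    have h1 := ih (fun j hj => ha j (Finset.mem_insert_of_mem hj))
      (fun j hj => hb j (Finset.mem_insert_of_mem hj))
    have h2 : |∏ j ∈ s, a j| ≤ 1 := by
      rw [Finset.abs_prod]
      exact Finset.prod_le_one (fun _ _ => abs_nonneg _)
        fun j hj => ha j (Finset.mem_insert_of_mem hj)
    have h3 : a i * ∏ j ∈ s, a j - b i * ∏ j ∈ s, b j =
        (a i - b i) * ∏ j ∈ s, a j + b i * (∏ j ∈ s, a j - ∏ j ∈ s, b j) := by ring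
    rw [h3]
    refine (abs_add_le _ _).trans (add_le_add ?_ ?_)
    · rw [abs_mul]
      exact mul_le_of_le_one_right (abs_nonneg _) h2
    · rw [abs_mul]
      exact (mul_le_of_le_one_left (abs_nonneg _) (hb i (Finset.mem_insert_self i s))).trans h1

lemma abs_interp_sub_le (K : Cell d) {c : Pt d} {r : ℝ} (hr : 0 < r)
    (hc : Metric.ball c r ⊆ K.carrier) (g : Pt d → ℝ) {x y : Pt d} (hx : x ∈ K.carrier)
    (hy : y ∈ K.carrier) :
    |K.interp g x - K.interp g y| ≤ 2 * d / r * K.nodalSum g * dist x y := by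
  have hx' := K.mem_carrier.1 hx
  have hy' := K.mem_carrier.1 hy
  have hs : ∀ s : Finset (Fin d), |shape s (fun j => K.coord j x) - shape s (fun j => K.coord j y)|
      ≤ 2 * d / r * dist x y := by
    intro s
    refine (abs_prod_sub_prod_le _ _ _ ?_ ?_).trans ?_
    · intro j _
      split_ifs <;> rw [abs_le] <;> constructor <;> linarith [(hx' j).1, (hx' j).2]
    · intro j _
      split_ifs <;> rw [abs_le] <;> constructor <;> linarith [(hy' j).1, (hy' j).2]
    · have : ∀ j ∈ (Finset.univ : Finset (Fin d)), |(if j ∈ s then K.coord j x else 1 - K.coord j x)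
          - (if j ∈ s then K.coord j y else 1 - K.coord j y)| ≤ 2 / r * dist x y := by
        intro j _
        split_ifs
        · exact K.abs_coord_sub_le hr hc j x y
        · rw [show 1 - K.coord j x - (1 - K.coord j y) = -(K.coord j x - K.coord j y) by ring,
            abs_neg]
          exact K.abs_coord_sub_le hr hc j x y
      refine (Finset.sum_le_card_nsmul _ _ _ this).trans (le_of_eq ?_)
      simp
      ring
  rw [interp_eq_sum_shape, interp_eq_sum_shape, ← Finset.sum_sub_distrib, nodalSum,
    Finset.mul_sum, Finset.sum_mul]
  refine (Finset.abs_sum_le_sum_abs _ _).trans (Finset.sum_le_sum fun s _ => ?_)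
  rw [← mul_sub, abs_mul]
  calc _ ≤ |g (K.vertex s)| * (2 * d / r * dist x y) :=
        mul_le_mul_of_nonneg_left (hs s) (abs_nonneg _)
    _ = _ := by ring

end Cell

/-- The Cauchy--Schwarz inequality for integrals. -/
lemma sq_integral_mul_le {X : Type*} [MeasurableSpace X] {μ : Measure X} {f g : X → ℝ}
    (hf : Integrable (fun x => f x * f x) μ) (hg : Integrable (fun x => g x * g x) μ)
    (hfg : Integrable (fun x => f x * g x) μ) :
    (∫ x, f x * g x ∂μ) ^ 2 ≤ (∫ x, f x * f x ∂μ) * ∫ x, g x * g x ∂μ := by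
  have h : ∀ t : ℝ, 0 ≤ (∫ x, g x * g x ∂μ) * (t * t) + 2 * (∫ x, f x * g x ∂μ) * t +
      ∫ x, f x * f x ∂μ := by
    intro t
    have h1 : ∫ x, (f x + t * g x) * (f x + t * g x) ∂μ = (∫ x, g x * g x ∂μ) * (t * t) +
        2 * (∫ x, f x * g x ∂μ) * t + ∫ x, f x * f x ∂μ := by
      have : (fun x => (f x + t * g x) * (f x + t * g x)) = fun x =>
          ((t * t) * (g x * g x) + (2 * t) * (f x * g x)) + f x * f x := by ext; ring
      have hi : Integrable (fun x => (t * t) * (g x * g x) + (2 * t) * (f x * g x)) μ :=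
        (hg.const_mul _).add (hfg.const_mul _)
      rw [this, integral_add hi hf,
        integral_add (hg.const_mul _) (hfg.const_mul _), integral_const_mul, integral_const_mul]
      ring
    rw [← h1]
    exact integral_nonneg fun x => mul_self_nonneg _
  have := discrim_le_zero h
  rw [discrim] at this
  nlinarith

namespace Cell

variable {d : ℕ}

/-! ### Norm equivalence on a cell -/

/-- The biorthogonal system of the shape functions. -/
def dualShape (s : Finset (Fin d)) (t : Fin d → ℝ) : ℝ :=
  ∏ j, if j ∈ s then 6 * t j - 2 else 4 - 6 * t j

lemma continuous_shape (s : Finset (Fin d)) : Continuous (shape s) := by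
  unfold shape
  refine continuous_finsetProd _ fun j _ => ?_
  split_ifs <;> fun_prop

lemma continuous_dualShape (s : Finset (Fin d)) : Continuous (dualShape s) := by
  unfold dualShape
  refine continuous_finsetProd _ fun j _ => ?_
  split_ifs <;> fun_prop

lemma abs_dualShape_le (s : Finset (Fin d)) {t : Fin d → ℝ} (ht : t ∈ Set.Icc (0 : Fin d → ℝ) 1) :
    |dualShape s t| ≤ 4 ^ d := by
  rw [dualShape, Finset.abs_prod]
  refine (Finset.prod_le_prod (g := fun _ => (4 : ℝ)) (fun _ _ => abs_nonneg _)
    fun j _ => ?_).trans (by simp)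
  have h0 := ht.1 j
  have h1 := ht.2 j
  simp only [Pi.zero_apply, Pi.one_apply] at h0 h1
  split_ifs <;> rw [abs_le] <;> constructor <;> linarith

/-- The integral over the cube factors over the coordinates, and in one variable `6y - 2` and `4 -
6y` are dual to `y` and `1 - y`. -/
lemma integral_shape_mul_dualShape (s r : Finset (Fin d)) :
    ∫ t in Set.Icc (0 : Fin d → ℝ) 1, shape s t * dualShape r t = if s = r then 1 else 0 := by
  have hvol : (volume : Measure (Fin d → ℝ)).restrict (Set.Icc 0 1) =
      Measure.pi fun _ => (volume : Measure ℝ).restrict (Set.Icc 0 1) := by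
    rw [volume_pi, ← Measure.restrict_pi_pi, Set.pi_univ_Icc]
    rfl
  have hprod : ∀ t : Fin d → ℝ, shape s t * dualShape r t =
      ∏ j, (fun y : ℝ => (if j ∈ s then y else 1 - y) * (if j ∈ r then 6 * y - 2 else 4 - 6 * y))
        (t j) := by
    intro t
    rw [shape, dualShape, ← Finset.prod_mul_distrib]
  have h1 : ∀ j : Fin d, ∫ y in Set.Icc (0 : ℝ) 1,
      (if j ∈ s then y else 1 - y) * (if j ∈ r then 6 * y - 2 else 4 - 6 * y) =
        if (j ∈ s ↔ j ∈ r) then 1 else 0 := by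
    intro j
    rw [integral_Icc_eq_integral_Ioc, ← intervalIntegral.integral_of_le zero_le_one]
    have key : ∀ a b c : ℝ, ∫ y in (0 : ℝ)..1, (a + b * y + c * y ^ 2) = a + b / 2 + c / 3 := by
      intro a b c
      rw [intervalIntegral.integral_add (by apply Continuous.intervalIntegrable; fun_prop)
        (by apply Continuous.intervalIntegrable; fun_prop),
        intervalIntegral.integral_add (by apply Continuous.intervalIntegrable; fun_prop)
        (by apply Continuous.intervalIntegrable; fun_prop)]
      simp only [intervalIntegral.integral_const, intervalIntegral.integral_const_mul,
        integral_pow]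
      have : ∫ y in (0 : ℝ)..1, b * y = b * ((1 ^ 2 - 0 ^ 2) / 2) := by
        rw [intervalIntegral.integral_const_mul, integral_id]
      rw [this]
      norm_num
      ring
    by_cases hs : j ∈ s <;> by_cases hr : j ∈ r <;> simp only [hs, hr, if_true, if_false,
      iff_true, iff_false, not_true]
    · rw [show (fun y : ℝ => y * (6 * y - 2)) = fun y => 0 + (-2) * y + 6 * y ^ 2 by ext; ring, key]
      norm_num
    · rw [show (fun y : ℝ => y * (4 - 6 * y)) = fun y => 0 + 4 * y + (-6) * y ^ 2 by ext; ring, key]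
      norm_num
    · rw [show (fun y : ℝ => (1 - y) * (6 * y - 2)) = fun y => (-2) + 8 * y + (-6) * y ^ 2 by
        ext; ring, key]
      norm_num
    · rw [show (fun y : ℝ => (1 - y) * (4 - 6 * y)) = fun y => 4 + (-10) * y + 6 * y ^ 2 by
        ext; ring, key]
      norm_num
  simp only [hprod]
  rw [hvol, integral_fintype_prod_eq_prod (𝕜 := ℝ) (fun (j : Fin d) (y : ℝ) =>
    (if j ∈ s then y else 1 - y) * (if j ∈ r then 6 * y - 2 else 4 - 6 * y))]
  simp only [h1]
  split_ifs with h
  · subst h; simp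
  · have : ∃ j, ¬ (j ∈ s ↔ j ∈ r) := by
      by_contra hc
      push Not at hc
      exact h (Finset.ext hc)
    obtain ⟨j, hj⟩ := this
    exact Finset.prod_eq_zero (Finset.mem_univ j) (if_neg hj)

lemma volume_Icc_zero_one : (volume : Measure (Fin d → ℝ)).real (Set.Icc 0 1) = 1 := by
  rw [Measure.real, Real.volume_Icc_pi]
  simp

/-- A coefficient is the integral against its dual function, which is bounded by `4^d`, so
Cauchy–Schwarz costs `16^d`. The sum over the `2^d` vertices costs `2^d` twice, hence `64^d`. -/
lemma sq_sum_abs_le_integral (g : Finset (Fin d) → ℝ) :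
    (∑ s, |g s|) ^ 2 ≤ 64 ^ d *
      ∫ t in Set.Icc (0 : Fin d → ℝ) 1, (∑ s, g s * shape s t) * (∑ s, g s * shape s t) := by
  set p : (Fin d → ℝ) → ℝ := fun t => ∑ s, g s * shape s t with hp
  have hpc : Continuous p := continuous_finsetSum _ fun s _ =>
    continuous_const.mul (continuous_shape s)
  have hint : ∀ q : (Fin d → ℝ) → ℝ, Continuous q → IntegrableOn q (Set.Icc 0 1) :=
    fun q hq => hq.continuousOn.integrableOn_compact isCompact_Icc
  set J := ∫ t in Set.Icc (0 : Fin d → ℝ) 1, p t * p t with hJ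
  have hg : ∀ r, g r ^ 2 ≤ 16 ^ d * J := by
    intro r
    have h1 : g r = ∫ t in Set.Icc (0 : Fin d → ℝ) 1, p t * dualShape r t := by
      have : ∀ t, p t * dualShape r t = ∑ s, g s * (shape s t * dualShape r t) := by
        intro t
        rw [hp]
        simp only [Finset.sum_mul]
        exact Finset.sum_congr rfl fun s _ => by ring
      simp only [this]
      rw [integral_finsetSum]
      · simp only [integral_const_mul, integral_shape_mul_dualShape]
        simp
      · intro s _
        exact (hint _ ((continuous_shape s).mul (continuous_dualShape r))).const_mul _
    have h2 : ∫ t in Set.Icc (0 : Fin d → ℝ) 1, dualShape r t * dualShape r t ≤ 16 ^ d := by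
      have : ∫ t in Set.Icc (0 : Fin d → ℝ) 1, dualShape r t * dualShape r t ≤
          ∫ t in Set.Icc (0 : Fin d → ℝ) 1, (16 : ℝ) ^ d := by
        refine setIntegral_mono_on (hint _ ((continuous_dualShape r).mul (continuous_dualShape r)))
          (hint _ continuous_const) measurableSet_Icc fun t ht => ?_
        have h4 := abs_dualShape_le r ht
        calc dualShape r t * dualShape r t = |dualShape r t| * |dualShape r t| :=
              (abs_mul_abs_self _).symm
          _ ≤ 4 ^ d * 4 ^ d := mul_le_mul h4 h4 (abs_nonneg _) (by positivity)
          _ = 16 ^ d := by rw [← mul_pow]; norm_num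
      refine this.trans (le_of_eq ?_)
      rw [setIntegral_const, volume_Icc_zero_one, one_smul]
    have h3 := sq_integral_mul_le (hint _ (hpc.mul hpc))
      (hint _ ((continuous_dualShape r).mul (continuous_dualShape r)))
      (hint _ (hpc.mul (continuous_dualShape r)))
    rw [h1]
    refine h3.trans ?_
    rw [mul_comm]
    exact mul_le_mul_of_nonneg_right h2 (integral_nonneg fun t => mul_self_nonneg _)
  have hcs : (∑ s, |g s|) ^ 2 ≤ 2 ^ d * ∑ s, g s ^ 2 := by
    have := sq_sum_le_card_mul_sum_sq (s := (Finset.univ : Finset (Finset (Fin d))))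
      (f := fun s => |g s|)
    simpa [sq_abs] using this
  refine hcs.trans ?_
  calc (2 : ℝ) ^ d * ∑ s, g s ^ 2 ≤ 2 ^ d * ∑ s : Finset (Fin d), 16 ^ d * J := by
        gcongr with s _
        exact hg s
    _ = 64 ^ d * J := by
        rw [Finset.sum_const, Finset.card_univ, Fintype.card_finset, Fintype.card_fin,
          nsmul_eq_mul]
        push_cast
        rw [← mul_assoc, ← mul_assoc, ← mul_pow, ← mul_pow]
        norm_num

/-- Integrals over a cell are computed on the reference cube. -/
lemma integral_carrier (K : Cell d) (F : Pt d → ℝ) (hF : Continuous F) :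
    ∫ x in K.carrier, F x = (volume : Measure (Pt d)).real K.carrier *
      ∫ t in Set.Icc (0 : Fin d → ℝ) 1, F (K.map t) := by
  set L : (Fin d → ℝ) ≃L[ℝ] Pt d := K.edge.equivFun.symm.toContinuousLinearEquiv with hL
  have hmap : ∀ t, K.map t = K.corner + L t := by
    intro t
    have h := K.map_sub_corner t
    rw [sub_eq_iff_eq_add'] at h
    exact h
  set Φ : (Fin d → ℝ) ≃ₜ Pt d := L.toHomeomorph.trans (Homeomorph.addLeft K.corner) with hΦ
  have hΦmap : ∀ t, Φ t = K.map t := fun t => (hmap t).symm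
  have hhaar : (Measure.map L (volume : Measure (Fin d → ℝ))).IsAddHaarMeasure :=
    L.isAddHaarMeasure_map _
  -- Uniqueness of Haar measure replaces a determinant: the pushforward is a multiple of the volume,
  -- and the multiple is read off later from the constant function 1.
  obtain ⟨c, hc⟩ : ∃ c : NNReal, (volume : Measure (Pt d)) =
      c • Measure.map Φ (volume : Measure (Fin d → ℝ)) := by
    have h2 : Measure.map Φ (volume : Measure (Fin d → ℝ)) =
        Measure.map L (volume : Measure (Fin d → ℝ)) := by
      rw [← map_add_left_eq_self (Measure.map L (volume : Measure (Fin d → ℝ))) K.corner,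
        Measure.map_map (by fun_prop) (L.continuous.measurable)]
      rfl
    rw [h2]
    exact ⟨_, Measure.isAddLeftInvariant_eq_smul (volume : Measure (Pt d)) _⟩
  have hpre : Φ ⁻¹' K.carrier = Set.Icc 0 1 := by
    ext t
    rw [Set.mem_preimage, hΦmap, mem_carrier]
    simp only [coord_map]
    exact ⟨fun h => ⟨fun j => (h j).1, fun j => (h j).2⟩, fun h j => ⟨h.1 j, h.2 j⟩⟩
  have hint : ∀ G : Pt d → ℝ, Continuous G → ∫ x in K.carrier, G x =
      (c : ℝ) * ∫ t in Set.Icc (0 : Fin d → ℝ) 1, G (K.map t) := by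
    intro G hG
    conv_lhs => rw [hc]
    rw [Measure.restrict_smul, integral_smul_nnreal_measure, NNReal.smul_def, smul_eq_mul]
    congr 1
    have hemb := Φ.measurableEmbedding
    rw [hemb.restrict_map, hpre, hemb.integral_map]
    simp only [hΦmap]
  have h1 := hint (fun _ => 1) continuous_const
  simp only [setIntegral_const, volume_Icc_zero_one, smul_eq_mul, mul_one] at h1
  rw [hint F hF, h1]

/-- The nodal values are controlled by the `L²` norm. -/
lemma volume_mul_sq_nodalSum_le (K : Cell d) (g : Pt d → ℝ) :
    (volume : Measure (Pt d)).real K.carrier * K.nodalSum g ^ 2 ≤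
      64 ^ d * ∫ x in K.carrier, K.interp g x * K.interp g x := by
  rw [K.integral_carrier (fun x => K.interp g x * K.interp g x)
    ((K.continuous_interp g).mul (K.continuous_interp g))]
  have h := sq_sum_abs_le_integral (fun s => g (K.vertex s))
  simp only [interp_eq_sum_shape, coord_map]
  calc _ ≤ (volume : Measure (Pt d)).real K.carrier * _ :=
        mul_le_mul_of_nonneg_left h measureReal_nonneg
    _ = _ := by ring

end Cell

namespace Mesh

variable {d : ℕ}

/-! ### Conformity: interpolants agree on common faces -/

/-- A common face of two cells is where a linear functional attains its maximum. -/
lemma exists_functional (T : Mesh d) {K K' : Cell d} (hK : K ∈ T.cells) (hK' : K' ∈ T.cells)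
    (hne : (K.carrier ∩ K'.carrier).Nonempty) :
    ∃ l : Pt d →L[ℝ] ℝ, ∀ x ∈ K.carrier, ∀ y ∈ K.carrier ∩ K'.carrier,
      l x ≤ l y ∧ (l x = l y → x ∈ K'.carrier) := by
  obtain ⟨l, hl⟩ := T.conforming K hK K' hK' hne
  refine ⟨l, fun x hx y hy => ?_⟩
  have hy' := hy
  rw [hl] at hy'
  refine ⟨hy'.2 x hx, fun h => ?_⟩
  have : x ∈ K.carrier ∩ K'.carrier := by
    rw [hl]
    exact ⟨hx, fun z hz => by rw [h]; exact hy'.2 z hz⟩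
  exact this.2

/-- The functional that exposes a face is constant along the face. -/
lemma functional_edge_eq_zero {K K' : Cell d} {l : Pt d →L[ℝ] ℝ}
    (hl : ∀ x ∈ K.carrier, ∀ y ∈ K.carrier ∩ K'.carrier,
      l x ≤ l y ∧ (l x = l y → x ∈ K'.carrier)) {x : Pt d} (hx : x ∈ K.carrier ∩ K'.carrier)
    {j : Fin d} (h0 : 0 < K.coord j x) (h1 : K.coord j x < 1) : l (K.edge j) = 0 := by
  have hc := K.mem_carrier.1 hx.1
  have key : ∀ c : ℝ, 0 ≤ K.coord j x + c → K.coord j x + c ≤ 1 → c * l (K.edge j) ≤ 0 := by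
    intro c hc0 hc1
    have hmem : x + c • K.edge j ∈ K.carrier := by
      rw [Cell.mem_carrier]
      intro i
      rw [Cell.coord_add_smul_edge]
      split_ifs with h
      · subst h; exact ⟨hc0, hc1⟩
      · rw [add_zero]; exact hc i
    have := (hl _ hmem x hx).1
    rw [map_add, map_smul, smul_eq_mul] at this
    linarith
  have ha := key (-K.coord j x) (by linarith) (by linarith)
  have hb := key (1 - K.coord j x) (by linarith) (by linarith)
  have : 0 ≤ l (K.edge j) := by
    by_contra hneg
    push Not at hneg
    nlinarith
  nlinarith

/-- Changing the strictly fractional coordinates does not leave the face. -/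
lemma mem_of_coord_eq {K K' : Cell d} {l : Pt d →L[ℝ] ℝ}
    (hl : ∀ x ∈ K.carrier, ∀ y ∈ K.carrier ∩ K'.carrier,
      l x ≤ l y ∧ (l x = l y → x ∈ K'.carrier)) {x y : Pt d} (hx : x ∈ K.carrier ∩ K'.carrier)
    (hy : y ∈ K.carrier) (hxy : ∀ j, K.coord j y ≠ K.coord j x → 0 < K.coord j x ∧
      K.coord j x < 1) : y ∈ K'.carrier := by
  refine (hl y hy x hx).2 ?_
  have hdiff : y - x = ∑ j, (K.coord j y - K.coord j x) • K.edge j := by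
    have h1 := K.map_coord y
    have h2 := K.map_coord x
    rw [Cell.map] at h1 h2
    rw [← h1, ← h2]
    simp only [Cell.coord_add, sub_smul, Finset.sum_sub_distrib]
    simp [Cell.coord]
  have : l (y - x) = 0 := by
    rw [hdiff, map_sum]
    refine Finset.sum_eq_zero fun j _ => ?_
    rw [map_smul, smul_eq_mul]
    by_cases h : K.coord j y = K.coord j x
    · rw [h, sub_self, zero_mul]
    · rw [functional_edge_eq_zero hl hx (hxy j h).1 (hxy j h).2, mul_zero]
  rw [map_sub] at this
  linarith

/-- An edge of a cell along a common face is parallel to an edge of the other cell. -/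
lemma exists_parallel_edge (T : Mesh d) {K K' : Cell d} (hK : K ∈ T.cells) (hK' : K' ∈ T.cells)
    {x : Pt d} (hx : x ∈ K.carrier ∩ K'.carrier) {j : Fin d} (h0 : 0 < K.coord j x)
    (h1 : K.coord j x < 1) : ∃ (k : Fin d) (c : ℝ), K.edge j = c • K'.edge k := by
  obtain ⟨l, hl⟩ := T.exists_functional hK hK' ⟨x, hx⟩
  obtain ⟨l', hl'⟩ := T.exists_functional hK' hK ⟨x, hx.2, hx.1⟩
  have hxc := K.mem_carrier.1 hx.1
  classical
  -- The point `p` has the fractional coordinates of `x` rounded down to 0, and `q` is the other end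
  -- of the edge in direction `j`. Both lie in the smallest face of `K` containing `x`, hence in
  -- `K'`.
  set s : Finset (Fin d) := Finset.univ.filter fun i => K.coord i x = 1 with hs
  have hjs : j ∉ s := by simp [hs, h1.ne]
  set p := K.vertex s with hp
  set q := p + (1 : ℝ) • K.edge j with hq
  have hpc : ∀ i, K.coord i p = if K.coord i x = 1 then 1 else 0 := by
    intro i
    rw [hp, Cell.coord_vertex]
    simp [hs]
  have hpc01 : ∀ i, K.coord i p = 0 ∨ K.coord i p = 1 := by
    intro i; rw [hpc]; split_ifs <;> simp
  have hpK : p ∈ K.carrier := K.vertex_mem s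
  have hqc : ∀ i, K.coord i q = if i = j then 1 else K.coord i p := by
    intro i
    rw [hq, Cell.coord_add_smul_edge]
    split_ifs with h
    · subst h
      rw [hpc, if_neg h1.ne, zero_add]
    · rw [add_zero]
  have hqK : q ∈ K.carrier := by
    rw [Cell.mem_carrier]
    intro i
    rw [hqc]
    split_ifs
    · simp
    · exact K.mem_carrier.1 hpK i
  have hfrac : ∀ i, K.coord i x ≠ 1 → K.coord i x ≠ 0 → 0 < K.coord i x ∧ K.coord i x < 1 :=
    fun i h1 h0 => ⟨lt_of_le_of_ne (hxc i).1 (Ne.symm h0), lt_of_le_of_ne (hxc i).2 h1⟩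
  have hpF : p ∈ K'.carrier := mem_of_coord_eq hl hx hpK fun i hi => by
    rw [hpc] at hi
    split_ifs at hi with h
    · exact absurd h.symm hi
    · exact hfrac i h (Ne.symm hi)
  have hqF : q ∈ K'.carrier := mem_of_coord_eq hl hx hqK fun i hi => by
    rw [hqc] at hi
    split_ifs at hi with h
    · subst h; exact ⟨h0, h1⟩
    · rw [hpc] at hi
      split_ifs at hi with h
      · exact absurd h.symm hi
      · exact hfrac i h (Ne.symm hi)
  have hedge : K.edge j = ∑ k, K'.edge.repr (K.edge j) k • K'.edge k :=
    (K'.edge.sum_repr _).symm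
  have hne : ∃ k, K'.edge.repr (K.edge j) k ≠ 0 := by
    by_contra hcon
    push Not at hcon
    have : K.edge j = 0 := by
      rw [hedge]
      exact Finset.sum_eq_zero fun k _ => by rw [hcon k, zero_smul]
    exact K.edge.ne_zero j this
  obtain ⟨k, hk⟩ := hne
  set b := K'.edge.repr (K.edge j) k with hb
  have hqk : ∀ i, K'.coord i q = K'.coord i p + K'.edge.repr (K.edge j) i := by
    intro i
    rw [hq, one_smul, Cell.coord_add]
  have hpK' := K'.mem_carrier.1 hpF
  have hqK' := K'.mem_carrier.1 hqF
  -- A parallelogram with diagonal `pq` and a side along an edge of `K'`. Its corners `y`, `z` lie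
  -- in `K'`, as their coordinates are those of `p` or `q`. The functional exposing the common face
  -- is maximal at `p` and `q`, and `y + z = p + q`, so it is maximal at `y` and `z` too, and these
  -- lie in `K`.
  set y := p + b • K'.edge k with hy
  set z := q + (-b) • K'.edge k with hz
  have hyK' : y ∈ K'.carrier := by
    rw [Cell.mem_carrier]
    intro i
    rw [hy, Cell.coord_add_smul_edge]
    split_ifs with h
    · subst h
      rw [hb, ← hqk]
      exact hqK' i
    · rw [add_zero]; exact hpK' i
  have hzK' : z ∈ K'.carrier := by
    rw [Cell.mem_carrier]
    intro i
    rw [hz, Cell.coord_add_smul_edge]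
    split_ifs with h
    · subst h
      rw [hqk, ← hb, add_neg_cancel_right]
      exact hpK' i
    · rw [add_zero]; exact hqK' i
  have hsum : y + z = p + q := by rw [hy, hz, neg_smul]; abel
  have hyK : y ∈ K.carrier := by
    refine (hl' y hyK' p ⟨hpF, hpK⟩).2 ?_
    have e1 := (hl' y hyK' p ⟨hpF, hpK⟩).1
    have e2 := (hl' z hzK' p ⟨hpF, hpK⟩).1
    have e3 := (hl' p hpF q ⟨hqF, hqK⟩).1
    have e4 : l' y + l' z = l' p + l' q := by rw [← map_add, ← map_add, hsum]
    have e5 := (hl' q hqF p ⟨hpF, hpK⟩).1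
    linarith
  have hzK : z ∈ K.carrier := by
    refine (hl' z hzK' p ⟨hpF, hpK⟩).2 ?_
    have e1 := (hl' y hyK' p ⟨hpF, hpK⟩).1
    have e2 := (hl' z hzK' p ⟨hpF, hpK⟩).1
    have e3 := (hl' p hpF q ⟨hqF, hqK⟩).1
    have e4 : l' y + l' z = l' p + l' q := by rw [← map_add, ← map_add, hsum]
    have e5 := (hl' q hqF p ⟨hpF, hpK⟩).1
    linarith
  -- The `i`-th coordinates of `y` and `z` are those of `p` plus and minus the same number. Since
  -- `p` has coordinate 0 or 1, that number vanishes.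
  have hcoord : ∀ i, i ≠ j → K.edge.repr (b • K'.edge k) i = 0 := by
    intro i hij
    have e1 := K.mem_carrier.1 hyK i
    have e2 := K.mem_carrier.1 hzK i
    have e3 : K.coord i z = K.coord i q - K.edge.repr (b • K'.edge k) i := by
      rw [hz, Cell.coord_add, neg_smul, map_neg]
      simp [sub_eq_add_neg]
    rw [hy, Cell.coord_add] at e1
    rw [e3, hqc, if_neg hij] at e2
    rcases hpc01 i with h | h <;> rw [h] at e1 e2 <;> linarith [e1.1, e1.2, e2.1, e2.2]
  have hpar : b • K'.edge k = (K.edge.repr (b • K'.edge k) j) • K.edge j := by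
    conv_lhs => rw [← K.edge.sum_repr (b • K'.edge k)]
    rw [Finset.sum_eq_single j]
    · intro i _ hij
      rw [hcoord i hij, zero_smul]
    · simp
  set t := K.edge.repr (b • K'.edge k) j with ht
  have ht0 : t ≠ 0 := by
    intro h
    rw [h, zero_smul] at hpar
    exact (smul_ne_zero hk (K'.edge.ne_zero k)) hpar
  refine ⟨k, t⁻¹ * b, ?_⟩
  rw [mul_smul, hpar, smul_smul, inv_mul_cancel₀ ht0, one_smul]

/-- On a common face, the interpolants from both sides agree. -/
lemma interp_eq_of_mem_inter (T : Mesh d) {K K' : Cell d} (hK : K ∈ T.cells) (hK' : K' ∈ T.cells)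
    (g : Pt d → ℝ) {x : Pt d} (hx : x ∈ K.carrier) (hx' : x ∈ K'.carrier) :
    K.interp g x = K'.interp g x := by
  classical
  obtain ⟨l, hl⟩ := T.exists_functional hK hK' ⟨x, hx, hx'⟩
  induction hn : (Finset.univ.filter fun j => 0 < K.coord j x ∧ K.coord j x < 1).card
    using Nat.strong_induction_on generalizing x with
  | _ n ih =>
  have hxc := K.mem_carrier.1 hx
  -- Induction on the number of fractional coordinates. A fractional coordinate is moved to 0 and to
  -- 1 inside the common face; along this line both interpolants are affine because the edges are
  -- parallel.
  by_cases hex : ∃ j, 0 < K.coord j x ∧ K.coord j x < 1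
  · obtain ⟨j, h0, h1⟩ := hex
    obtain ⟨k, c, hkc⟩ := T.exists_parallel_edge hK hK' ⟨hx, hx'⟩ h0 h1
    set x0 := x + (-K.coord j x) • K.edge j with hx0
    have hx0c : ∀ i, K.coord i x0 = if i = j then 0 else K.coord i x := by
      intro i
      rw [hx0, Cell.coord_add_smul_edge]
      split_ifs with h
      · subst h; ring
      · ring
    set x1 := x0 + K.edge j with hx1
    have hx1c : ∀ i, K.coord i x1 = if i = j then 1 else K.coord i x := by
      intro i
      have := K.coord_add_smul_edge x0 1 i j
      rw [one_smul] at this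
      rw [hx1, this, hx0c]
      split_ifs <;> ring
    have hx0K : x0 ∈ K.carrier := by
      rw [Cell.mem_carrier]; intro i; rw [hx0c]; split_ifs
      · simp
      · exact hxc i
    have hx1K : x1 ∈ K.carrier := by
      rw [Cell.mem_carrier]; intro i; rw [hx1c]; split_ifs
      · simp
      · exact hxc i
    have hx0K' : x0 ∈ K'.carrier := mem_of_coord_eq hl ⟨hx, hx'⟩ hx0K fun i hi => by
      rw [hx0c] at hi
      split_ifs at hi with h
      · subst h; exact ⟨h0, h1⟩
      · exact absurd rfl hi
    have hx1K' : x1 ∈ K'.carrier := mem_of_coord_eq hl ⟨hx, hx'⟩ hx1K fun i hi => by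
      rw [hx1c] at hi
      split_ifs at hi with h
      · subst h; exact ⟨h0, h1⟩
      · exact absurd rfl hi
    have hcard : ∀ y : Pt d, ∀ a : ℝ, (a = 0 ∨ a = 1) →
        (∀ i, K.coord i y = if i = j then a else K.coord i x) →
        (Finset.univ.filter fun i => 0 < K.coord i y ∧ K.coord i y < 1).card < n := by
      intro y a ha hy
      rw [← hn]
      refine Finset.card_lt_card ⟨fun i hi => ?_, fun hsub => ?_⟩
      · simp only [Finset.mem_filter, Finset.mem_univ, true_and] at hi ⊢
        rw [hy] at hi
        split_ifs at hi with h
        · rcases ha with rfl | rfl <;> linarith [hi.1, hi.2]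
        · exact hi
      · have hj := hsub (Finset.mem_filter.2 ⟨Finset.mem_univ j, h0, h1⟩)
        simp only [Finset.mem_filter, Finset.mem_univ, true_and] at hj
        rw [hy, if_pos rfl] at hj
        rcases ha with rfl | rfl <;> linarith [hj.1, hj.2]
    have e0 := ih _ (hcard x0 0 (Or.inl rfl) hx0c) hx0K hx0K' rfl
    have e1 := ih _ (hcard x1 1 (Or.inr rfl) hx1c) hx1K hx1K' rfl
    have hxt : x = x0 + K.coord j x • K.edge j := by
      rw [hx0, add_assoc, ← add_smul]; simp
    have hl1 := K.interp_line g x0 (K.edge j) j 1 (one_smul _ _).symm (K.coord j x)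
    have hl2 := K'.interp_line g x0 (K.edge j) k c hkc (K.coord j x)
    rw [← hxt] at hl1 hl2
    rw [hl1, hl2, e0, ← hx1, e1]
  · push Not at hex
    set s : Finset (Fin d) := Finset.univ.filter fun i => K.coord i x = 1 with hs
    have hxv : x = K.vertex s := by
      refine K.ext_coord fun i => ?_
      rw [Cell.coord_vertex]
      by_cases h : K.coord i x = 1
      · simp [hs, h]
      · have : ¬ 0 < K.coord i x := fun h0 =>
          absurd (lt_of_le_of_ne (hxc i).2 h) (not_lt.2 (hex i h0))
        have h0 : K.coord i x = 0 := le_antisymm (not_lt.1 this) (hxc i).1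
        simp [hs, h0]
    have hx'c := K'.mem_carrier.1 hx'
    obtain ⟨l', hl'⟩ := T.exists_functional hK' hK ⟨x, hx', hx⟩
    -- A vertex of `K` is also a vertex of `K'`: otherwise a segment in the common face, parallel to
    -- an edge of `K`, would extend on both sides of `x`, where the corresponding coordinate of `K`
    -- is already 0 or 1.
    have hex' : ∀ k, ¬ (0 < K'.coord k x ∧ K'.coord k x < 1) := by
      rintro k ⟨h0, h1⟩
      obtain ⟨i, c, hic⟩ := T.exists_parallel_edge hK' hK ⟨hx', hx⟩ h0 h1
      have hc0 : c ≠ 0 := by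
        rintro rfl
        rw [zero_smul] at hic
        exact K'.edge.ne_zero k hic
      have hmem : ∀ a : ℝ, 0 ≤ K'.coord k x + a → K'.coord k x + a ≤ 1 →
          0 ≤ K.coord i x + a * c ∧ K.coord i x + a * c ≤ 1 := by
        intro a ha0 ha1
        have hK'a : x + a • K'.edge k ∈ K'.carrier := by
          rw [Cell.mem_carrier]; intro m
          rw [Cell.coord_add_smul_edge]
          split_ifs with h
          · subst h; exact ⟨ha0, ha1⟩
          · rw [add_zero]; exact hx'c m
        have hKa : x + a • K'.edge k ∈ K.carrier :=
          mem_of_coord_eq hl' ⟨hx', hx⟩ hK'a fun m hm => by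
            rw [Cell.coord_add_smul_edge] at hm
            split_ifs at hm with h
            · subst h; exact ⟨h0, h1⟩
            · exact absurd (add_zero _) hm
        have := K.mem_carrier.1 hKa i
        rw [hic, smul_smul, Cell.coord_add_smul_edge, if_pos rfl] at this
        exact this
      have ha := hmem (-K'.coord k x) (by linarith) (by linarith)
      have hb := hmem (1 - K'.coord k x) (by linarith) (by linarith)
      have hxi : K.coord i x = 0 ∨ K.coord i x = 1 := by
        rw [hxv, Cell.coord_vertex]; split_ifs <;> simp
      rcases lt_or_gt_of_ne hc0 with hc | hc <;> rcases hxi with h | h <;> rw [h] at ha hb <;>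
        nlinarith [ha.1, ha.2, hb.1, hb.2]
    set s' : Finset (Fin d) := Finset.univ.filter fun i => K'.coord i x = 1 with hs'
    have hxv' : x = K'.vertex s' := by
      refine K'.ext_coord fun i => ?_
      rw [Cell.coord_vertex]
      by_cases h : K'.coord i x = 1
      · simp [hs', h]
      · have : ¬ 0 < K'.coord i x := fun h0 => hex' i ⟨h0, lt_of_le_of_ne (hx'c i).2 h⟩
        have h0 : K'.coord i x = 0 := le_antisymm (not_lt.1 this) (hx'c i).1
        simp [hs', h0]
    have e1 := K.interp_vertex g s
    have e2 := K'.interp_vertex g s'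
    rw [← hxv] at e1
    rw [← hxv'] at e2
    rw [e1, e2]

lemma interp_eq (T : Mesh d) {K : Cell d} (hK : K ∈ T.cells) (g : Pt d → ℝ) {x : Pt d}
    (hx : x ∈ K.carrier) : T.interp g x = K.interp g x := by
  have h : ∃ K ∈ T.cells, x ∈ K.carrier := ⟨K, hK, hx⟩
  rw [Mesh.interp, dif_pos h]
  exact T.interp_eq_of_mem_inter h.choose_spec.1 hK g h.choose_spec.2 hx

lemma mem_closedDomain (T : Mesh d) {x : Pt d} :
    x ∈ T.closedDomain ↔ ∃ K ∈ T.cells, x ∈ K.carrier := by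
  simp [Mesh.closedDomain]

lemma interp_of_notMem (T : Mesh d) (g : Pt d → ℝ) {x : Pt d} (hx : x ∉ T.closedDomain) :
    T.interp g x = 0 := by
  rw [mem_closedDomain] at hx
  rw [Mesh.interp, dif_neg hx]

lemma interp_vertex (T : Mesh d) {K : Cell d} (hK : K ∈ T.cells) (g : Pt d → ℝ)
    (s : Finset (Fin d)) : T.interp g (K.vertex s) = g (K.vertex s) := by
  rw [T.interp_eq hK g (K.vertex_mem s), Cell.interp_vertex]

end Mesh

/-! ### Gluing Lipschitz bounds along a finite closed cover. -/

open Filter Topology in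
/-- A function that is Lipschitz on each member of a finite closed cover of a normed space is
Lipschitz. -/
lemma abs_sub_le_of_finite_closed_cover {E : Type*} [NormedAddCommGroup E] [NormedSpace ℝ E]
    {ι : Type*} [Finite ι] {S : ι → Set E} (hcl : ∀ i, IsClosed (S i)) (hcov : ∀ x, ∃ i, x ∈ S i)
    {v : E → ℝ} {L : ℝ} (hL : ∀ i, ∀ x ∈ S i, ∀ y ∈ S i, |v x - v y| ≤ L * dist x y) (x y : E) :
    |v x - v y| ≤ L * dist x y := by
  -- Near `x` the finitely many closed sets that miss `x` can be avoided, so every nearby `y` shares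
  -- a member of the cover with `x`.
  have hloc : ∀ x, ∀ᶠ y in 𝓝 x, |v y - v x| ≤ L * dist y x := by
    intro x
    have : ∀ᶠ y in 𝓝 x, ∀ i, y ∈ S i → x ∈ S i := by
      rw [eventually_all]
      intro i
      by_cases h : x ∈ S i
      · exact Eventually.of_forall fun _ _ => h
      · filter_upwards [(hcl i).isOpen_compl.mem_nhds h] with y hy hy'
        exact absurd hy' hy
    filter_upwards [this] with y hy
    obtain ⟨i, hi⟩ := hcov y
    exact hL i y hi x (hy i hi)
  have hcont : Continuous v := by
    rw [continuous_iff_continuousAt]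
    intro x
    rw [ContinuousAt, tendsto_iff_dist_tendsto_zero]
    refine squeeze_zero' (Eventually.of_forall fun _ => dist_nonneg) (hloc x) ?_
    have : Continuous fun y => L * dist y x := by fun_prop
    simpa using this.tendsto x
  set γ : ℝ → E := fun t => x + t • (y - x) with hγ
  have hγc : Continuous γ := by fun_prop
  have hγd : ∀ s t : ℝ, dist (γ s) (γ t) = |s - t| * dist x y := by
    intro s t
    rw [hγ]
    simp only [dist_add_left]
    rw [dist_eq_norm, ← sub_smul, norm_smul, Real.norm_eq_abs, dist_comm x y, dist_eq_norm]
  set f : ℝ → ℝ := fun t => v (γ t) - v x with hf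
  have hfc : Continuous f := (hcont.comp hγc).sub continuous_const
  -- The comparison of slopes along the segment needs a strict inequality; the slack `η` provides it
  -- and is removed at the end.
  have key : ∀ η > 0, |f 1| ≤ L * dist x y + η := by
    intro η hη
    have h := image_norm_le_of_liminf_right_slope_norm_lt_deriv_boundary (a := 0) (b := 1)
      (f := f) (f' := fun _ => L * dist x y) (B := fun t => (L * dist x y + η) * t)
      (B' := fun _ => L * dist x y + η) hfc.continuousOn ?_ (by simp [hf, hγ]) (by fun_prop)
      (fun t _ => by
        simpa using ((hasDerivAt_id t).const_mul (L * dist x y + η)).hasDerivWithinAt)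
      (fun t _ _ => by linarith) (Set.right_mem_Icc.2 zero_le_one)
    · simpa using h
    · intro t _ r hr
      refine Eventually.frequently ?_
      have h1 : ∀ᶠ s in 𝓝[>] t, |v (γ s) - v (γ t)| ≤ L * dist (γ s) (γ t) :=
        (hγc.continuousAt.eventually (hloc (γ t))).filter_mono nhdsWithin_le_nhds
      filter_upwards [h1, self_mem_nhdsWithin] with s hs hst
      have hst' : 0 < s - t := sub_pos.2 hst
      rw [hγd, abs_of_pos hst'] at hs
      refine lt_of_le_of_lt ?_ hr
      rw [slope_def_field, div_le_iff₀ hst']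
      have h2 : ‖f s‖ - ‖f t‖ ≤ ‖f s - f t‖ := norm_sub_norm_le _ _
      have h3 : f s - f t = v (γ s) - v (γ t) := by simp [hf]
      rw [h3] at h2
      have h4 : ‖v (γ s) - v (γ t)‖ = |v (γ s) - v (γ t)| := Real.norm_eq_abs _
      rw [h4] at h2
      simp only [Function.comp]
      nlinarith
  have h1 : f 1 = v y - v x := by simp [hf, hγ]
  rw [abs_sub_comm, ← h1]
  exact le_of_forall_pos_le_add key

/-! ### Boundary values and the finite element space. -/

namespace Mesh

variable {d : ℕ}

lemma domain_subset (T : Mesh d) : T.domain ⊆ T.closedDomain := interior_subset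

open Filter Topology in
/-- If `x` is on the boundary, then so is every point of the smallest face containing `x`. -/
lemma notMem_domain_of_coord_eq (T : Mesh d) {K : Cell d} (hK : K ∈ T.cells) {x y : Pt d}
    (hx : x ∈ K.carrier) (hy : y ∈ K.carrier) (hxy : ∀ j, K.coord j y ≠ K.coord j x →
      0 < K.coord j x ∧ K.coord j x < 1) (hxd : x ∉ T.domain) : y ∉ T.domain := by
  intro hyd
  apply hxd
  have hxc := K.mem_carrier.1 hx
  have hyc := K.mem_carrier.1 hy
  obtain ⟨ε, hε0, hε1, hεd⟩ : ∃ ε : ℝ, 0 < ε ∧ ε < 1 ∧ (1 - ε) • y + ε • x ∈ T.domain := by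
    have hc : Continuous fun ε : ℝ => (1 - ε) • y + ε • x := by fun_prop
    have h1 : ∀ᶠ ε : ℝ in 𝓝[>] 0, (1 - ε) • y + ε • x ∈ T.domain := by
      refine (hc.continuousAt.eventually ?_).filter_mono nhdsWithin_le_nhds
      have : (fun ε : ℝ => (1 - ε) • y + ε • x) 0 = y := by simp
      rw [this]
      exact isOpen_interior.mem_nhds hyd
    have h2 : ∀ᶠ ε : ℝ in 𝓝[>] 0, ε < 1 :=
      (eventually_lt_nhds zero_lt_one).filter_mono nhdsWithin_le_nhds
    obtain ⟨ε, h1, h2, h3⟩ := (h1.and (h2.and self_mem_nhdsWithin)).exists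
    exact ⟨ε, h3, h2, h1⟩
  -- A contraction towards `y`. It maps a neighbourhood of `x` into the domain, so `x` is an
  -- interior point as soon as, for `z` near `x`, every cell containing `ψ z` contains `z`.
  set ψ : Pt d → Pt d := fun z => (1 - ε) • y + ε • z with hψ
  have hψc : Continuous ψ := by fun_prop
  have hψcoord : ∀ (K' : Cell d) k z, K'.coord k (ψ z) =
      (1 - ε) * K'.coord k y + ε * K'.coord k z := fun K' k z =>
    K'.coord_convexComb y z (1 - ε) ε (by ring) k
  have hpull : ∀ K' ∈ T.cells, ∀ᶠ z in 𝓝 x, ψ z ∈ K'.carrier → z ∈ K'.carrier := by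
    intro K' hK'
    by_cases hx' : ψ x ∈ K'.carrier
    swap
    · filter_upwards [hψc.continuousAt.eventually
        (K'.isCompact_carrier.isClosed.isOpen_compl.mem_nhds hx')] with z hz hz'
      exact absurd hz' hz
    have hψK : ψ x ∈ K.carrier :=
      K.convex_carrier hy hx (by linarith) hε0.le (by ring)
    obtain ⟨l, hl⟩ := T.exists_functional hK hK' ⟨_, hψK, hx'⟩
    have hfrac : ∀ j, K.coord j y ≠ K.coord j x →
        0 < K.coord j (ψ x) ∧ K.coord j (ψ x) < 1 := by
      intro j hj
      obtain ⟨h0, h1⟩ := hxy j hj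
      rw [hψcoord]
      have := hyc j
      constructor <;> nlinarith [this.1, this.2]
    have hψeq : ∀ j, K.coord j y = K.coord j x → K.coord j (ψ x) = K.coord j x := by
      intro j hj
      rw [hψcoord, hj]; ring
    have hxK' : x ∈ K'.carrier := mem_of_coord_eq hl ⟨hψK, hx'⟩ hx fun j hj =>
      hfrac j fun h => hj (hψeq j h).symm
    have hyK' : y ∈ K'.carrier := mem_of_coord_eq hl ⟨hψK, hx'⟩ hy fun j hj =>
      hfrac j fun h => hj ((hψeq j h).trans h.symm).symm
    -- The segment from `y` to `x` can be prolonged beyond `x` within the face, hence within `K'`.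
    -- So a coordinate of `K'` that is 0 or 1 at `x` has the same value at `y`, and its sign
    -- condition at `ψ z` passes to `z`.
    obtain ⟨δ, hδ0, hδK⟩ : ∃ δ : ℝ, 0 < δ ∧ (1 + δ) • x + (-δ) • y ∈ K.carrier := by
      have hj : ∀ j, ∀ᶠ δ : ℝ in 𝓝[>] 0,
          (1 + δ) * K.coord j x + (-δ) * K.coord j y ∈ Set.Icc (0 : ℝ) 1 := by
        intro j
        by_cases h : K.coord j y = K.coord j x
        · refine Eventually.of_forall fun δ => ?_
          rw [h, show (1 + δ) * K.coord j x + (-δ) * K.coord j x = K.coord j x by ring]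
          exact hxc j
        · have hc : Continuous fun δ : ℝ => (1 + δ) * K.coord j x + (-δ) * K.coord j y := by
            fun_prop
          refine (hc.continuousAt.eventually (Icc_mem_nhds ?_ ?_)).filter_mono nhdsWithin_le_nhds
          · simpa using (hxy j h).1
          · simpa using (hxy j h).2
      obtain ⟨δ, h1, h2⟩ := ((eventually_all.2 hj).and self_mem_nhdsWithin).exists
      refine ⟨δ, h2, K.mem_carrier.2 fun j => ?_⟩
      rw [K.coord_convexComb x y _ _ (by ring)]
      exact h1 j
    have hδK' : (1 + δ) • x + (-δ) • y ∈ K'.carrier :=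
      mem_of_coord_eq hl ⟨hψK, hx'⟩ hδK fun j hj => hfrac j fun h => hj (by
        rw [K.coord_convexComb x y _ _ (by ring), hψeq j h, h]; ring)
    have hxk := K'.mem_carrier.1 hxK'
    have hyk := K'.mem_carrier.1 hyK'
    have hδk : ∀ k, (1 + δ) * K'.coord k x + (-δ) * K'.coord k y ∈ Set.Icc (0 : ℝ) 1 := by
      intro k
      have := K'.mem_carrier.1 hδK' k
      rwa [K'.coord_convexComb x y _ _ (by ring)] at this
    have hk : ∀ k, ∀ᶠ z in 𝓝 x, ψ z ∈ K'.carrier → K'.coord k z ∈ Set.Icc (0 : ℝ) 1 := by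
      intro k
      have hlt : K'.coord k x < 1 → ∀ᶠ z in 𝓝 x, K'.coord k z < 1 := fun h =>
        (K'.continuous_coord k).continuousAt.eventually (eventually_lt_nhds h)
      have hgt : 0 < K'.coord k x → ∀ᶠ z in 𝓝 x, 0 < K'.coord k z := fun h =>
        (K'.continuous_coord k).continuousAt.eventually (eventually_gt_nhds h)
      rcases eq_or_lt_of_le (hxk k).1 with h0 | h0
      · have hy0 : K'.coord k y = 0 := by
          have h2 := (hδk k).1
          rw [← h0] at h2
          nlinarith [(hyk k).1]
        filter_upwards [hlt (by rw [← h0]; exact zero_lt_one)] with z hz hzK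
        have h3 := (K'.mem_carrier.1 hzK k).1
        rw [hψcoord, hy0] at h3
        exact ⟨by nlinarith, hz.le⟩
      · rcases eq_or_lt_of_le (hxk k).2 with h1 | h1
        · have hy1 : K'.coord k y = 1 := by
            have h2 := (hδk k).2
            rw [h1] at h2
            nlinarith [(hyk k).2]
          filter_upwards [hgt h0] with z hz hzK
          have h3 := (K'.mem_carrier.1 hzK k).2
          rw [hψcoord, hy1] at h3
          exact ⟨hz.le, by nlinarith⟩
        · filter_upwards [hgt h0, hlt h1] with z hz1 hz2 _
          exact ⟨hz1.le, hz2.le⟩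
    filter_upwards [eventually_all.2 hk] with z hz hzK
    exact K'.mem_carrier.2 fun k => hz k hzK
  rw [Mesh.domain, mem_interior_iff_mem_nhds]
  have h1 : ∀ᶠ z in 𝓝 x, ψ z ∈ T.closedDomain :=
    (hψc.continuousAt.eventually (isOpen_interior.mem_nhds hεd)).mono fun z hz =>
      interior_subset hz
  have h2 : ∀ᶠ z in 𝓝 x, ∀ K' ∈ T.cells, ψ z ∈ K'.carrier → z ∈ K'.carrier :=
    (eventually_all_finset T.cells).2 hpull
  filter_upwards [h1, h2] with z hz1 hz2
  obtain ⟨K', hK', hz⟩ := T.mem_closedDomain.1 hz1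
  exact T.mem_closedDomain.2 ⟨K', hK', hz2 K' hK' hz⟩

/-- A shape function that does not vanish at a boundary point `x` belongs to a vertex of the
smallest face containing `x`, and such a vertex is on the boundary as well. -/
lemma interp_eq_zero_of_notMem_domain (T : Mesh d) {g : Pt d → ℝ} (hg : ∀ x ∉ T.domain, g x = 0)
    {x : Pt d} (hx : x ∉ T.domain) : T.interp g x = 0 := by
  by_cases hxc : x ∈ T.closedDomain
  swap
  · exact T.interp_of_notMem g hxc
  obtain ⟨K, hK, hxK⟩ := T.mem_closedDomain.1 hxc
  rw [T.interp_eq hK g hxK, Cell.interp_eq_sum_shape]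
  refine Finset.sum_eq_zero fun s _ => ?_
  by_cases h : Cell.shape s (fun j => K.coord j x) = 0
  · rw [h, mul_zero]
  · rw [hg, zero_mul]
    refine T.notMem_domain_of_coord_eq hK hxK (K.vertex_mem s) (fun j hj => ?_) hx
    have hne : (if j ∈ s then K.coord j x else 1 - K.coord j x) ≠ 0 := fun h0 =>
      h (Finset.prod_eq_zero (Finset.mem_univ j) h0)
    have hxj := K.mem_carrier.1 hxK j
    rw [Cell.coord_vertex] at hj
    split_ifs at hne hj
    · exact ⟨lt_of_le_of_ne hxj.1 (Ne.symm hne), lt_of_le_of_ne hxj.2 (Ne.symm hj)⟩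
    · exact ⟨lt_of_le_of_ne hxj.1 hj, lt_of_le_of_ne hxj.2 fun h => hne (by linarith)⟩

/-- The closed cells together with the complement of the domain. -/
def closedCover (T : Mesh d) : Option {K // K ∈ T.cells} → Set (Pt d)
  | none => T.domainᶜ
  | some K => K.1.carrier

lemma isClosed_closedCover (T : Mesh d) (i) : IsClosed (T.closedCover i) := by
  cases i with
  | none => exact isOpen_interior.isClosed_compl
  | some K => exact K.1.isCompact_carrier.isClosed

lemma exists_mem_closedCover (T : Mesh d) (x : Pt d) : ∃ i, x ∈ T.closedCover i := by
  by_cases h : x ∈ T.domain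
  · obtain ⟨K, hK, hx⟩ := T.mem_closedDomain.1 (T.domain_subset h)
    exact ⟨some ⟨K, hK⟩, hx⟩
  · exact ⟨none, h⟩

lemma interp_mem_femSpace (T : Mesh d) {g : Pt d → ℝ} (hg : ∀ x ∉ T.domain, g x = 0) :
    T.interp g ∈ T.femSpace := by
  refine ⟨?_, fun x hx => T.interp_eq_zero_of_notMem_domain hg hx, fun K hK =>
    Cell.isQ1_of_eq_interp (g := g) fun x hx => T.interp_eq hK g hx⟩
  refine (locallyFinite_of_finite T.closedCover).continuous
    (Set.iUnion_eq_univ_iff.2 T.exists_mem_closedCover) T.isClosed_closedCover fun i => ?_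
  cases i with
  | none =>
    exact (continuousOn_const (c := (0 : ℝ))).congr fun x hx =>
      T.interp_eq_zero_of_notMem_domain hg hx
  | some K =>
    exact (K.1.continuous_interp g).continuousOn.congr fun x hx => T.interp_eq K.2 g hx

lemma eq_interp_of_mem (T : Mesh d) {v : Pt d → ℝ} (hv : v ∈ T.femSpace) {K : Cell d}
    (hK : K ∈ T.cells) {x : Pt d} (hx : x ∈ K.carrier) : v x = K.interp v x :=
  (hv.2.2 K hK).eq_interp hx

lemma ext_of_mem (T : Mesh d) {v w : Pt d → ℝ} (hv : v ∈ T.femSpace) (hw : w ∈ T.femSpace)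
    (h : ∀ K ∈ T.cells, ∀ s, v (K.vertex s) = w (K.vertex s)) : v = w := by
  ext x
  by_cases hx : x ∈ T.closedDomain
  · obtain ⟨K, hK, hxK⟩ := T.mem_closedDomain.1 hx
    rw [T.eq_interp_of_mem hv hK hxK, T.eq_interp_of_mem hw hK hxK, K.interp_congr (h K hK)]
  · rw [hv.2.1 x fun h => hx (T.domain_subset h), hw.2.1 x fun h => hx (T.domain_subset h)]

/-- The finite element space as a vector space. -/
def fem (T : Mesh d) : Submodule ℝ (Pt d → ℝ) where
  carrier := T.femSpace
  zero_mem' := ⟨continuous_const, fun _ _ => rfl, fun K _ => ⟨0, fun x _ => by simp⟩⟩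
  add_mem' := by
    rintro v w ⟨hv1, hv2, hv3⟩ ⟨hw1, hw2, hw3⟩
    refine ⟨hv1.add hw1, fun x hx => by simp [hv2 x hx, hw2 x hx], fun K hK => ?_⟩
    obtain ⟨a, ha⟩ := hv3 K hK
    obtain ⟨b, hb⟩ := hw3 K hK
    refine ⟨a + b, fun x hx => ?_⟩
    simp [ha x hx, hb x hx, add_mul, Finset.sum_add_distrib]
  smul_mem' := by
    rintro c v ⟨hv1, hv2, hv3⟩
    refine ⟨hv1.const_smul c, fun x hx => by simp [hv2 x hx], fun K hK => ?_⟩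
    obtain ⟨a, ha⟩ := hv3 K hK
    refine ⟨c • a, fun x hx => ?_⟩
    simp [ha x hx, Finset.mul_sum, mul_assoc]

/-- The finite element functions that vanish outside of `ω`, as a vector space. -/
def femOn (T : Mesh d) (ω : Set (Pt d)) : Submodule ℝ (Pt d → ℝ) where
  carrier := T.femSpaceOn ω
  zero_mem' := ⟨T.fem.zero_mem, fun _ _ => rfl⟩
  add_mem' := by
    rintro v w ⟨hv1, hv2⟩ ⟨hw1, hw2⟩
    exact ⟨T.fem.add_mem hv1 hw1, fun x hx => by simp [hv2 x hx, hw2 x hx]⟩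
  smul_mem' := by
    rintro c v ⟨hv1, hv2⟩
    exact ⟨T.fem.smul_mem c hv1, fun x hx => by simp [hv2 x hx]⟩

/-- Every cell contains a ball of radius `r`. -/
def HasInradius (T : Mesh d) (r : ℝ) : Prop := ∀ K ∈ T.cells, ∃ c, Metric.ball c r ⊆ K.carrier

lemma HasInradius.interior_nonempty {T : Mesh d} {r : ℝ} (h : T.HasInradius r) (hr : 0 < r)
    {K : Cell d} (hK : K ∈ T.cells) : (interior K.carrier).Nonempty := by
  obtain ⟨c, hc⟩ := h K hK
  exact ⟨c, interior_maximal hc Metric.isOpen_ball (Metric.mem_ball_self hr)⟩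

lemma HasInradius.closure_interior {T : Mesh d} {r : ℝ} (h : T.HasInradius r) (hr : 0 < r)
    {K : Cell d} (hK : K ∈ T.cells) : closure (interior K.carrier) = K.carrier := by
  rw [K.convex_carrier.closure_interior_eq_closure_of_nonempty_interior
    (h.interior_nonempty hr hK), K.isCompact_carrier.isClosed.closure_eq]

/-- Finite element functions are Lipschitz. -/
lemma exists_lipschitzWith (T : Mesh d) {r : ℝ} (hr : 0 < r) (hT : T.HasInradius r)
    {v : Pt d → ℝ} (hv : v ∈ T.femSpace) : ∃ L, LipschitzWith L v := by
  set L : ℝ := ∑ K ∈ T.cells, 2 * d / r * K.nodalSum v with hLdef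
  have hnn : ∀ K ∈ T.cells, 0 ≤ 2 * d / r * K.nodalSum v := fun K _ =>
    mul_nonneg (by positivity) (K.nodalSum_nonneg v)
  have hL : 0 ≤ L := Finset.sum_nonneg hnn
  have h := abs_sub_le_of_finite_closed_cover T.isClosed_closedCover T.exists_mem_closedCover
    (v := v) (L := L) (by
      intro i x hx y hy
      cases i with
      | none =>
        rw [hv.2.1 x hx, hv.2.1 y hy, sub_self, abs_zero]
        positivity
      | some K =>
        obtain ⟨c, hc⟩ := hT K.1 K.2
        rw [T.eq_interp_of_mem hv K.2 hx, T.eq_interp_of_mem hv K.2 hy]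
        refine (K.1.abs_interp_sub_le hr hc v hx hy).trans ?_
        exact mul_le_mul_of_nonneg_right (Finset.single_le_sum
          (f := fun K : Cell d => 2 * d / r * K.nodalSum v) hnn K.2) dist_nonneg)
  refine ⟨L.toNNReal, LipschitzWith.of_dist_le_mul fun x y => ?_⟩
  rw [Real.dist_eq, Real.coe_toNNReal _ hL]
  exact h x y

/-! ### Layers -/

/-- The union of the cells that meet `S`. -/
def cellHull (T : Mesh d) (S : Set (Pt d)) : Set (Pt d) :=
  ⋃ K ∈ T.cells, ⋃ (_ : (S ∩ K.carrier).Nonempty), K.carrier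

lemma mem_cellHull (T : Mesh d) {S : Set (Pt d)} {x : Pt d} :
    x ∈ T.cellHull S ↔ ∃ K ∈ T.cells, (S ∩ K.carrier).Nonempty ∧ x ∈ K.carrier := by
  simp only [cellHull, Set.mem_iUnion, exists_prop]

lemma isClosed_cellHull (T : Mesh d) (S : Set (Pt d)) : IsClosed (T.cellHull S) :=
  T.cells.finite_toSet.isClosed_biUnion fun K _ =>
    isClosed_iUnion_of_finite fun _ => K.isCompact_carrier.isClosed

/-- Each cell is the closure of its interior. Hence iterated patches can be described by closed
unions of cells, without taking interiors in between. -/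
lemma closure_interior_cellHull (T : Mesh d) {r : ℝ} (hr : 0 < r) (hT : T.HasInradius r)
    (S : Set (Pt d)) : closure (interior (T.cellHull S)) = T.cellHull S := by
  refine (closure_minimal interior_subset (T.isClosed_cellHull S)).antisymm fun x hx => ?_
  obtain ⟨K, hK, hS, hxK⟩ := T.mem_cellHull.1 hx
  have hsub : K.carrier ⊆ T.cellHull S := fun y hy => T.mem_cellHull.2 ⟨K, hK, hS, hy⟩
  rw [← hT.closure_interior hr hK] at hxK
  exact closure_mono (interior_mono hsub) hxK

/-- The closed patches of `l` layers of cells around `ω`. -/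
def closedLayers (T : Mesh d) (ω : Set (Pt d)) : ℕ → Set (Pt d)
  | 0 => closure ω
  | l + 1 => T.cellHull (T.closedLayers ω l)

lemma layers_succ (T : Mesh d) {r : ℝ} (hr : 0 < r) (hT : T.HasInradius r) (ω : Set (Pt d))
    (l : ℕ) : T.layers ω (l + 1) = interior (T.closedLayers ω (l + 1)) := by
  induction l with
  | zero => rfl
  | succ l ih =>
    have : T.layers ω (l + 2) = interior (T.cellHull (closure (T.layers ω (l + 1)))) := rfl
    rw [this, ih]
    congr 2
    exact T.closure_interior_cellHull hr hT _

lemma closedLayers_succ_of_mem (T : Mesh d) {ω : Set (Pt d)} {K : Cell d} (hK : K ∈ T.cells)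
    {x y : Pt d} (hx : x ∈ K.carrier) (hy : y ∈ K.carrier) {l : ℕ}
    (h : x ∈ T.closedLayers ω l) : y ∈ T.closedLayers ω (l + 1) :=
  T.mem_cellHull.2 ⟨K, hK, ⟨x, h, hx⟩, hy⟩

lemma closedLayers_mono_of_mem (T : Mesh d) {ω : Set (Pt d)} {K : Cell d} (hK : K ∈ T.cells)
    {x : Pt d} (hx : x ∈ K.carrier) {l m : ℕ} (hlm : l ≤ m) (h : x ∈ T.closedLayers ω l) :
    x ∈ T.closedLayers ω m := by
  induction m, hlm using Nat.le_induction with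
  | base => exact h
  | succ m _ ih => exact T.closedLayers_succ_of_mem hK hx hx ih

/-- The interior of a cell meets a union of cells only if the cell is one of them. -/
lemma eq_of_mem_interior (T : Mesh d) {r : ℝ} (hr : 0 < r) (hT : T.HasInradius r)
    {K K' : Cell d} (hK : K ∈ T.cells) (hK' : K' ∈ T.cells) {x : Pt d}
    (hx : x ∈ interior K.carrier) (hx' : x ∈ K'.carrier) : K = K' := by
  by_contra hne
  have hd := T.nonoverlapping K hK K' hK' hne
  rw [← hT.closure_interior hr hK'] at hx'
  exact (hd.closure_right isOpen_interior).le_bot ⟨hx, hx'⟩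

end Mesh

/-- An elliptic coefficient on a mesh whose cells contain balls of radius `r`. -/
structure Problem (d : ℕ) where
  T : Mesh d
  A : Pt d → ℝ
  r : ℝ
  α : ℝ
  β : ℝ
  r_pos : 0 < r
  inradius : T.HasInradius r
  α_pos : 0 < α
  measA : AEMeasurable A (volume.restrict T.domain)
  boundA : ∀ᵐ x ∂(volume.restrict T.domain), α ≤ A x ∧ A x ≤ β

/-! ### Integration over cells and gradients. -/

namespace Mesh

variable {d : ℕ}

lemma isCompact_closedDomain (T : Mesh d) : IsCompact T.closedDomain :=
  T.cells.isCompact_biUnion fun K _ => K.isCompact_carrier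

lemma hasCompactSupport_of_mem (T : Mesh d) {v : Pt d → ℝ} (hv : v ∈ T.femSpace) :
    HasCompactSupport v :=
  HasCompactSupport.intro T.isCompact_closedDomain fun x hx =>
    hv.2.1 x fun h => hx (T.domain_subset h)

lemma interior_carrier_subset (T : Mesh d) {K : Cell d} (hK : K ∈ T.cells) :
    interior K.carrier ⊆ T.domain :=
  interior_mono fun _ hx => T.mem_closedDomain.2 ⟨K, hK, hx⟩

lemma volume_frontier_carrier (K : Cell d) : volume (frontier K.carrier) = 0 :=
  K.convex_carrier.addHaar_frontier volume

lemma interior_carrier_ae_eq (K : Cell d) : interior K.carrier =ᵐ[volume] K.carrier :=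
  interior_ae_eq_of_null_frontier (volume_frontier_carrier K)

lemma volume_domain_diff (T : Mesh d) :
    volume (T.closedDomain \ ⋃ K ∈ T.cells, interior K.carrier) = 0 := by
  have hsub : T.closedDomain \ ⋃ K ∈ T.cells, interior K.carrier ⊆
      ⋃ K ∈ T.cells, frontier K.carrier := by
    rintro x ⟨hx, hx'⟩
    obtain ⟨K, hK, hxK⟩ := T.mem_closedDomain.1 hx
    refine Set.mem_biUnion (x := K) hK ?_
    rw [K.isCompact_carrier.isClosed.frontier_eq]
    exact ⟨hxK, fun h => hx' (Set.mem_biUnion (x := K) hK h)⟩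
  refine measure_mono_null hsub ?_
  exact (measure_biUnion_null_iff T.cells.countable_toSet).2 fun K _ => volume_frontier_carrier K

lemma domain_ae_eq (T : Mesh d) :
    T.domain =ᵐ[volume] (⋃ K ∈ T.cells, interior K.carrier : Set (Pt d)) := by
  refine Filter.EventuallyLE.antisymm ?_ ?_
  · rw [ae_le_set]
    exact measure_mono_null (Set.sdiff_subset_sdiff_left T.domain_subset) T.volume_domain_diff
  · refine Filter.Eventually.of_forall fun x hx => ?_
    obtain ⟨K, hK, hxK⟩ := Set.mem_iUnion₂.1 hx
    exact T.interior_carrier_subset hK hxK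

/-- Integrals over the domain are sums of integrals over the cells. -/
lemma integral_domain (T : Mesh d) {F : Pt d → ℝ} (hF : IntegrableOn F T.domain) :
    ∫ x in T.domain, F x = ∑ K ∈ T.cells, ∫ x in interior K.carrier, F x := by
  rw [setIntegral_congr_set T.domain_ae_eq, integral_biUnion_finset]
  · exact fun K _ => isOpen_interior.measurableSet
  · exact fun K hK K' hK' hne => T.nonoverlapping K hK K' hK' hne
  · exact fun K hK => hF.mono_set (T.interior_carrier_subset hK)

lemma integral_interior_carrier (K : Cell d) (F : Pt d → ℝ) :
    ∫ x in interior K.carrier, F x = ∫ x in K.carrier, F x :=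
  setIntegral_congr_set (interior_carrier_ae_eq K)

lemma volume_interior_carrier (K : Cell d) :
    (volume : Measure (Pt d)).real (interior K.carrier) = volume.real K.carrier :=
  measureReal_congr (interior_carrier_ae_eq K)

/-- The bilinear form of the nodal values that dominates the `L²` inner product. -/
def nodalForm (T : Mesh d) (v w : Pt d → ℝ) : ℝ :=
  ∑ K ∈ T.cells, (volume : Measure (Pt d)).real K.carrier * (K.nodalSum v * K.nodalSum w)

lemma integral_domain_le (T : Mesh d) {F : Pt d → ℝ} (hF : IntegrableOn F T.domain)
    {G : Cell d → ℝ} (h : ∀ K ∈ T.cells, ∀ᵐ x ∂(volume.restrict (interior K.carrier)),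
      F x ≤ G K) :
    ∫ x in T.domain, F x ≤ ∑ K ∈ T.cells, (volume : Measure (Pt d)).real K.carrier * G K := by
  rw [T.integral_domain hF]
  refine Finset.sum_le_sum fun K hK => ?_
  have hfin : volume (interior K.carrier) ≠ ⊤ :=
    ((measure_mono interior_subset).trans_lt K.isCompact_carrier.measure_lt_top).ne
  have h1 := integral_mono_ae (hF.mono_set (T.interior_carrier_subset hK))
    (integrableOn_const hfin) (h K hK)
  refine h1.trans (le_of_eq ?_)
  rw [setIntegral_const, volume_interior_carrier, smul_eq_mul]

lemma volume_domain_lt_top (T : Mesh d) : volume T.domain < ⊤ :=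
  (measure_mono T.domain_subset).trans_lt T.isCompact_closedDomain.measure_lt_top

lemma integrableOn_domain_of_continuous (T : Mesh d) {F : Pt d → ℝ} (hF : Continuous F) :
    IntegrableOn F T.domain :=
  (hF.continuousOn.integrableOn_compact T.isCompact_closedDomain).mono_set T.domain_subset

lemma measurable_gradient (v : Pt d → ℝ) : Measurable (gradient v) := by
  unfold gradient
  exact (LinearIsometryEquiv.continuous _).measurable.comp (measurable_fderiv ℝ v)

lemma norm_gradient (v : Pt d → ℝ) (x : Pt d) : ‖gradient v x‖ = ‖fderiv ℝ v x‖ := by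
  unfold gradient
  exact LinearIsometryEquiv.norm_map _ _

lemma gradient_add {v w : Pt d → ℝ} {x : Pt d} (hv : DifferentiableAt ℝ v x)
    (hw : DifferentiableAt ℝ w x) : gradient (v + w) x = gradient v x + gradient w x := by
  simp only [gradient]
  rw [fderiv_add hv hw, map_add]

lemma gradient_smul (c : ℝ) (v : Pt d → ℝ) (x : Pt d) :
    gradient (c • v) x = c • gradient v x := by
  simp only [gradient]
  rw [fderiv_const_smul_field, Pi.smul_apply, map_smulₛₗ]
  simp

end Mesh

/-! ### The mass and stiffness forms. -/

namespace Problem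

open Mesh

variable {d : ℕ} (P : Problem d)

lemma exists_norm_gradient_le {v : Pt d → ℝ} (hv : v ∈ P.T.femSpace) :
    ∃ L : ℝ, ∀ x, ‖gradient v x‖ ≤ L := by
  obtain ⟨L, hL⟩ := P.T.exists_lipschitzWith P.r_pos P.inradius hv
  exact ⟨L, fun x => by rw [norm_gradient]; exact norm_fderiv_le_of_lipschitz ℝ hL⟩

lemma ae_differentiableAt {v : Pt d → ℝ} (hv : v ∈ P.T.femSpace) :
    ∀ᵐ x, DifferentiableAt ℝ v x := by
  obtain ⟨L, hL⟩ := P.T.exists_lipschitzWith P.r_pos P.inradius hv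
  exact hL.ae_differentiableAt

lemma integrable_mul {v w : Pt d → ℝ} (hv : v ∈ P.T.femSpace) (hw : w ∈ P.T.femSpace) :
    IntegrableOn (fun x => v x * w x) P.T.domain :=
  P.T.integrableOn_domain_of_continuous (hv.1.mul hw.1)

lemma integrable_inner {v w : Pt d → ℝ} (hv : v ∈ P.T.femSpace) (hw : w ∈ P.T.femSpace) :
    IntegrableOn (fun x => P.A x * inner ℝ (gradient v x) (gradient w x)) P.T.domain := by
  obtain ⟨L, hL⟩ := P.exists_norm_gradient_le hv
  obtain ⟨L', hL'⟩ := P.exists_norm_gradient_le hw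
  have hfin : IsFiniteMeasure (volume.restrict P.T.domain) :=
    ⟨by rw [Measure.restrict_apply_univ]; exact P.T.volume_domain_lt_top⟩
  refine Integrable.of_bound (C := max |P.α| |P.β| * (L * L')) ?_ ?_
  · exact (P.measA.mul ((measurable_gradient v).inner
      (measurable_gradient w)).aemeasurable).aestronglyMeasurable
  · filter_upwards [P.boundA] with x hx
    rw [norm_mul]
    have hL0 : 0 ≤ L := (norm_nonneg _).trans (hL x)
    refine mul_le_mul ?_ ?_ (norm_nonneg _) (le_max_of_le_left (abs_nonneg _))
    · rw [Real.norm_eq_abs]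
      exact abs_le_max_abs_abs hx.1 hx.2
    · exact (norm_inner_le_norm _ _).trans (mul_le_mul (hL x) (hL' x) (norm_nonneg _) hL0)

/-- The `L²` inner product on the finite element space. -/
def mass : LinearMap.BilinForm ℝ P.T.fem :=
  LinearMap.mk₂ ℝ (fun v w => l2Inner P.T.domain v w)
    (fun u v w => by
      simp only [l2Inner, Submodule.coe_add, Pi.add_apply, add_mul]
      exact integral_add (P.integrable_mul u.2 w.2) (P.integrable_mul v.2 w.2))
    (fun c v w => by
      simp only [l2Inner, Submodule.coe_smul, Pi.smul_apply, smul_eq_mul, mul_assoc]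
      exact integral_const_mul _ _)
    (fun u v w => by
      simp only [l2Inner, Submodule.coe_add, Pi.add_apply, mul_add]
      exact integral_add (P.integrable_mul u.2 v.2) (P.integrable_mul u.2 w.2))
    (fun c v w => by
      simp only [l2Inner, Submodule.coe_smul, Pi.smul_apply, smul_eq_mul, mul_left_comm]
      exact integral_const_mul _ _)

lemma mass_apply (v w : P.T.fem) : P.mass v w = l2Inner P.T.domain v w := rfl

lemma mass_comm (v w : P.T.fem) : P.mass v w = P.mass w v := by
  simp [mass_apply, l2Inner, mul_comm]

lemma aForm_comm (A : Pt d → ℝ) (ω : Set (Pt d)) (v w : Pt d → ℝ) :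
    aForm A ω v w = aForm A ω w v := by
  simp only [aForm]
  congr 1
  ext x
  rw [real_inner_comm]

lemma aForm_add_left (u v w : P.T.fem) :
    aForm P.A P.T.domain (u + v : P.T.fem) w = aForm P.A P.T.domain u w +
      aForm P.A P.T.domain v w := by
  simp only [aForm]
  rw [← integral_add (P.integrable_inner u.2 w.2) (P.integrable_inner v.2 w.2)]
  refine integral_congr_ae ?_
  filter_upwards [ae_restrict_of_ae (P.ae_differentiableAt u.2),
    ae_restrict_of_ae (P.ae_differentiableAt v.2)] with x hu hv
  rw [Submodule.coe_add, gradient_add hu hv, inner_add_left, mul_add]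

lemma aForm_smul_left (c : ℝ) (v w : P.T.fem) :
    aForm P.A P.T.domain (c • v : P.T.fem) w = c * aForm P.A P.T.domain v w := by
  simp only [aForm]
  rw [← integral_const_mul]
  congr 1
  ext x
  rw [Submodule.coe_smul, gradient_smul, real_inner_smul_left]
  ring

/-- The energy inner product on the finite element space. -/
def stiff : LinearMap.BilinForm ℝ P.T.fem :=
  LinearMap.mk₂ ℝ (fun v w => aForm P.A P.T.domain v w)
    P.aForm_add_left P.aForm_smul_left
    (fun u v w => by
      rw [aForm_comm, aForm_add_left, aForm_comm _ _ (v : Pt d → ℝ), aForm_comm _ _ (w : Pt d → ℝ)])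
    (fun c v w => by rw [aForm_comm, aForm_smul_left, aForm_comm _ _ (w : Pt d → ℝ)]; rfl)

lemma stiff_apply (v w : P.T.fem) : P.stiff v w = aForm P.A P.T.domain v w := rfl

lemma stiff_comm (v w : P.T.fem) : P.stiff v w = P.stiff w v := aForm_comm _ _ _ _

lemma mass_self_nonneg (v : P.T.fem) : 0 ≤ P.mass v v :=
  integral_nonneg fun _ => mul_self_nonneg _

lemma stiff_self_nonneg (v : P.T.fem) : 0 ≤ P.stiff v v := by
  refine integral_nonneg_of_ae ?_
  filter_upwards [P.boundA] with x hx
  exact mul_nonneg (P.α_pos.le.trans hx.1) real_inner_self_nonneg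

/-! ### Bounds by nodal values -/

lemma abs_le_nodalSum {v : Pt d → ℝ} (hv : v ∈ P.T.femSpace) {K : Cell d} (hK : K ∈ P.T.cells)
    {x : Pt d} (hx : x ∈ K.carrier) : |v x| ≤ K.nodalSum v := by
  rw [P.T.eq_interp_of_mem hv hK hx]
  exact K.abs_interp_le v hx

lemma norm_gradient_le {v : Pt d → ℝ} (hv : v ∈ P.T.femSpace) {K : Cell d} (hK : K ∈ P.T.cells)
    {x : Pt d} (hx : x ∈ interior K.carrier) :
    ‖gradient v x‖ ≤ 2 * d / P.r * K.nodalSum v := by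
  rw [norm_gradient]
  have hnn : 0 ≤ 2 * d / P.r * K.nodalSum v :=
    mul_nonneg (div_nonneg (by positivity) P.r_pos.le) (K.nodalSum_nonneg v)
  have hlip : LipschitzOnWith (2 * d / P.r * K.nodalSum v).toNNReal v K.carrier := by
    refine LipschitzOnWith.of_dist_le_mul fun x hx y hy => ?_
    obtain ⟨c, hc⟩ := P.inradius K hK
    rw [Real.dist_eq, Real.coe_toNNReal _ hnn, P.T.eq_interp_of_mem hv hK hx,
      P.T.eq_interp_of_mem hv hK hy]
    exact K.abs_interp_sub_le P.r_pos hc v hx hy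
  have := norm_fderiv_le_of_lipschitzOn ℝ (mem_interior_iff_mem_nhds.1 hx) hlip
  rwa [Real.coe_toNNReal _ hnn] at this

lemma ae_interior_of_ae_domain {p : Pt d → Prop} (h : ∀ᵐ x ∂(volume.restrict P.T.domain), p x)
    {K : Cell d} (hK : K ∈ P.T.cells) : ∀ᵐ x ∂(volume.restrict (interior K.carrier)), p x :=
  ae_mono (Measure.restrict_mono (P.T.interior_carrier_subset hK) le_rfl) h

/-- Passing to nodal values pays off because nodal weights act on `nodalForm` cell by cell, whereas
they cannot be moved across the `L²` product. -/
lemma mass_le_nodalForm (v w : P.T.fem) : |P.mass v w| ≤ P.T.nodalForm v w := by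
  refine (abs_integral_le_integral_abs).trans ?_
  refine P.T.integral_domain_le (P.integrable_mul v.2 w.2).abs fun K hK => ?_
  filter_upwards [ae_restrict_mem isOpen_interior.measurableSet] with x hx
  rw [abs_mul]
  exact mul_le_mul (P.abs_le_nodalSum v.2 hK (interior_subset hx))
    (P.abs_le_nodalSum w.2 hK (interior_subset hx)) (abs_nonneg _) (K.nodalSum_nonneg _)

/-- The inverse inequality. -/
lemma stiff_le_nodalForm (v w : P.T.fem) :
    |P.stiff v w| ≤ P.β * (2 * d / P.r) ^ 2 * P.T.nodalForm v w := by
  refine (abs_integral_le_integral_abs).trans ?_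
  refine (P.T.integral_domain_le (P.integrable_inner v.2 w.2).abs (G := fun K =>
    P.β * (2 * d / P.r) ^ 2 * (K.nodalSum v * K.nodalSum w)) fun K hK => ?_).trans ?_
  · filter_upwards [ae_restrict_mem isOpen_interior.measurableSet,
      P.ae_interior_of_ae_domain P.boundA hK] with x hx hA
    have hA0 : 0 ≤ P.A x := P.α_pos.le.trans hA.1
    have hv := P.norm_gradient_le v.2 hK hx
    have hw := P.norm_gradient_le w.2 hK hx
    have hb := (abs_real_inner_le_norm (gradient (v : Pt d → ℝ) x)
      (gradient (w : Pt d → ℝ) x)).trans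
      (mul_le_mul hv hw (norm_nonneg _) ((norm_nonneg _).trans hv))
    rw [abs_mul, abs_of_nonneg hA0]
    refine (mul_le_mul hA.2 hb (abs_nonneg _) (hA0.trans hA.2)).trans (le_of_eq ?_)
    ring
  · rw [nodalForm, Finset.mul_sum]
    exact Finset.sum_le_sum fun K _ => le_of_eq (by ring)

/-- The `L²` norm on the finite element space. -/
def nrm (v : P.T.fem) : ℝ := √(P.mass v v)

lemma nrm_nonneg (v : P.T.fem) : 0 ≤ P.nrm v := Real.sqrt_nonneg _

lemma nrm_sq (v : P.T.fem) : P.nrm v ^ 2 = P.mass v v := Real.sq_sqrt (P.mass_self_nonneg v)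

lemma nodalForm_self_le (v : P.T.fem) : P.T.nodalForm v v ≤ 64 ^ d * P.nrm v ^ 2 := by
  rw [nrm_sq, mass_apply, l2Inner, P.T.integral_domain (P.integrable_mul v.2 v.2), nodalForm,
    Finset.mul_sum]
  refine Finset.sum_le_sum fun K hK => ?_
  have h := K.volume_mul_sq_nodalSum_le v
  rw [integral_interior_carrier]
  have hc : ∫ x in K.carrier, (v : Pt d → ℝ) x * (v : Pt d → ℝ) x =
      ∫ x in K.carrier, K.interp v x * K.interp v x :=
    setIntegral_congr_fun K.isCompact_carrier.measurableSet fun x hx => by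
      simp only [P.T.eq_interp_of_mem v.2 hK hx]
  rw [hc, ← sq]
  exact h

lemma nodalForm_le (v w : P.T.fem) : P.T.nodalForm v w ≤ 64 ^ d * (P.nrm v * P.nrm w) := by
  have hcs : P.T.nodalForm v w ^ 2 ≤ P.T.nodalForm v v * P.T.nodalForm w w := by
    have := Finset.sum_mul_sq_le_sq_mul_sq P.T.cells
      (fun K => √((volume : Measure (Pt d)).real K.carrier) * K.nodalSum v)
      (fun K => √((volume : Measure (Pt d)).real K.carrier) * K.nodalSum w)
    have hs : ∀ K : Cell d, √((volume : Measure (Pt d)).real K.carrier) ^ 2 =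
        (volume : Measure (Pt d)).real K.carrier := fun K => Real.sq_sqrt measureReal_nonneg
    refine le_trans (le_of_eq ?_) (this.trans (le_of_eq ?_))
    · rw [nodalForm]
      congr 1
      refine Finset.sum_congr rfl fun K _ => ?_
      linear_combination (-(K.nodalSum v * K.nodalSum w)) * hs K
    · rw [nodalForm, nodalForm]
      congr 1 <;> refine Finset.sum_congr rfl fun K _ => ?_ <;>
        rw [mul_pow, hs K] <;> ring
  have h2 : P.T.nodalForm v w ^ 2 ≤ (64 ^ d * (P.nrm v * P.nrm w)) ^ 2 := by
    refine hcs.trans ?_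
    calc _ ≤ (64 ^ d * P.nrm v ^ 2) * (64 ^ d * P.nrm w ^ 2) := by
          refine mul_le_mul (P.nodalForm_self_le v) (P.nodalForm_self_le w) ?_ (by positivity)
          exact Finset.sum_nonneg fun K _ => mul_nonneg measureReal_nonneg (mul_self_nonneg _)
      _ = _ := by ring
  exact le_of_sq_le_sq h2 (mul_nonneg (by positivity) (mul_nonneg (P.nrm_nonneg v)
    (P.nrm_nonneg w)))

end Problem

namespace Problem

open Mesh

variable {d : ℕ} (P : Problem d)

/-! ### Perturbed coercivity -/

/-- The cellwise factor `μ` cancels in the product, which becomes `(t + a)(t + b)` with `a`, `b` at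
most `δ` times the nodal sum of `t`. The three error terms give `3δ`. It is used with `x = s`, `t =
W s`, `y = W² s`. -/
lemma mass_ge {x y t : P.T.fem} {δ : ℝ} (hδ0 : 0 ≤ δ) (hδ1 : δ ≤ 1)
    (h : ∀ K ∈ P.T.cells, ∃ μ : ℝ, μ ≠ 0 ∧
      K.nodalSum ((μ • x - t : P.T.fem) : Pt d → ℝ) ≤ δ * K.nodalSum t ∧
      K.nodalSum ((μ⁻¹ • y - t : P.T.fem) : Pt d → ℝ) ≤ δ * K.nodalSum t) :
    P.mass t t - 3 * δ * P.T.nodalForm t t ≤ P.mass x y := by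
  have hI : P.mass t t - P.mass x y = ∫ z in P.T.domain, ((t : Pt d → ℝ) z * (t : Pt d → ℝ) z -
      (x : Pt d → ℝ) z * (y : Pt d → ℝ) z) :=
    (integral_sub (P.integrable_mul t.2 t.2) (P.integrable_mul x.2 y.2)).symm
  have hle := P.T.integral_domain_le
    ((P.integrable_mul t.2 t.2).sub (P.integrable_mul x.2 y.2))
    (G := fun K => 3 * δ * (K.nodalSum t * K.nodalSum t)) fun K hK => by
      filter_upwards [ae_restrict_mem isOpen_interior.measurableSet] with z hz
      obtain ⟨μ, hμ, hx, hy⟩ := h K hK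
      have ht := P.abs_le_nodalSum t.2 hK (interior_subset hz)
      have ha := (P.abs_le_nodalSum (μ • x - t : P.T.fem).2 hK (interior_subset hz)).trans hx
      have hb := (P.abs_le_nodalSum (μ⁻¹ • y - t : P.T.fem).2 hK (interior_subset hz)).trans hy
      set a := ((μ • x - t : P.T.fem) : Pt d → ℝ) z with hadef
      set b := ((μ⁻¹ • y - t : P.T.fem) : Pt d → ℝ) z with hbdef
      set τ := (t : Pt d → ℝ) z
      set N := K.nodalSum t
      have hN : 0 ≤ N := K.nodalSum_nonneg _
      have hxy : (x : Pt d → ℝ) z * (y : Pt d → ℝ) z = (τ + a) * (τ + b) := by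
        have e1 : τ + a = μ * (x : Pt d → ℝ) z := by
          rw [hadef]; simp [τ]
        have e2 : τ + b = μ⁻¹ * (y : Pt d → ℝ) z := by
          rw [hbdef]; simp [τ]
        rw [e1, e2]; field_simp
      show τ * τ - (x : Pt d → ℝ) z * (y : Pt d → ℝ) z ≤ 3 * δ * (N * N)
      rw [hxy]
      have h1 : |τ * a| ≤ N * (δ * N) := by
        rw [abs_mul]; exact mul_le_mul ht ha (abs_nonneg _) hN
      have h2 : |τ * b| ≤ N * (δ * N) := by
        rw [abs_mul]; exact mul_le_mul ht hb (abs_nonneg _) hN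
      have h3 : |a * b| ≤ (δ * N) * (δ * N) := by
        rw [abs_mul]; exact mul_le_mul ha hb (abs_nonneg _) (by positivity)
      have h4 : (δ * N) * (δ * N) ≤ N * (δ * N) :=
        mul_le_mul_of_nonneg_right (mul_le_of_le_one_left hN hδ1) (by positivity)
      have := neg_abs_le (τ * a)
      have := neg_abs_le (τ * b)
      have := neg_abs_le (a * b)
      linarith
  have hsum : ∑ K ∈ P.T.cells, (volume : Measure (Pt d)).real K.carrier *
      (3 * δ * (K.nodalSum t * K.nodalSum t)) = 3 * δ * P.T.nodalForm t t := by
    rw [nodalForm, Finset.mul_sum]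
    exact Finset.sum_congr rfl fun K _ => by ring
  rw [hsum] at hle
  have hle' : P.mass t t - P.mass x y ≤ 3 * δ * P.T.nodalForm t t := by
    rw [hI]; exact hle
  linarith

/-- Polarization: four times the inner product is `‖x + y‖² - ‖x - y‖²`. -/
lemma neg_inner_le {E : Type*} [NormedAddCommGroup E] [InnerProductSpace ℝ E] (x y : E) :
    -inner ℝ x y ≤ ‖x - y‖ ^ 2 / 4 := by
  have h1 := norm_add_sq_real x y
  have h2 := norm_sub_sq_real x y
  nlinarith [sq_nonneg ‖x + y‖]

/-- The vectors `μ∇x` and `μ⁻¹∇y` are both close to `∇t`, hence to each other, and an inner product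
is at least `-‖X - Y‖²/4`. The loss is thus quadratic in `δ` and needs no regularity of `A`; a
linear loss would force `δ` down to the order of `(h/τ)²`. -/
lemma stiff_ge {x y t : P.T.fem} {δ : ℝ}
    (h : ∀ K ∈ P.T.cells, ∃ μ : ℝ, μ ≠ 0 ∧
      K.nodalSum ((μ • x - t : P.T.fem) : Pt d → ℝ) ≤ δ * K.nodalSum t ∧
      K.nodalSum ((μ⁻¹ • y - t : P.T.fem) : Pt d → ℝ) ≤ δ * K.nodalSum t) :
    -(P.β * (2 * d / P.r) ^ 2 * δ ^ 2 * P.T.nodalForm t t) ≤ P.stiff x y := by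
  have hI : -P.stiff x y = ∫ z in P.T.domain,
      -(P.A z * inner ℝ (gradient (x : Pt d → ℝ) z) (gradient (y : Pt d → ℝ) z)) :=
    (integral_neg _).symm
  have hle := P.T.integral_domain_le (P.integrable_inner x.2 y.2).neg
    (G := fun K => P.β * (2 * d / P.r) ^ 2 * δ ^ 2 * (K.nodalSum t * K.nodalSum t))
    fun K hK => by
      obtain ⟨μ, hμ, hx, hy⟩ := h K hK
      filter_upwards [ae_restrict_mem isOpen_interior.measurableSet,
        P.ae_interior_of_ae_domain P.boundA hK, ae_restrict_of_ae (P.ae_differentiableAt x.2),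
        ae_restrict_of_ae (P.ae_differentiableAt y.2),
        ae_restrict_of_ae (P.ae_differentiableAt t.2)] with z hz hA dx dy dt
      have hc : 0 ≤ 2 * (d : ℝ) / P.r := div_nonneg (by positivity) P.r_pos.le
      have ha := (P.norm_gradient_le (μ • x - t : P.T.fem).2 hK hz).trans
        (mul_le_mul_of_nonneg_left hx hc)
      have hb := (P.norm_gradient_le (μ⁻¹ • y - t : P.T.fem).2 hK hz).trans
        (mul_le_mul_of_nonneg_left hy hc)
      have hgrad : ∀ (ν : ℝ) (w : P.T.fem), DifferentiableAt ℝ (w : Pt d → ℝ) z →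
          gradient ((ν • w - t : P.T.fem) : Pt d → ℝ) z =
            ν • gradient (w : Pt d → ℝ) z - gradient (t : Pt d → ℝ) z := by
        intro ν w dw
        have e : ((ν • w - t : P.T.fem) : Pt d → ℝ) =
            ν • (w : Pt d → ℝ) + (-1 : ℝ) • (t : Pt d → ℝ) := by
          ext; simp [sub_eq_add_neg]
        rw [e, gradient_add (dw.const_smul ν) (dt.const_smul _), gradient_smul, gradient_smul,
          neg_one_smul, sub_eq_add_neg]
      rw [hgrad μ x dx] at ha
      rw [hgrad μ⁻¹ y dy] at hb
      set N := K.nodalSum t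
      set X := gradient (x : Pt d → ℝ) z
      set Y := gradient (y : Pt d → ℝ) z
      set G := gradient (t : Pt d → ℝ) z
      have hXY : inner ℝ X Y = inner ℝ (μ • X) (μ⁻¹ • Y) := by
        rw [real_inner_smul_left, real_inner_smul_right, mul_inv_cancel_left₀ hμ]
      have h1 : ‖μ • X - μ⁻¹ • Y‖ ≤ 2 * (2 * d / P.r * (δ * N)) := by
        have : μ • X - μ⁻¹ • Y = (μ • X - G) - (μ⁻¹ • Y - G) := by abel
        rw [this]
        exact (norm_sub_le _ _).trans (by linarith)
      have h2 : -inner ℝ X Y ≤ (2 * d / P.r * (δ * N)) ^ 2 := by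
        rw [hXY]
        refine (neg_inner_le _ _).trans ?_
        have := pow_le_pow_left₀ (norm_nonneg _) h1 2
        linarith
      have hA0 := P.α_pos.le.trans hA.1
      show -(P.A z * inner ℝ X Y) ≤ P.β * (2 * d / P.r) ^ 2 * δ ^ 2 * (N * N)
      calc -(P.A z * inner ℝ X Y) = P.A z * (-inner ℝ X Y) := by ring
        _ ≤ P.A z * (2 * d / P.r * (δ * N)) ^ 2 := mul_le_mul_of_nonneg_left h2 hA0
        _ ≤ P.β * (2 * d / P.r * (δ * N)) ^ 2 :=
            mul_le_mul_of_nonneg_right hA.2 (sq_nonneg _)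
        _ = _ := by ring
  have hsum : ∑ K ∈ P.T.cells, (volume : Measure (Pt d)).real K.carrier *
      (P.β * (2 * d / P.r) ^ 2 * δ ^ 2 * (K.nodalSum t * K.nodalSum t)) =
        P.β * (2 * d / P.r) ^ 2 * δ ^ 2 * P.T.nodalForm t t := by
    rw [nodalForm, Finset.mul_sum]
    exact Finset.sum_congr rfl fun K _ => by ring
  rw [hsum] at hle
  have hle' : -P.stiff x y ≤ P.β * (2 * d / P.r) ^ 2 * δ ^ 2 * P.T.nodalForm t t := by
    rw [hI]; exact hle
  linarith

/-! ### The Poincaré inequality -/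

/-- Integration by parts with `ψ x = x i - a i`, which is bounded by `D` on the domain, gives `∫ f²
= -2 ∫ ψ f ∂ᵢf`; Young's inequality absorbs half of the left-hand side. There are no boundary terms,
since `f` extended by zero is Lipschitz with compact support. -/
lemma mass_le_stiff (hd : 1 ≤ d) {D : ℝ} (hD : Metric.diam P.T.domain ≤ D) (v : P.T.fem) :
    P.mass v v ≤ 4 * D ^ 2 / P.α * P.stiff v v := by
  have hbdd : Bornology.IsBounded P.T.domain :=
    P.T.isCompact_closedDomain.isBounded.subset P.T.domain_subset
  have hD0 : 0 ≤ D := Metric.diam_nonneg.trans hD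
  obtain ⟨i⟩ : Nonempty (Fin d) := ⟨⟨0, hd⟩⟩
  rcases P.T.domain.eq_empty_or_nonempty with hemp | ⟨a, ha⟩
  · simp [mass_apply, stiff_apply, l2Inner, aForm, hemp]
  obtain ⟨L, hL⟩ := P.T.exists_lipschitzWith P.r_pos P.inradius v.2
  have hcs := P.T.hasCompactSupport_of_mem v.2
  set f : Pt d → ℝ := v.1 with hf
  have hf0 : ∀ x ∉ P.T.domain, f x = 0 := v.2.2.1
  obtain ⟨B, hB⟩ := hcs.exists_bound_of_continuous v.2.1
  set ψ : Pt d → ℝ := fun x => x i - a i with hψ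
  have hψlip : ∀ x y, |ψ x - ψ y| ≤ dist x y := by
    intro x y
    have h1 : ψ x - ψ y = (x - y) i := by simp [hψ]
    rw [h1, dist_eq_norm, ← Real.norm_eq_abs]
    exact PiLp.norm_apply_le (x - y) i
  have hψD : ∀ x ∈ P.T.domain, |ψ x| ≤ D := by
    intro x hx
    have h1 := hψlip x a
    have h2 : ψ a = 0 := by simp [hψ]
    rw [h2, sub_zero] at h1
    exact h1.trans ((Metric.dist_le_diam_of_mem hbdd hx ha).trans hD)
  set g : Pt d → ℝ := fun x => ψ x * f x with hg
  have hB0 : 0 ≤ B := (norm_nonneg _).trans (hB a)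
  -- Although `ψ` is unbounded, its size only matters at points of the domain because `f` vanishes
  -- elsewhere; of each pair, one point may be assumed to lie inside.
  have hglip : LipschitzWith (D * L + B).toNNReal g := by
    have key : ∀ x y, x ∈ P.T.domain → |g x - g y| ≤ (D * L + B) * dist x y := by
      intro x y hx
      have h1 : g x - g y = ψ x * (f x - f y) + f y * (ψ x - ψ y) := by simp only [hg]; ring
      have h2 : |f x - f y| ≤ L * dist x y := by
        have := hL.dist_le_mul x y
        rwa [Real.dist_eq] at this
      rw [h1, add_mul]
      refine (abs_add_le _ _).trans (add_le_add ?_ ?_)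
      · rw [abs_mul, mul_assoc]
        exact mul_le_mul (hψD x hx) h2 (abs_nonneg _) hD0
      · rw [abs_mul]
        exact mul_le_mul (hB y) (hψlip x y) (abs_nonneg _) hB0
    refine LipschitzWith.of_dist_le_mul fun x y => ?_
    rw [Real.dist_eq, Real.coe_toNNReal _ (by positivity)]
    by_cases hx : x ∈ P.T.domain
    · exact key x y hx
    · by_cases hy : y ∈ P.T.domain
      · rw [abs_sub_comm, dist_comm]; exact key y x hy
      · simp only [hg, hf0 x hx, hf0 y hy, mul_zero, sub_self, abs_zero]
        positivity
  have hgcs : HasCompactSupport g := hcs.mul_left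
  set e : Pt d := EuclideanSpace.single i 1 with he
  have hψe : ∀ x t, ψ (x + t • e) = ψ x + t := by
    intro x t
    simp [hψ, he]; ring
  have hparts := hL.integral_lineDeriv_mul_eq (μ := volume) hglip hgcs e
  have hae := hL.ae_differentiableAt (μ := volume)
  have hlv : ∀ x, DifferentiableAt ℝ f x → lineDeriv ℝ f x e = inner ℝ (gradient f x) e := by
    intro x hx
    rw [hx.lineDeriv_eq_fderiv, gradient, InnerProductSpace.toDual_symm_apply]
  have hlg : ∀ x, DifferentiableAt ℝ f x → lineDeriv ℝ g x (-e) =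
      -(f x + ψ x * inner ℝ (gradient f x) e) := by
    intro x hx
    rw [lineDeriv_neg]
    congr 1
    have h1 : HasDerivAt (fun t : ℝ => f (x + t • e)) (lineDeriv ℝ f x e) 0 :=
      (hx.lineDifferentiableAt (v := e)).hasLineDerivAt
    have h2 : HasDerivAt (fun t : ℝ => ψ (x + t • e)) 1 0 := by
      simp only [hψe]
      exact (hasDerivAt_id _).const_add (ψ x)
    have h3 := h2.mul h1
    simp only [zero_smul, add_zero] at h3
    rw [hlv x hx] at h3
    rw [one_mul] at h3
    exact HasLineDerivAt.lineDeriv h3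
  obtain ⟨G, hG⟩ := P.exists_norm_gradient_le v.2
  set D1 : Pt d → ℝ := fun x => inner ℝ (gradient f x) e with hD1
  have hD1m : Measurable D1 := (measurable_gradient f).inner measurable_const
  have he1 : ‖e‖ = 1 := by simp [he]
  have hD1le : ∀ x, |D1 x| ≤ ‖gradient f x‖ := by
    intro x
    have := abs_real_inner_le_norm (gradient f x) e
    rwa [he1, mul_one] at this
  have hGle : ∀ x, |D1 x| ≤ G := fun x => (hD1le x).trans (hG x)
  have hffi : Integrable (fun x => f x * f x) :=
    (v.2.1.mul v.2.1).integrable_of_hasCompactSupport hcs.mul_left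
  have hgi : Integrable g := hglip.continuous.integrable_of_hasCompactSupport hgcs
  have hD1gi : Integrable (fun x => D1 x * g x) :=
    hgi.bdd_mul hD1m.aestronglyMeasurable (Filter.Eventually.of_forall hGle)
  have e1 : ∫ x, lineDeriv ℝ f x e * g x = ∫ x, D1 x * g x :=
    integral_congr_ae (by
      filter_upwards [hae] with x hx
      rw [hlv x hx])
  have e2 : ∫ x, lineDeriv ℝ g x (-e) * f x = -(∫ x, f x * f x) - ∫ x, D1 x * g x := by
    have hneg : Integrable (fun x => -(f x * f x)) := hffi.neg
    rw [← integral_neg, ← integral_sub hneg hD1gi]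
    refine integral_congr_ae ?_
    filter_upwards [hae] with x hx
    rw [hlg x hx]
    simp only [hg, hD1]; ring
  rw [e1, e2] at hparts
  have hmass : P.mass v v = ∫ x, f x * f x := by
    rw [mass_apply, l2Inner]
    exact setIntegral_eq_integral_of_forall_compl_eq_zero fun x hx => by
      show f x * f x = 0
      rw [hf0 x hx, zero_mul]
  have hset : ∫ x, D1 x * g x = ∫ x in P.T.domain, D1 x * g x :=
    (setIntegral_eq_integral_of_forall_compl_eq_zero fun x hx => by
      simp only [hg]; rw [hf0 x hx, mul_zero, mul_zero]).symm
  have hAi := P.integrable_inner v.2 v.2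
  have hbound : -(∫ x in P.T.domain, D1 x * g x) ≤
      (1 / 4) * (∫ x in P.T.domain, f x * f x) + D ^ 2 / P.α *
        ∫ x in P.T.domain, P.A x * inner ℝ (gradient f x) (gradient f x) := by
    rw [← integral_neg, ← integral_const_mul, ← integral_const_mul, ← integral_add
      (hffi.integrableOn.const_mul _) (hAi.const_mul _)]
    refine integral_mono_ae hD1gi.neg.integrableOn
      ((hffi.integrableOn.const_mul _).add (hAi.const_mul _)) ?_
    have hmeas : MeasurableSet P.T.domain := isOpen_interior.measurableSet
    filter_upwards [P.boundA, ae_restrict_mem hmeas] with x hA hx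
    have hα := P.α_pos
    simp only [hg]
    rw [real_inner_self_eq_norm_sq]
    have h1 : |D1 x * ψ x| ≤ ‖gradient f x‖ * D := by
      rw [abs_mul]; exact mul_le_mul (hD1le x) (hψD x hx) (abs_nonneg _) (norm_nonneg _)
    have h2 : D ^ 2 / P.α * (P.A x * ‖gradient f x‖ ^ 2) ≥ (‖gradient f x‖ * D) ^ 2 := by
      rw [ge_iff_le, div_mul_eq_mul_div, le_div_iff₀ hα]
      have : ‖gradient f x‖ ^ 2 * D ^ 2 * P.α ≤ ‖gradient f x‖ ^ 2 * D ^ 2 * P.A x :=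
        mul_le_mul_of_nonneg_left hA.1 (by positivity)
      linarith
    have h3 : -(D1 x * (ψ x * f x)) ≤ (1 / 4) * (f x * f x) + (D1 x * ψ x) ^ 2 := by
      nlinarith [sq_nonneg (f x / 2 + D1 x * ψ x)]
    have h4 : (D1 x * ψ x) ^ 2 ≤ (‖gradient f x‖ * D) ^ 2 := by
      rw [← sq_abs (D1 x * ψ x)]
      exact pow_le_pow_left₀ (abs_nonneg _) h1 2
    linarith
  rw [← hset] at hbound
  have hm2 : P.mass v v = ∫ x in P.T.domain, f x * f x := rfl
  have hs2 : P.stiff v v = ∫ x in P.T.domain, P.A x *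
    inner ℝ (gradient f x) (gradient f x) := rfl
  rw [← hm2, ← hs2] at hbound
  rw [← hmass] at hparts
  have hfin : 4 * D ^ 2 / P.α * P.stiff v v = 4 * (D ^ 2 / P.α * P.stiff v v) := by ring
  rw [hfin]
  have := P.stiff_self_nonneg v
  have : 0 ≤ D ^ 2 / P.α * P.stiff v v :=
    mul_nonneg (div_nonneg (sq_nonneg _) P.α_pos.le) this
  linarith

end Problem

/-! ### Nodal multiplication and functions supported on patches. -/

namespace Mesh

variable {d : ℕ} (T : Mesh d)

lemma fem_ext {v w : T.fem} (h : ∀ K ∈ T.cells, ∀ s, (v : Pt d → ℝ) (K.vertex s) =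
    (w : Pt d → ℝ) (K.vertex s)) : v = w :=
  Subtype.ext (T.ext_of_mem v.2 w.2 h)

lemma interp_mul_mem (m : Pt d → ℝ) {v : Pt d → ℝ} (hv : v ∈ T.femSpace) :
    T.interp (fun x => m x * v x) ∈ T.femSpace :=
  T.interp_mem_femSpace fun x hx => by rw [hv.2.1 x hx, mul_zero]

/-- The nodal multiplication operator `v ↦ I_h (m v)`. -/
def scale (m : Pt d → ℝ) : T.fem →ₗ[ℝ] T.fem where
  toFun v := ⟨T.interp fun x => m x * (v : Pt d → ℝ) x, T.interp_mul_mem m v.2⟩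
  map_add' v w := T.fem_ext fun K hK s => by
    simp only [Submodule.coe_add, Pi.add_apply, T.interp_vertex hK, mul_add]
  map_smul' c v := T.fem_ext fun K hK s => by
    simp only [Submodule.coe_smul, Pi.smul_apply, T.interp_vertex hK, smul_eq_mul,
      RingHom.id_apply]
    ring

lemma scale_coe (m : Pt d → ℝ) (v : T.fem) :
    (T.scale m v : Pt d → ℝ) = T.interp fun x => m x * (v : Pt d → ℝ) x := rfl

lemma scale_vertex (m : Pt d → ℝ) (v : T.fem) {K : Cell d} (hK : K ∈ T.cells)
    (s : Finset (Fin d)) :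
    (T.scale m v : Pt d → ℝ) (K.vertex s) = m (K.vertex s) * (v : Pt d → ℝ) (K.vertex s) := by
  rw [scale_coe, T.interp_vertex hK]

lemma nodalForm_nonneg (v w : Pt d → ℝ) : 0 ≤ T.nodalForm v w :=
  Finset.sum_nonneg fun K _ => mul_nonneg measureReal_nonneg
    (mul_nonneg (K.nodalSum_nonneg _) (K.nodalSum_nonneg _))

lemma nodalForm_le_of {v w v' w' : Pt d → ℝ} {c : ℝ}
    (h : ∀ K ∈ T.cells, K.nodalSum v * K.nodalSum w ≤ c * (K.nodalSum v' * K.nodalSum w')) :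
    T.nodalForm v w ≤ c * T.nodalForm v' w' := by
  rw [nodalForm, nodalForm, Finset.mul_sum]
  refine Finset.sum_le_sum fun K hK => ?_
  exact (mul_le_mul_of_nonneg_left (h K hK) measureReal_nonneg).trans
    (le_of_eq (mul_left_comm _ _ _))

/-- A finite element function vanishes on a cell if it vanishes at the vertices. -/
lemma eq_zero_on_cell {v : Pt d → ℝ} (hv : v ∈ T.femSpace) {K : Cell d} (hK : K ∈ T.cells)
    (h : ∀ s, v (K.vertex s) = 0) {x : Pt d} (hx : x ∈ K.carrier) : v x = 0 := by
  rw [T.eq_interp_of_mem hv hK hx, Cell.interp_eq_sum_shape]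
  exact Finset.sum_eq_zero fun s _ => by rw [h s, zero_mul]

/-- A continuous function that vanishes off a set also vanishes off its interior. -/
lemma eq_zero_of_notMem_interior {v : Pt d → ℝ} (hv : Continuous v) {S : Set (Pt d)}
    (h : ∀ x ∉ S, v x = 0) {x : Pt d} (hx : x ∉ interior S) : v x = 0 := by
  have hcl : IsClosed {x | v x = 0} := isClosed_eq hv continuous_const
  have hsub : closure Sᶜ ⊆ {x | v x = 0} := closure_minimal (fun y hy => h y hy) hcl
  rw [closure_compl] at hsub
  exact hsub hx

/-- A cell outside the hull has no vertex in `S`, so all its nodal values vanish; continuity then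
gives zero off the interior of the hull. -/
lemma mem_femSpaceOn_of_vertex {v : Pt d → ℝ} (hv : v ∈ T.femSpace) {S : Set (Pt d)}
    (h : ∀ K ∈ T.cells, ∀ s, K.vertex s ∉ S → v (K.vertex s) = 0) :
    v ∈ T.femSpaceOn (interior (T.cellHull S)) := by
  refine ⟨hv, fun x hx => eq_zero_of_notMem_interior hv.1 (fun y hy => ?_) hx⟩
  by_cases hyd : y ∈ T.closedDomain
  · obtain ⟨K, hK, hyK⟩ := T.mem_closedDomain.1 hyd
    refine T.eq_zero_on_cell hv hK (fun s => h K hK s fun hs => hy ?_) hyK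
    exact T.mem_cellHull.2 ⟨K, hK, ⟨_, hs, K.vertex_mem s⟩, hyK⟩
  · exact hv.2.1 y fun h => hyd (T.domain_subset h)

/-- Interior points of a cell outside the hull belong to no cell of the hull, by nonoverlapping.
Zero values extend to the closed cell by continuity. -/
lemma eq_zero_of_not_meets {r : ℝ} (hr : 0 < r) (hT : T.HasInradius r)
    {v : Pt d → ℝ} {S : Set (Pt d)}
    (hv : v ∈ T.femSpaceOn (interior (T.cellHull S))) {K : Cell d} (hK : K ∈ T.cells)
    (hKS : ¬ (S ∩ K.carrier).Nonempty) {x : Pt d} (hx : x ∈ K.carrier) : v x = 0 := by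
  have hcl : IsClosed {x | v x = 0} := isClosed_eq hv.1.1 continuous_const
  have hsub : closure (interior K.carrier) ⊆ {x | v x = 0} := by
    refine closure_minimal (fun y hy => hv.2 y fun hyS => ?_) hcl
    obtain ⟨K', hK', hS, hyK'⟩ := T.mem_cellHull.1 (interior_subset hyS)
    exact hKS (T.eq_of_mem_interior hr hT hK hK' hy hyK' ▸ hS)
  rw [hT.closure_interior hr hK] at hsub
  exact hsub hx

/-- Nodal values on cells outside the hull are zero and stay zero. This makes weighted local
solutions admissible as local test functions. -/
lemma scale_mem_femSpaceOn {r : ℝ} (hr : 0 < r) (hT : T.HasInradius r)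
    {v : T.fem} {S : Set (Pt d)}
    (hv : (v : Pt d → ℝ) ∈ T.femSpaceOn (interior (T.cellHull S))) (m : Pt d → ℝ) :
    (T.scale m v : Pt d → ℝ) ∈ T.femSpaceOn (interior (T.cellHull S)) := by
  refine ⟨(T.scale m v).2, fun x hx => eq_zero_of_notMem_interior (T.scale m v).2.1
    (fun y hy => ?_) hx⟩
  by_cases hyd : y ∈ T.closedDomain
  · obtain ⟨K, hK, hyK⟩ := T.mem_closedDomain.1 hyd
    have hKS : ¬ (S ∩ K.carrier).Nonempty := fun h => hy (T.mem_cellHull.2 ⟨K, hK, h, hyK⟩)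
    refine T.eq_zero_on_cell (T.scale m v).2 hK (fun s => ?_) hyK
    rw [T.scale_vertex m v hK, T.eq_zero_of_not_meets hr hT hv hK hKS (K.vertex_mem s), mul_zero]
  · exact (T.scale m v).2.2.1 y fun h => hyd (T.domain_subset h)

lemma interior_cellHull_subset (S : Set (Pt d)) : interior (T.cellHull S) ⊆ T.domain :=
  interior_mono fun x hx => by
    obtain ⟨K, hK, _, hxK⟩ := T.mem_cellHull.1 hx
    exact T.mem_closedDomain.2 ⟨K, hK, hxK⟩

lemma l2Inner_of_mem_femSpaceOn {S : Set (Pt d)} {v : Pt d → ℝ}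
    (hv : v ∈ T.femSpaceOn (interior (T.cellHull S))) (g : Pt d → ℝ) :
    l2Inner (interior (T.cellHull S)) g v = l2Inner T.domain g v :=
  (setIntegral_eq_of_subset_of_forall_sdiff_eq_zero isOpen_interior.measurableSet
    (T.interior_cellHull_subset S) fun x hx => by rw [hv.2 x hx.2, mul_zero]).symm

/-- Off the null set of cell boundaries, a point outside the patch is interior to a cell on which
`v` vanishes, so the gradient of `v` is zero there. -/
lemma aForm_of_mem_femSpaceOn {r : ℝ} (hr : 0 < r) (hT : T.HasInradius r)
    {S : Set (Pt d)} {v : Pt d → ℝ}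
    (hv : v ∈ T.femSpaceOn (interior (T.cellHull S))) (A g : Pt d → ℝ) :
    aForm A (interior (T.cellHull S)) g v = aForm A T.domain g v := by
  refine (setIntegral_eq_of_subset_of_ae_sdiff_eq_zero
    isOpen_interior.measurableSet.nullMeasurableSet (T.interior_cellHull_subset S) ?_).symm
  have hnull : ∀ᵐ x, x ∉ T.closedDomain \ ⋃ K ∈ T.cells, interior K.carrier :=
    measure_eq_zero_iff_ae_notMem.1 T.volume_domain_diff
  filter_upwards [hnull] with x hx hxd
  have hxi : x ∈ ⋃ K ∈ T.cells, interior K.carrier := by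
    by_contra h
    exact hx ⟨T.domain_subset hxd.1, h⟩
  obtain ⟨K, hK, hxK⟩ := Set.mem_iUnion₂.1 hxi
  have hKS : ¬ (S ∩ K.carrier).Nonempty := fun h =>
    hxd.2 (interior_mono (fun y hy => T.mem_cellHull.2 ⟨K, hK, h, hy⟩) hxK)
  have hev : v =ᶠ[nhds x] fun _ => 0 := by
    filter_upwards [mem_interior_iff_mem_nhds.1 hxK] with y hy
    exact T.eq_zero_of_not_meets hr hT hv hK hKS hy
  have hgrad : gradient v x = 0 := by
    rw [gradient, hev.fderiv_eq]
    simp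
  rw [hgrad, inner_zero_right, mul_zero]

/-! ### Layer indices and weights -/

open Classical in
/-- The number of layers that do not contain the point, at most `l`. -/
def layerIndex (ω : Set (Pt d)) (l : ℕ) (x : Pt d) : ℕ :=
  ((Finset.range l).filter fun i => x ∉ T.closedLayers ω i).card

variable {T} in
-- If `x` is in layer `i`, then `y` is in layer `i + 1`. So the layers missing `y` are among layer 0
-- and the successors of the layers missing `x`.
lemma layerIndex_le_add_one {ω : Set (Pt d)} (l : ℕ) {K : Cell d} (hK : K ∈ T.cells) {x y : Pt d}
    (hx : x ∈ K.carrier) (hy : y ∈ K.carrier) :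
    T.layerIndex ω l y ≤ T.layerIndex ω l x + 1 := by
  classical
  have hsub : (Finset.range l).filter (fun i => y ∉ T.closedLayers ω i) ⊆
      insert 0 (((Finset.range l).filter fun i => x ∉ T.closedLayers ω i).image (· + 1)) := by
    intro i hi
    rw [Finset.mem_filter, Finset.mem_range] at hi
    cases i with
    | zero => exact Finset.mem_insert_self _ _
    | succ i =>
      refine Finset.mem_insert_of_mem (Finset.mem_image.2 ⟨i, ?_, rfl⟩)
      rw [Finset.mem_filter, Finset.mem_range]
      exact ⟨by omega, fun hxi => hi.2 (T.closedLayers_succ_of_mem hK hx hy hxi)⟩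
  have h := (Finset.card_le_card hsub).trans ((Finset.card_insert_le _ _).trans
    (Nat.add_le_add_right Finset.card_image_le 1))
  unfold layerIndex
  convert h

lemma layerIndex_eq_zero {ω : Set (Pt d)} (l : ℕ) {K : Cell d} (hK : K ∈ T.cells) {x : Pt d}
    (hx : x ∈ K.carrier) (h0 : x ∈ T.closedLayers ω 0) : T.layerIndex ω l x = 0 := by
  classical
  rw [layerIndex, Finset.card_eq_zero, Finset.filter_eq_empty_iff]
  intro i _ hi
  exact hi (T.closedLayers_mono_of_mem hK hx (Nat.zero_le i) h0)

lemma layerIndex_eq {ω : Set (Pt d)} {l : ℕ} {K : Cell d} (hK : K ∈ T.cells) {x : Pt d}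
    (hx : x ∈ K.carrier) (h : x ∉ T.closedLayers ω l) : T.layerIndex ω (l + 1) x = l + 1 := by
  classical
  rw [layerIndex, Finset.filter_true_of_mem, Finset.card_range]
  intro i hi hxi
  exact h (T.closedLayers_mono_of_mem hK hx (Nat.lt_succ_iff.1 (Finset.mem_range.1 hi)) hxi)

end Mesh

/-! ### Seminorms of symmetric positive semidefinite forms -/

section Form

variable {V : Type*} [AddCommGroup V] [Module ℝ V]

/-- Symmetric and positive semidefinite bilinear forms. -/
structure IsPSD (B : LinearMap.BilinForm ℝ V) : Prop where
  comm : ∀ x y, B x y = B y x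
  nonneg : ∀ x, 0 ≤ B x x

/-- The seminorm of a form. -/
def formNorm (B : LinearMap.BilinForm ℝ V) (x : V) : ℝ := √(B x x)

variable {B : LinearMap.BilinForm ℝ V}

lemma formNorm_nonneg (x : V) : 0 ≤ formNorm B x := Real.sqrt_nonneg _

lemma formNorm_sq (hB : IsPSD B) (x : V) : formNorm B x ^ 2 = B x x := Real.sq_sqrt (hB.nonneg x)

lemma abs_form_le (hB : IsPSD B) (x y : V) : |B x y| ≤ formNorm B x * formNorm B y := by
  refine abs_le_of_sq_le_sq ?_ (mul_nonneg (formNorm_nonneg x) (formNorm_nonneg y))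
  rw [mul_pow, formNorm_sq hB, formNorm_sq hB]
  have := LinearMap.BilinForm.apply_mul_apply_le_of_forall_zero_le B hB.nonneg x y
  rwa [hB.comm y x, ← sq] at this

lemma formNorm_add_le (hB : IsPSD B) (x y : V) :
    formNorm B (x + y) ≤ formNorm B x + formNorm B y := by
  refine le_of_sq_le_sq ?_ (add_nonneg (formNorm_nonneg x) (formNorm_nonneg y))
  rw [formNorm_sq hB, add_sq, formNorm_sq hB, formNorm_sq hB]
  simp only [map_add, LinearMap.add_apply]
  have := (le_abs_self _).trans (abs_form_le hB x y)
  rw [hB.comm y x]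
  linarith

lemma formNorm_smul (c : ℝ) (x : V) : formNorm B (c • x) = |c| * formNorm B x := by
  have h : B (c • x) (c • x) = c ^ 2 * B x x := by
    simp only [map_smul, LinearMap.smul_apply, smul_eq_mul]; ring
  rw [formNorm, h, Real.sqrt_mul (sq_nonneg c), Real.sqrt_sq_eq_abs, formNorm]

lemma formNorm_sub_le (hB : IsPSD B) (x y : V) :
    formNorm B (x - y) ≤ formNorm B x + formNorm B y := by
  have h := formNorm_add_le hB x ((-1 : ℝ) • y)
  rw [formNorm_smul, neg_one_smul, ← sub_eq_add_neg] at h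
  simpa using h

/-- The second difference quotient. -/
def diff2 (τ : ℝ) (z : ℕ → V) (n : ℕ) : V :=
  (τ ^ 2)⁻¹ • (z (n + 1) - (2 : ℝ) • z n + z (n - 1))

/-- The weighted time average. -/
def tavg (z : ℕ → V) (n : ℕ) : V := (4 : ℝ)⁻¹ • (z (n + 1) + (2 : ℝ) • z n + z (n - 1))

end Form

/-- The solution of a perturbed three-term recursion grows at most geometrically. -/
lemma three_term_growth {a b : ℕ → ℝ} {Γ : ℝ} (hΓ : 0 ≤ Γ) {N : ℕ} (ha : ∀ k, 0 ≤ a k)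
    (hb : ∀ k, 0 ≤ b k)
    (h : ∀ k < N, a (k + 2) ≤ (2 + 16 * Γ) * a (k + 1) + a k + 4 * Γ * b k) :
    ∀ k ≤ N, a k ≤ (3 + 16 * Γ) ^ (k + 1) * (a 0 + a 1 + 4 * Γ * ∑ i ∈ Finset.range k, b i) ∧
      a (k + 1) ≤ (3 + 16 * Γ) ^ (k + 1) *
        (a 0 + a 1 + 4 * Γ * ∑ i ∈ Finset.range k, b i) := by
  intro k
  induction k with
  | zero =>
    intro _
    have h0 := ha 0
    have h1 := ha 1
    simp only [zero_add, pow_one, Finset.range_zero, Finset.sum_empty, mul_zero, add_zero]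
    constructor <;> nlinarith [mul_nonneg hΓ h0, mul_nonneg hΓ h1]
  | succ k ih =>
    intro hk
    obtain ⟨h0, h1⟩ := ih (by omega)
    have h2 := h k (by omega)
    rw [Finset.sum_range_succ]
    set S := ∑ i ∈ Finset.range k, b i
    have hS : 0 ≤ S := Finset.sum_nonneg fun i _ => hb i
    set Z := (3 + 16 * Γ) ^ (k + 1) * (a 0 + a 1 + 4 * Γ * S) with hZ
    have hG1 : 1 ≤ (3 + 16 * Γ) ^ (k + 1 + 1) := one_le_pow₀ (by linarith)
    have hZ0 : 0 ≤ Z := (ha k).trans h0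
    have hbk : 0 ≤ 4 * Γ * b k := mul_nonneg (by linarith) (hb k)
    have hexp : (3 + 16 * Γ) ^ (k + 1 + 1) * (a 0 + a 1 + 4 * Γ * (S + b k)) =
        (3 + 16 * Γ) * Z + (3 + 16 * Γ) ^ (k + 1 + 1) * (4 * Γ * b k) := by
      rw [hZ, pow_succ]; ring
    have h3 : 4 * Γ * b k ≤ (3 + 16 * Γ) ^ (k + 1 + 1) * (4 * Γ * b k) :=
      le_mul_of_one_le_left hbk hG1
    rw [hexp]
    constructor
    · nlinarith [mul_nonneg hΓ hZ0]
    · have : (2 + 16 * Γ) * a (k + 1) ≤ (2 + 16 * Γ) * Z :=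
        mul_le_mul_of_nonneg_left h1 (by linarith)
      show a (k + 2) ≤ _
      linarith

namespace Problem

open Mesh

variable {d : ℕ} (P : Problem d)

lemma isPSD_mass : IsPSD P.mass := ⟨P.mass_comm, P.mass_self_nonneg⟩

lemma isPSD_stiff : IsPSD P.stiff := ⟨P.stiff_comm, P.stiff_self_nonneg⟩

lemma nrm_add_le (v w : P.T.fem) : P.nrm (v + w) ≤ P.nrm v + P.nrm w :=
  formNorm_add_le P.isPSD_mass v w

lemma nrm_sub_le (v w : P.T.fem) : P.nrm (v - w) ≤ P.nrm v + P.nrm w :=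
  formNorm_sub_le P.isPSD_mass v w

lemma nrm_smul (c : ℝ) (v : P.T.fem) : P.nrm (c • v) = |c| * P.nrm v := formNorm_smul c v

/-- The norm of nodal multiplication operators. -/
lemma nrm_scale_le {m : Pt d → ℝ} (hm : ∀ K ∈ P.T.cells, ∀ s, |m (K.vertex s)| ≤ 1)
    (v : P.T.fem) : P.nrm (P.T.scale m v) ≤ 64 ^ d * P.nrm v := by
  have h1 : P.nrm (P.T.scale m v) ^ 2 ≤ (64 ^ d * P.nrm v) ^ 2 := by
    rw [nrm_sq]
    refine (le_abs_self _).trans ((P.mass_le_nodalForm _ _).trans ?_)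
    have h2 : P.T.nodalForm (P.T.scale m v) (P.T.scale m v) ≤ 1 * P.T.nodalForm v v := by
      refine P.T.nodalForm_le_of fun K hK => ?_
      have h3 : K.nodalSum (P.T.scale m v) ≤ 1 * K.nodalSum v :=
        K.nodalSum_le_of_abs_le fun s => by
          rw [P.T.scale_vertex m v hK, abs_mul]
          exact mul_le_mul_of_nonneg_right (hm K hK s) (abs_nonneg _)
      rw [one_mul] at h3 ⊢
      exact mul_le_mul h3 h3 (K.nodalSum_nonneg _) (K.nodalSum_nonneg _)
    rw [one_mul] at h2
    refine h2.trans ((P.nodalForm_self_le v).trans ?_)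
    rw [mul_pow]
    refine mul_le_mul_of_nonneg_right ?_ (sq_nonneg _)
    have : (1 : ℝ) ≤ 64 ^ d := one_le_pow₀ (by norm_num)
    nlinarith
  exact le_of_sq_le_sq h1 (mul_nonneg (by positivity) (P.nrm_nonneg v))

/-! ### Exponential weights -/

variable (ω : Set (Pt d)) (l : ℕ) (δ : ℝ)

/-- Multiplication by a weight that grows by the factor `1 + δ` per layer. -/
def wt : P.T.fem →ₗ[ℝ] P.T.fem := P.T.scale fun x => (1 + δ) ^ P.T.layerIndex ω l x

/-- The inverse of `wt`. -/
def wtInv : P.T.fem →ₗ[ℝ] P.T.fem := P.T.scale fun x => ((1 + δ) ^ P.T.layerIndex ω l x)⁻¹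

variable {ω l δ}

lemma wtInv_wt (hδ : 0 < δ) (v : P.T.fem) : P.wtInv ω l δ (P.wt ω l δ v) = v :=
  P.T.fem_ext fun K hK s => by
    rw [wtInv, P.T.scale_vertex _ _ hK, wt, P.T.scale_vertex _ _ hK]
    exact inv_mul_cancel_left₀ (by positivity) _

lemma exists_layerIndex {K : Cell d} (hK : K ∈ P.T.cells) :
    ∃ j, ∀ s, P.T.layerIndex ω l (K.vertex s) = j ∨ P.T.layerIndex ω l (K.vertex s) = j + 1 := by
  obtain ⟨s0, hs0⟩ := Finite.exists_min fun s => P.T.layerIndex ω l (K.vertex s)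
  refine ⟨P.T.layerIndex ω l (K.vertex s0), fun s => ?_⟩
  have h1 := layerIndex_le_add_one (ω := ω) l hK (K.vertex_mem s0) (K.vertex_mem s)
  have h2 := hs0 s
  omega

/-- With `j` the smallest layer index on a cell, the inverse weight is at most `(1 + δ)^(-j)` and
the weight at most `(1 + δ)^(j+1)`: opposite weights cancel up to one factor. -/
lemma nodalForm_wt_le (hδ : 0 < δ) (x p : P.T.fem) :
    P.T.nodalForm (P.wtInv ω l δ x) (P.wt ω l δ p) ≤ (1 + δ) * P.T.nodalForm x p := by
  refine P.T.nodalForm_le_of fun K hK => ?_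
  obtain ⟨j, hj⟩ := P.exists_layerIndex (ω := ω) (l := l) hK
  have hE : (1 : ℝ) ≤ 1 + δ := by linarith
  have h1 : K.nodalSum (P.wtInv ω l δ x) ≤ ((1 + δ) ^ j)⁻¹ * K.nodalSum x :=
    K.nodalSum_le_of_abs_le fun s => by
      rw [wtInv, P.T.scale_vertex _ _ hK, abs_mul, abs_of_nonneg (by positivity)]
      refine mul_le_mul_of_nonneg_right (inv_anti₀ (by positivity) ?_) (abs_nonneg _)
      exact pow_le_pow_right₀ hE (by have := hj s; omega)
  have h2 : K.nodalSum (P.wt ω l δ p) ≤ (1 + δ) ^ (j + 1) * K.nodalSum p :=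
    K.nodalSum_le_of_abs_le fun s => by
      rw [wt, P.T.scale_vertex _ _ hK, abs_mul, abs_of_nonneg (by positivity)]
      refine mul_le_mul_of_nonneg_right ?_ (abs_nonneg _)
      exact pow_le_pow_right₀ hE (by have := hj s; omega)
  refine (mul_le_mul h1 h2 (K.nodalSum_nonneg _) (mul_nonneg (by positivity)
    (K.nodalSum_nonneg _))).trans (le_of_eq ?_)
  rw [pow_succ]
  field_simp

lemma weighted_nodalForm_le (hδ : 0 < δ) (hδ1 : δ ≤ 1) (x p : P.T.fem) :
    P.T.nodalForm x (P.wt ω l δ p) ≤ 2 * 64 ^ d * P.nrm (P.wt ω l δ x) * P.nrm p := by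
  have h := P.nodalForm_wt_le (ω := ω) (l := l) hδ (P.wt ω l δ x) p
  rw [P.wtInv_wt hδ] at h
  have h2 := P.nodalForm_le (P.wt ω l δ x) p
  have h3 := P.T.nodalForm_nonneg (P.wt ω l δ x) p
  calc _ ≤ (1 + δ) * P.T.nodalForm (P.wt ω l δ x) p := h
    _ ≤ 2 * P.T.nodalForm (P.wt ω l δ x) p := mul_le_mul_of_nonneg_right (by linarith) h3
    _ ≤ 2 * (64 ^ d * (P.nrm (P.wt ω l δ x) * P.nrm p)) := by linarith
    _ = _ := by ring

/-- Take `μ = (1 + δ)^j`, the weight frozen at its smallest value on the cell. At a vertex the true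
weight is `μ` or `(1 + δ) μ`, so the differences are zero or carry a factor `δ`. -/
lemma wt_perturbation (hδ : 0 < δ) (s : P.T.fem) :
    ∀ K ∈ P.T.cells, ∃ μ : ℝ, μ ≠ 0 ∧
      K.nodalSum ((μ • s - P.wt ω l δ s : P.T.fem) : Pt d → ℝ) ≤
        δ * K.nodalSum (P.wt ω l δ s) ∧
      K.nodalSum ((μ⁻¹ • P.wt ω l δ (P.wt ω l δ s) - P.wt ω l δ s : P.T.fem) : Pt d → ℝ) ≤
        δ * K.nodalSum (P.wt ω l δ s) := by
  intro K hK
  obtain ⟨j, hj⟩ := P.exists_layerIndex (ω := ω) (l := l) hK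
  have hE : (0 : ℝ) < 1 + δ := by linarith
  refine ⟨(1 + δ) ^ j, by positivity, K.nodalSum_le_of_abs_le fun r => ?_,
    K.nodalSum_le_of_abs_le fun r => ?_⟩
  · have hs : (P.wt ω l δ s : Pt d → ℝ) (K.vertex r) =
        (1 + δ) ^ P.T.layerIndex ω l (K.vertex r) * (s : Pt d → ℝ) (K.vertex r) :=
      P.T.scale_vertex _ _ hK r
    rw [Submodule.coe_sub, Pi.sub_apply, Submodule.coe_smul, Pi.smul_apply, smul_eq_mul, hs]
    set y := (s : Pt d → ℝ) (K.vertex r)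
    rcases hj r with h | h <;> rw [h]
    · rw [sub_self, abs_zero]; positivity
    · have h1 : (1 + δ) ^ j * y - (1 + δ) ^ (j + 1) * y = -(δ * ((1 + δ) ^ j * y)) := by ring
      rw [h1, abs_neg, abs_mul, abs_of_pos hδ, abs_mul, abs_mul,
        abs_of_nonneg (by positivity : 0 ≤ (1 + δ) ^ j),
        abs_of_nonneg (by positivity : 0 ≤ (1 + δ) ^ (j + 1))]
      refine mul_le_mul_of_nonneg_left (mul_le_mul_of_nonneg_right ?_ (abs_nonneg _)) hδ.le
      exact pow_le_pow_right₀ (by linarith) (by omega)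
  · set t := P.wt ω l δ s
    have hs : (P.wt ω l δ t : Pt d → ℝ) (K.vertex r) =
        (1 + δ) ^ P.T.layerIndex ω l (K.vertex r) * (t : Pt d → ℝ) (K.vertex r) :=
      P.T.scale_vertex _ _ hK r
    rw [Submodule.coe_sub, Pi.sub_apply, Submodule.coe_smul, Pi.smul_apply, smul_eq_mul, hs]
    set y := (t : Pt d → ℝ) (K.vertex r)
    rcases hj r with h | h <;> rw [h]
    · rw [inv_mul_cancel_left₀ (by positivity), sub_self, abs_zero]; positivity
    · have h1 : ((1 + δ) ^ j)⁻¹ * ((1 + δ) ^ (j + 1) * y) - y = δ * y := by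
        rw [pow_succ]; field_simp; ring
      rw [h1, abs_mul, abs_of_pos hδ]

/-- The inverse of a shifted stiffness operator is bounded in weighted norms. -/
lemma nrm_wt_le_of_solves (hδ : 0 < δ) (hδ1 : δ ≤ 1) {κ : ℝ} (hκ : 0 ≤ κ)
    (hδm : 3 * δ * 64 ^ d ≤ 1 / 4)
    (hδs : κ * (P.β * (2 * d / P.r) ^ 2 * δ ^ 2 * 64 ^ d) ≤ 1 / 4) {S : Set (Pt d)}
    {s g : P.T.fem} (hs : (s : Pt d → ℝ) ∈ P.T.femSpaceOn (interior (P.T.cellHull S)))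
    (h : ∀ v : P.T.fem, (v : Pt d → ℝ) ∈ P.T.femSpaceOn (interior (P.T.cellHull S)) →
      P.mass s v + κ * P.stiff s v = P.mass g v) :
    P.nrm (P.wt ω l δ s) ≤ 4 * 64 ^ d * P.nrm (P.wt ω l δ g) := by
  set t := P.wt ω l δ s with ht
  have htmem : (t : Pt d → ℝ) ∈ P.T.femSpaceOn (interior (P.T.cellHull S)) :=
    P.T.scale_mem_femSpaceOn P.r_pos P.inradius hs _
  -- Test with `W² s`. The mass form yields at least `3/4 N²`, the stiffness form loses at most `1/4
  -- N²`, and the remaining half is compared with the right-hand side.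
  have hv := h (P.wt ω l δ t) (P.T.scale_mem_femSpaceOn P.r_pos P.inradius htmem _)
  have h1 := P.mass_ge hδ.le hδ1 (P.wt_perturbation (ω := ω) (l := l) hδ s)
  have h2 := P.stiff_ge (P.wt_perturbation (ω := ω) (l := l) hδ s)
  rw [← ht] at h1 h2
  have h3 := P.nodalForm_self_le t
  have h4 := (le_abs_self _).trans ((P.mass_le_nodalForm g (P.wt ω l δ t)).trans
    (P.weighted_nodalForm_le hδ hδ1 g t))
  rw [← nrm_sq] at h1
  set N := P.nrm t with hN
  have hN0 : 0 ≤ N := P.nrm_nonneg t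
  have hG0 := P.nrm_nonneg (P.wt ω l δ g)
  have h5 : 3 * δ * P.T.nodalForm t t ≤ 1 / 4 * N ^ 2 :=
    (mul_le_mul_of_nonneg_left h3 (by positivity)).trans (by
      rw [← mul_assoc]; exact mul_le_mul_of_nonneg_right hδm (sq_nonneg _))
  have h6 : κ * P.stiff s (P.wt ω l δ t) ≥ -(1 / 4 * N ^ 2) := by
    -- A `Problem` does not fix the sign of `β`; for negative `β` the lower bound on the stiffness
    -- term is nonnegative anyway.
    by_cases hβ : 0 ≤ P.β
    · have h7 : P.β * (2 * d / P.r) ^ 2 * δ ^ 2 * P.T.nodalForm t t ≤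
          P.β * (2 * d / P.r) ^ 2 * δ ^ 2 * (64 ^ d * N ^ 2) :=
        mul_le_mul_of_nonneg_left h3 (by positivity)
      have h8 : κ * (P.β * (2 * d / P.r) ^ 2 * δ ^ 2 * (64 ^ d * N ^ 2)) ≤ 1 / 4 * N ^ 2 := by
        have := mul_le_mul_of_nonneg_right hδs (sq_nonneg N)
        linarith
      have h9 := mul_le_mul_of_nonneg_left h2 hκ
      have h10 := mul_le_mul_of_nonneg_left h7 hκ
      linarith
    · have h7 : P.β * (2 * d / P.r) ^ 2 * δ ^ 2 * P.T.nodalForm t t ≤ 0 := by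
        refine mul_nonpos_of_nonpos_of_nonneg ?_ (P.T.nodalForm_nonneg _ _)
        exact mul_nonpos_of_nonpos_of_nonneg (mul_nonpos_of_nonpos_of_nonneg
          (not_le.1 hβ).le (sq_nonneg _)) (sq_nonneg _)
      have : 0 ≤ κ * P.stiff s (P.wt ω l δ t) := mul_nonneg hκ (by linarith)
      nlinarith [sq_nonneg N]
  have h7 : 1 / 2 * N ^ 2 ≤ 2 * 64 ^ d * P.nrm (P.wt ω l δ g) * N := by linarith
  rcases eq_or_lt_of_le hN0 with h0 | h0
  · rw [← h0]; positivity
  · have : N * (1 / 2 * N) ≤ N * (2 * 64 ^ d * P.nrm (P.wt ω l δ g)) := by nlinarith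
    have := le_of_mul_le_mul_left this h0
    linarith

end Problem

/-! ### The discrete energy -/

section Energy

variable {V : Type*} [AddCommGroup V] [Module ℝ V]

/-- The form `M(x, x') + a(y, y')` on pairs. -/
def pairForm (M a : LinearMap.BilinForm ℝ V) : LinearMap.BilinForm ℝ (V × V) :=
  M.compl₁₂ (LinearMap.fst ℝ V V) (LinearMap.fst ℝ V V) +
    a.compl₁₂ (LinearMap.snd ℝ V V) (LinearMap.snd ℝ V V)

variable {M a : LinearMap.BilinForm ℝ V}

lemma pairForm_apply (x y : V × V) : pairForm M a x y = M x.1 y.1 + a x.2 y.2 := rfl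

lemma isPSD_pairForm (hM : IsPSD M) (ha : IsPSD a) : IsPSD (pairForm M a) :=
  ⟨fun x y => by rw [pairForm_apply, pairForm_apply, hM.comm, ha.comm],
    fun x => add_nonneg (hM.nonneg _) (ha.nonneg _)⟩

/-- The pair of the difference quotient and the mean value. -/
def energyPair (τ : ℝ) (z : ℕ → V) (n : ℕ) : V × V :=
  (τ⁻¹ • (z (n + 1) - z n), (2 : ℝ)⁻¹ • (z (n + 1) + z n))

variable (M a) in
/-- The discrete energy norm. -/
def energy (τ : ℝ) (z : ℕ → V) (n : ℕ) : ℝ := formNorm (pairForm M a) (energyPair τ z n)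

lemma energy_nonneg (τ : ℝ) (z : ℕ → V) (n : ℕ) : 0 ≤ energy M a τ z n := formNorm_nonneg _

lemma energy_add_le (hM : IsPSD M) (ha : IsPSD a) (τ : ℝ) (z w : ℕ → V) (n : ℕ) :
    energy M a τ (z + w) n ≤ energy M a τ z n + energy M a τ w n := by
  have : energyPair τ (z + w) n = energyPair τ z n + energyPair τ w n := by
    simp only [energyPair, Pi.add_apply, Prod.mk_add_mk]
    congr 1 <;> module
  rw [energy, this]
  exact formNorm_add_le (isPSD_pairForm hM ha) _ _

lemma formNorm_fst_le (ha : IsPSD a) (x : V × V) :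
    formNorm M x.1 ≤ formNorm (pairForm M a) x :=
  Real.sqrt_le_sqrt (by rw [pairForm_apply]; linarith [ha.nonneg x.2])

lemma formNorm_snd_le (hM : IsPSD M) (x : V × V) :
    formNorm a x.2 ≤ formNorm (pairForm M a) x :=
  Real.sqrt_le_sqrt (by rw [pairForm_apply]; linarith [hM.nonneg x.1])

/-- Stability of the Crank--Nicolson scheme. -/
lemma energy_succ_le (hM : IsPSD M) (ha : IsPSD a) {τ ρ : ℝ} (hτ : 0 < τ) (hρ : 0 ≤ ρ)
    {z : ℕ → V} {n : ℕ}
    (h : ∀ v, M (diff2 τ z (n + 1)) v + a (tavg z (n + 1)) v ≤ ρ * formNorm M v) :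
    energy M a τ z (n + 1) ≤ energy M a τ z n + τ * ρ := by
  set p := energyPair τ z (n + 1) with hp
  set q := energyPair τ z n with hq
  have e1 : diff2 τ z (n + 1) = τ⁻¹ • (p.1 - q.1) := by
    simp only [diff2, hp, hq, energyPair, Nat.add_sub_cancel, ← smul_sub, smul_smul, ← mul_inv, sq]
    congr 1
    module
  have e2 : tavg z (n + 1) = (2 : ℝ)⁻¹ • (p.2 + q.2) := by
    simp only [tavg, hp, hq, energyPair, Nat.add_sub_cancel]
    module
  have e3 : z (n + 2) - z n = τ • (p.1 + q.1) := by
    simp only [hp, hq, energyPair, ← smul_add]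
    rw [smul_inv_smul₀ hτ.ne']
    module
  have e4 : z (n + 2) - z n = (2 : ℝ) • (p.2 - q.2) := by
    simp only [hp, hq, energyPair]
    module
  -- This test function is both `τ` times the sum of the two difference quotients and twice the
  -- difference of the two mean values, so both forms telescope into differences of squares.
  have hv := h (z (n + 2) - z n)
  have h1 : M (diff2 τ z (n + 1)) (z (n + 2) - z n) = M p.1 p.1 - M q.1 q.1 := by
    rw [e1, e3]
    simp only [map_smul, map_sub, map_add, LinearMap.smul_apply, LinearMap.sub_apply, smul_eq_mul]
    rw [hM.comm q.1 p.1]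
    field_simp
    ring
  have h2 : a (tavg z (n + 1)) (z (n + 2) - z n) = a p.2 p.2 - a q.2 q.2 := by
    rw [e2, e4]
    simp only [map_smul, map_sub, map_add, LinearMap.smul_apply, LinearMap.add_apply, smul_eq_mul]
    rw [ha.comm q.2 p.2]
    ring
  have h3 : formNorm M (z (n + 2) - z n) ≤ τ * (formNorm (pairForm M a) p +
      formNorm (pairForm M a) q) := by
    rw [e3, formNorm_smul, abs_of_pos hτ]
    refine mul_le_mul_of_nonneg_left ((formNorm_add_le hM _ _).trans ?_) hτ.le
    exact add_le_add (formNorm_fst_le ha p) (formNorm_fst_le ha q)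
  rw [h1, h2] at hv
  have hp2 := formNorm_sq (isPSD_pairForm hM ha) p
  have hq2 := formNorm_sq (isPSD_pairForm hM ha) q
  rw [pairForm_apply] at hp2 hq2
  show formNorm (pairForm M a) p ≤ formNorm (pairForm M a) q + τ * ρ
  set E1 := formNorm (pairForm M a) p
  set E0 := formNorm (pairForm M a) q
  have hE1 : 0 ≤ E1 := formNorm_nonneg _
  have hE0 : 0 ≤ E0 := formNorm_nonneg _
  have h4 : E1 ^ 2 - E0 ^ 2 ≤ ρ * (τ * (E1 + E0)) := by
    have := mul_le_mul_of_nonneg_left h3 hρ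
    linarith
  by_contra hcon
  push Not at hcon
  have hpos : 0 < E1 + E0 := by nlinarith [mul_nonneg hτ.le hρ]
  nlinarith

/-- A discrete Gronwall inequality with delay. -/
lemma gronwall_delay {X : ℕ → ℝ} {S ε : ℝ} (hS : 0 ≤ S) (hε : 0 ≤ ε) (h0 : X 0 ≤ 0) {N : ℕ}
    {p : ℕ → ℕ} (hp : ∀ n, p n ≤ n) (h : ∀ n < N, X (n + 1) ≤ X n + ε * (X (p n) + S)) :
    ∀ n ≤ N, X n ≤ ((1 + ε) ^ n - 1) * S := by
  intro n
  induction n using Nat.strong_induction_on with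
  | _ n ih =>
    intro hn
    cases n with
    | zero => simpa using h0
    | succ n =>
      have h1 := ih n (by omega) (by omega)
      have h2 := ih (p n) (by have := hp n; omega) (by have := hp n; omega)
      have h3 : (1 + ε) ^ p n ≤ (1 + ε) ^ n := pow_le_pow_right₀ (by linarith) (hp n)
      have h4 : X (p n) + S ≤ (1 + ε) ^ n * S := by nlinarith
      have h5 := mul_le_mul_of_nonneg_left h4 hε
      have h6 := h n (by omega)
      rw [pow_succ]
      nlinarith

end Energy

/-! ### Exponential decay of local solutions. -/

namespace Problem

open Mesh

variable {d : ℕ} (P : Problem d) {ω : Set (Pt d)} {l : ℕ} {δ τ : ℝ}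

/-- The Crank--Nicolson equation on the patch of `l + 1` layers. -/
def SolvesOn (P : Problem d) (ω : Set (Pt d)) (l : ℕ) (τ : ℝ) (w φ : ℕ → P.T.fem) (n : ℕ) : Prop :=
  ∀ v : P.T.fem, (v : Pt d → ℝ) ∈ P.T.femSpaceOn (interior (P.T.cellHull (P.T.closedLayers ω l))) →
    P.mass (diff2 τ w n) v + P.stiff (tavg w n) v = P.mass (φ n) v

/-- Growth of weighted norms of a local solution. -/
lemma nrm_wt_growth (hδ : 0 < δ) (hδ1 : δ ≤ 1) (hτ : 0 < τ) (hδm : 3 * δ * 64 ^ d ≤ 1 / 4)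
    (hδs : τ ^ 2 / 4 * (P.β * (2 * d / P.r) ^ 2 * δ ^ 2 * 64 ^ d) ≤ 1 / 4)
    {w φ : ℕ → P.T.fem} {m N : ℕ}
    (hw : ∀ n, m ≤ n → n ≤ m + N + 1 → (w n : Pt d → ℝ) ∈
      P.T.femSpaceOn (interior (P.T.cellHull (P.T.closedLayers ω l))))
    (heq : ∀ n, m + 1 ≤ n → n ≤ m + N → P.SolvesOn ω l τ w φ n) (L : ℕ) :
    ∀ k ≤ N, ∀ i ≤ k + 1, P.nrm (P.wt ω L δ (w (m + i))) ≤ (3 + 16 * 64 ^ d) ^ (k + 1) *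
      (P.nrm (P.wt ω L δ (w m)) + P.nrm (P.wt ω L δ (w (m + 1))) +
        4 * 64 ^ d * ∑ j ∈ Finset.range k, τ ^ 2 * P.nrm (P.wt ω L δ (φ (m + j + 1)))) := by
  set a : ℕ → ℝ := fun k => P.nrm (P.wt ω L δ (w (m + k))) with ha
  set b : ℕ → ℝ := fun k => τ ^ 2 * P.nrm (P.wt ω L δ (φ (m + k + 1))) with hb
  have ha0 : ∀ k, 0 ≤ a k := fun k => P.nrm_nonneg _
  have hb0 : ∀ k, 0 ≤ b k := fun k => mul_nonneg (sq_nonneg _) (P.nrm_nonneg _)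
  have key := three_term_growth (a := a) (b := b) (Γ := 64 ^ d) (by positivity) (N := N) ha0 hb0
    (fun k hk => by
      set n := m + k + 1 with hn
      have hn1 : n - 1 = m + k := by omega
      set s : P.T.fem := w (n + 1) + (2 : ℝ) • w n + w (n - 1) with hs
      have hsmem : (s : Pt d → ℝ) ∈
          P.T.femOn (interior (P.T.cellHull (P.T.closedLayers ω l))) :=
        Submodule.add_mem _ (Submodule.add_mem _ (hw (n + 1) (by omega) (by omega))
          (Submodule.smul_mem _ _ (hw n (by omega) (by omega)))) (hw (n - 1) (by omega) (by omega))
      -- In terms of `s`, the second difference is `(s - 4 w n) / τ²` and the average is `s / 4`.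
      -- The scheme is therefore the shifted problem with `κ = τ²/4` and right-hand side `4 w n + τ²
      -- φ n`.
      have hsol := P.nrm_wt_le_of_solves (ω := ω) (l := L) (κ := τ ^ 2 / 4)
        (g := (4 : ℝ) • w n + τ ^ 2 • φ n) hδ hδ1 (by positivity) hδm hδs hsmem (fun v hv => by
          have h1 := heq n (by omega) (by omega) v hv
          have e1 : diff2 τ w n = (τ ^ 2)⁻¹ • (s - (4 : ℝ) • w n) := by
            rw [diff2, hs]; module
          have e2 : tavg w n = (4 : ℝ)⁻¹ • s := rfl
          rw [e1, e2] at h1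
          simp only [map_smul, map_sub, map_add, LinearMap.smul_apply, LinearMap.sub_apply,
            LinearMap.add_apply, smul_eq_mul] at h1 ⊢
          field_simp at h1
          linarith)
      clear_value s
      have e3 : w (n + 1) = s - ((2 : ℝ) • w n + w (n - 1)) := by rw [hs]; abel
      have h2 : P.nrm (P.wt ω L δ (w (n + 1))) ≤ P.nrm (P.wt ω L δ s) +
          (2 * P.nrm (P.wt ω L δ (w n)) + P.nrm (P.wt ω L δ (w (n - 1)))) := by
        rw [e3, map_sub, map_add, map_smul]
        refine (P.nrm_sub_le _ _).trans (add_le_add le_rfl ((P.nrm_add_le _ _).trans ?_))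
        rw [nrm_smul, abs_of_pos (by norm_num : (0 : ℝ) < 2)]
      have h3 : P.nrm (P.wt ω L δ ((4 : ℝ) • w n + τ ^ 2 • φ n)) ≤
          4 * P.nrm (P.wt ω L δ (w n)) + τ ^ 2 * P.nrm (P.wt ω L δ (φ n)) := by
        rw [map_add, map_smul, map_smul]
        refine (P.nrm_add_le _ _).trans ?_
        rw [nrm_smul, nrm_smul, abs_of_pos (by norm_num : (0 : ℝ) < 4), abs_of_nonneg (sq_nonneg τ)]
      have h4 : (4 : ℝ) * 64 ^ d * P.nrm (P.wt ω L δ ((4 : ℝ) • w n + τ ^ 2 • φ n)) ≤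
          4 * 64 ^ d * (4 * P.nrm (P.wt ω L δ (w n)) + τ ^ 2 * P.nrm (P.wt ω L δ (φ n))) :=
        mul_le_mul_of_nonneg_left h3 (by positivity)
      have hak2 : a (k + 2) = P.nrm (P.wt ω L δ (w (n + 1))) := rfl
      have hak1 : a (k + 1) = P.nrm (P.wt ω L δ (w n)) := rfl
      have hak : a k = P.nrm (P.wt ω L δ (w (n - 1))) := by rw [hn1]
      have hbk : b k = τ ^ 2 * P.nrm (P.wt ω L δ (φ n)) := rfl
      rw [hak2, hak1, hak, hbk]
      linarith)
  intro k hk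
  set Z : ℕ → ℝ := fun k => (3 + 16 * 64 ^ d) ^ (k + 1) *
    (a 0 + a 1 + 4 * 64 ^ d * ∑ i ∈ Finset.range k, b i) with hZ
  have hmono : ∀ i ≤ k, Z i ≤ Z k := by
    intro i hi
    have hS : ∑ j ∈ Finset.range i, b j ≤ ∑ j ∈ Finset.range k, b j :=
      Finset.sum_le_sum_of_subset_of_nonneg (Finset.range_mono hi) fun j _ _ => hb0 j
    have hS0 : 0 ≤ ∑ j ∈ Finset.range i, b j := Finset.sum_nonneg fun j _ => hb0 j
    have h0 := ha0 0
    have h1 := ha0 1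
    refine mul_le_mul (pow_le_pow_right₀ ?_ (by omega)) ?_ (by positivity) (by positivity)
    · have : (0 : ℝ) ≤ 64 ^ d := by positivity
      linarith
    · have := mul_le_mul_of_nonneg_left hS (by positivity : (0 : ℝ) ≤ 4 * 64 ^ d)
      linarith
  intro i hi
  rcases Nat.lt_or_ge k i with h | h
  · obtain rfl : i = k + 1 := by omega
    exact (key k hk).2
  · exact ((key i (h.trans hk)).1).trans (hmono i h)

/-- Outside of its patch, a local solution violates the equation only by an exponentially small
residual. -/
lemma abs_residual_le (hδ : 0 < δ) (hδ1 : δ ≤ 1) {w φ : ℕ → P.T.fem} {n : ℕ} {Z : ℝ}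
    (hτ : 0 < τ) (hβ : 0 ≤ P.β)
    (heq : P.SolvesOn ω l τ w φ n)
    (h0 : P.nrm (P.wt ω (l + 1) δ (w (n - 1))) ≤ Z) (h1 : P.nrm (P.wt ω (l + 1) δ (w n)) ≤ Z)
    (h2 : P.nrm (P.wt ω (l + 1) δ (w (n + 1))) ≤ Z) (v : P.T.fem) :
    |P.mass (diff2 τ w n) v + P.stiff (tavg w n) v - P.mass (φ n) v| ≤
      ((1 + δ) ^ (l + 1))⁻¹ * (2 * (64 ^ d) ^ 2) * ((4 / τ ^ 2 + P.β * (2 * d / P.r) ^ 2) * Z +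
        P.nrm (P.wt ω (l + 1) δ (φ n))) * P.nrm v := by
  classical
  -- The test function is split at the nodes: `v - q` keeps the nodes in the first `l` closed
  -- layers, so it is supported in the patch with one more layer and is annihilated by the local
  -- equation. Only `q` contributes.
  set χ : Pt d → ℝ := fun x => if x ∈ P.T.closedLayers ω l then 0 else 1 with hχ
  set q := P.T.scale χ v with hq
  have hqv : ∀ K ∈ P.T.cells, ∀ s, (q : Pt d → ℝ) (K.vertex s) =
      χ (K.vertex s) * (v : Pt d → ℝ) (K.vertex s) := fun K hK s => P.T.scale_vertex _ _ hK s
  have hloc : ((v - q : P.T.fem) : Pt d → ℝ) ∈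
      P.T.femSpaceOn (interior (P.T.cellHull (P.T.closedLayers ω l))) :=
    P.T.mem_femSpaceOn_of_vertex (v - q).2 fun K hK s hs => by
      rw [Submodule.coe_sub, Pi.sub_apply, hqv K hK, hχ]
      simp [hs]
  have hR : P.mass (diff2 τ w n) v + P.stiff (tavg w n) v - P.mass (φ n) v =
      P.mass (diff2 τ w n) q + P.stiff (tavg w n) q - P.mass (φ n) q := by
    have := heq _ hloc
    simp only [map_sub] at this
    linarith
  set E : ℝ := (1 + δ) ^ (l + 1) with hE
  have hE0 : 0 < E := by positivity
  -- All nodes where `q` is nonzero have the maximal index `l + 1`, so the weight acts on `q` as the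
  -- constant `E`. Writing `q` this way lets the weight be moved to the other argument.
  have hqw : q = E⁻¹ • P.wt ω (l + 1) δ q := P.T.fem_ext fun K hK s => by
    have hw := P.T.scale_vertex (fun x => (1 + δ) ^ P.T.layerIndex ω (l + 1) x) q hK s
    rw [Submodule.coe_smul, Pi.smul_apply, wt, hw, hqv K hK, smul_eq_mul]
    by_cases hs : K.vertex s ∈ P.T.closedLayers ω l
    · simp [hχ, hs]
    · rw [P.T.layerIndex_eq hK (K.vertex_mem s) hs, ← hE, inv_mul_cancel_left₀ hE0.ne']
  have hqn : P.nrm q ≤ 64 ^ d * P.nrm v := P.nrm_scale_le (fun K _ s => by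
    simp only [hχ]; split_ifs <;> simp) v
  have hmass : ∀ x, |P.mass x q| ≤
      E⁻¹ * (2 * (64 ^ d) ^ 2) * P.nrm (P.wt ω (l + 1) δ x) * P.nrm v := by
    intro x
    rw [hqw, map_smul, smul_eq_mul, abs_mul, abs_of_pos (inv_pos.2 hE0)]
    have h3 := (P.mass_le_nodalForm x (P.wt ω (l + 1) δ q)).trans
      (P.weighted_nodalForm_le hδ hδ1 x q)
    have h4 : 2 * 64 ^ d * P.nrm (P.wt ω (l + 1) δ x) * P.nrm q ≤
        2 * 64 ^ d * P.nrm (P.wt ω (l + 1) δ x) * (64 ^ d * P.nrm v) :=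
      mul_le_mul_of_nonneg_left hqn (mul_nonneg (by positivity) (P.nrm_nonneg _))
    refine (mul_le_mul_of_nonneg_left (h3.trans h4) (inv_pos.2 hE0).le).trans (le_of_eq ?_)
    ring
  have hstiff : ∀ x, |P.stiff x q| ≤ P.β * (2 * d / P.r) ^ 2 *
      (E⁻¹ * (2 * (64 ^ d) ^ 2) * P.nrm (P.wt ω (l + 1) δ x) * P.nrm v) := by
    intro x
    rw [hqw, map_smul, smul_eq_mul, abs_mul, abs_of_pos (inv_pos.2 hE0)]
    have h3 := P.weighted_nodalForm_le (ω := ω) (l := l + 1) hδ hδ1 x q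
    have h4 : 2 * 64 ^ d * P.nrm (P.wt ω (l + 1) δ x) * P.nrm q ≤
        2 * 64 ^ d * P.nrm (P.wt ω (l + 1) δ x) * (64 ^ d * P.nrm v) :=
      mul_le_mul_of_nonneg_left hqn (mul_nonneg (by positivity) (P.nrm_nonneg _))
    have h5 := (P.stiff_le_nodalForm x (P.wt ω (l + 1) δ q)).trans
      (mul_le_mul_of_nonneg_left (h3.trans h4) (by positivity))
    refine (mul_le_mul_of_nonneg_left h5 (inv_pos.2 hE0).le).trans (le_of_eq ?_)
    ring
  have hd2 : P.nrm (P.wt ω (l + 1) δ (diff2 τ w n)) ≤ 4 / τ ^ 2 * Z := by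
    rw [diff2, map_smul, map_add, map_sub, map_smul, nrm_smul, abs_of_pos (by positivity)]
    have h3 := P.nrm_add_le (P.wt ω (l + 1) δ (w (n + 1)) - (2 : ℝ) • P.wt ω (l + 1) δ (w n))
      (P.wt ω (l + 1) δ (w (n - 1)))
    have h4 := P.nrm_sub_le (P.wt ω (l + 1) δ (w (n + 1))) ((2 : ℝ) • P.wt ω (l + 1) δ (w n))
    rw [nrm_smul, abs_of_pos (by norm_num : (0 : ℝ) < 2)] at h4
    calc _ ≤ (τ ^ 2)⁻¹ * (4 * Z) := mul_le_mul_of_nonneg_left (by linarith) (by positivity)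
      _ = _ := by ring
  have hta : P.nrm (P.wt ω (l + 1) δ (tavg w n)) ≤ Z := by
    rw [tavg, map_smul, map_add, map_add, map_smul, nrm_smul, abs_of_pos (by norm_num)]
    have h3 := P.nrm_add_le (P.wt ω (l + 1) δ (w (n + 1)) + (2 : ℝ) • P.wt ω (l + 1) δ (w n))
      (P.wt ω (l + 1) δ (w (n - 1)))
    have h4 := P.nrm_add_le (P.wt ω (l + 1) δ (w (n + 1))) ((2 : ℝ) • P.wt ω (l + 1) δ (w n))
    rw [nrm_smul, abs_of_pos (by norm_num : (0 : ℝ) < 2)] at h4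
    linarith
  have hC : 0 ≤ E⁻¹ * (2 * (64 ^ d) ^ 2) := by positivity
  have hv0 := P.nrm_nonneg v
  rw [hR]
  have t1 := (hmass (diff2 τ w n)).trans (mul_le_mul_of_nonneg_right
    (mul_le_mul_of_nonneg_left hd2 hC) hv0)
  have t2 := (hstiff (tavg w n)).trans (mul_le_mul_of_nonneg_left (mul_le_mul_of_nonneg_right
    (mul_le_mul_of_nonneg_left hta hC) hv0) (by positivity : 0 ≤ P.β * (2 * d / P.r) ^ 2))
  have t3 := hmass (φ n)
  calc _ ≤ |P.mass (diff2 τ w n) q| + |P.stiff (tavg w n) q| + |P.mass (φ n) q| :=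
        (abs_sub _ _).trans (add_le_add (abs_add_le _ _) le_rfl)
    _ ≤ _ := by
        refine (add_le_add (add_le_add t1 t2) t3).trans (le_of_eq ?_)
        ring

end Problem

namespace Mesh

variable {d : ℕ} (T : Mesh d)

/-! ### The partition of unity -/

open Classical in
-- The cell chosen by `Mesh.interp` depends on `x` only, so all hat functions are evaluated on the
-- same cell and their bound and sum reduce to those of the shape functions.
lemma hat_eq {x : Pt d} (hx : x ∈ T.closedDomain) :
    ∃ K ∈ T.cells, x ∈ K.carrier ∧
      ∀ z, T.hat z x = K.interp (fun y => if y = z then 1 else 0) x := by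
  have h : ∃ K ∈ T.cells, x ∈ K.carrier := T.mem_closedDomain.1 hx
  refine ⟨h.choose, h.choose_spec.1, h.choose_spec.2, fun z => ?_⟩
  rw [Mesh.hat, Mesh.interp, dif_pos h]

lemma abs_hat_le (z x : Pt d) : |T.hat z x| ≤ 1 := by
  classical
  by_cases hx : x ∈ T.closedDomain
  · obtain ⟨K, _, hxK, h⟩ := T.hat_eq hx
    have hc := K.mem_carrier.1 hxK
    rw [h, Cell.interp_eq_sum_shape]
    refine le_trans ?_ (Cell.sum_shape fun j => K.coord j x).le
    refine (Finset.abs_sum_le_sum_abs _ _).trans (Finset.sum_le_sum fun s _ => ?_)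
    rw [abs_mul, abs_of_nonneg (Cell.shape_nonneg s hc)]
    refine mul_le_of_le_one_left (Cell.shape_nonneg s hc) ?_
    split_ifs <;> simp
  · rw [Mesh.hat, T.interp_of_notMem _ hx, abs_zero]
    exact zero_le_one

lemma sum_hat {x : Pt d} (hx : x ∈ T.closedDomain) : ∑ z ∈ T.nodes, T.hat z x = 1 := by
  classical
  obtain ⟨K, hK, _, h⟩ := T.hat_eq hx
  simp only [h, Cell.interp_eq_sum_shape]
  rw [Finset.sum_comm]
  refine Eq.trans ?_ (Cell.sum_shape fun j => K.coord j x)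
  refine Finset.sum_congr rfl fun s _ => ?_
  rw [← Finset.sum_mul]
  have hmem : K.vertex s ∈ T.nodes := by
    unfold Mesh.nodes
    exact Finset.mem_biUnion.2 ⟨K, hK, Finset.mem_image_of_mem _ (Finset.mem_univ s)⟩
  rw [Finset.sum_ite_eq, if_pos hmem, one_mul]

lemma hat_eq_zero {z x : Pt d} (hx : x ∉ coarseSupp T z) : T.hat z x = 0 := by
  by_contra h
  exact hx (subset_closure h)

end Mesh

/-! ### Transfer between pointwise difference quotients and the finite element space. -/

section Concrete

variable {d : ℕ} {T : Mesh d}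

lemma coe_diff2 (τ : ℝ) (z : ℕ → T.fem) (n : ℕ) :
    ((diff2 τ z n : T.fem) : Pt d → ℝ) = secondDiff τ (fun m => (z m : Pt d → ℝ)) n := by
  ext x
  simp [diff2, secondDiff]
  ring

lemma coe_tavg (z : ℕ → T.fem) (n : ℕ) :
    ((tavg z n : T.fem) : Pt d → ℝ) = avg (fun m => (z m : Pt d → ℝ)) n := by
  ext x
  simp [tavg, avg]
  ring

lemma secondDiff_congr {τ : ℝ} {z z' : ℕ → Pt d → ℝ} {n : ℕ} (h0 : z (n - 1) = z' (n - 1))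
    (h1 : z n = z' n) (h2 : z (n + 1) = z' (n + 1)) : secondDiff τ z n = secondDiff τ z' n := by
  unfold secondDiff
  rw [h0, h1, h2]

lemma avg_congr {z z' : ℕ → Pt d → ℝ} {n : ℕ} (h0 : z (n - 1) = z' (n - 1))
    (h1 : z n = z' n) (h2 : z (n + 1) = z' (n + 1)) : avg z n = avg z' n := by
  unfold avg
  rw [h0, h1, h2]

open Classical in
/-- A function as an element of the finite element space, if it belongs to it. -/
def Mesh.lift (T : Mesh d) (v : Pt d → ℝ) : T.fem :=
  if h : v ∈ T.femSpace then ⟨v, h⟩ else 0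

lemma Mesh.coe_lift {v : Pt d → ℝ} (h : v ∈ T.femSpace) : (T.lift v : Pt d → ℝ) = v := by
  rw [Mesh.lift, dif_pos h]

lemma diff2_sum {V ι : Type*} [AddCommGroup V] [Module ℝ V] (τ : ℝ) (s : Finset ι)
    {z : ℕ → V} {w : ι → ℕ → V} {n : ℕ} (h0 : z (n - 1) = ∑ i ∈ s, w i (n - 1))
    (h1 : z n = ∑ i ∈ s, w i n) (h2 : z (n + 1) = ∑ i ∈ s, w i (n + 1)) :
    diff2 τ z n = ∑ i ∈ s, diff2 τ (w i) n := by
  simp only [diff2, h0, h1, h2, ← Finset.smul_sum, Finset.sum_add_distrib, Finset.sum_sub_distrib]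

lemma tavg_sum {V ι : Type*} [AddCommGroup V] [Module ℝ V] (s : Finset ι)
    {z : ℕ → V} {w : ι → ℕ → V} {n : ℕ} (h0 : z (n - 1) = ∑ i ∈ s, w i (n - 1))
    (h1 : z n = ∑ i ∈ s, w i n) (h2 : z (n + 1) = ∑ i ∈ s, w i (n + 1)) :
    tavg z n = ∑ i ∈ s, tavg (w i) n := by
  simp only [tavg, h0, h1, h2, ← Finset.smul_sum, Finset.sum_add_distrib]

end Concrete

/-! ### Localization and the residual of the superposition. -/

namespace Problem

open Mesh

variable {d : ℕ} (P : Problem d) (TH : Mesh d)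

/-- Localization by a coarse basis function. -/
def loc (z : Pt d) : P.T.fem →ₗ[ℝ] P.T.fem := P.T.scale (TH.hat z)

lemma coe_loc (z : Pt d) (v : P.T.fem) : (P.loc TH z v : Pt d → ℝ) = localize TH P.T z v := rfl

lemma nrm_loc_le (z : Pt d) (v : P.T.fem) : P.nrm (P.loc TH z v) ≤ 64 ^ d * P.nrm v :=
  P.nrm_scale_le (fun _ _ _ => TH.abs_hat_le z _) v

variable {TH} in
-- The hat functions sum to one at every fine node, and nodal values determine the function. Hence
-- localization at a reset commits no error.
lemma sum_loc (hdom : P.T.closedDomain = TH.closedDomain) (v : P.T.fem) :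
    ∑ z ∈ TH.nodes, P.loc TH z v = v := P.T.fem_ext fun K hK s => by
  have hx : K.vertex s ∈ TH.closedDomain := by
    rw [← hdom]; exact P.T.mem_closedDomain.2 ⟨K, hK, K.vertex_mem s⟩
  rw [Submodule.coe_sum, Finset.sum_apply]
  simp only [loc, P.T.scale_vertex _ _ hK]
  rw [← Finset.sum_mul, TH.sum_hat hx, one_mul]

lemma subset_closedLayers_zero (z : Pt d) :
    coarseSupp TH z ⊆ P.T.closedLayers (coarseSupp TH z) 0 :=
  subset_closure

/-- Nodes in the support of the hat function have layer index 0. Thus weighted norms of localized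
data do not see the weight. -/
lemma wt_loc (z : Pt d) (L : ℕ) (δ : ℝ) (v : P.T.fem) :
    P.wt (coarseSupp TH z) L δ (P.loc TH z v) = P.loc TH z v := P.T.fem_ext fun K hK s => by
  rw [wt, P.T.scale_vertex _ _ hK, loc, P.T.scale_vertex _ _ hK]
  by_cases h : K.vertex s ∈ coarseSupp TH z
  · rw [P.T.layerIndex_eq_zero L hK (K.vertex_mem s) (P.subset_closedLayers_zero TH z h), pow_zero,
      one_mul]
  · rw [TH.hat_eq_zero h, zero_mul, mul_zero]

lemma loc_mem (z : Pt d) (l : ℕ) (v : P.T.fem) : (P.loc TH z v : Pt d → ℝ) ∈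
    P.T.femSpaceOn (interior (P.T.cellHull (P.T.closedLayers (coarseSupp TH z) l))) :=
  P.T.mem_femSpaceOn_of_vertex (P.loc TH z v).2 fun K hK s hs => by
    rw [loc, P.T.scale_vertex _ _ hK, TH.hat_eq_zero, zero_mul]
    exact fun h => hs (P.T.closedLayers_mono_of_mem hK (K.vertex_mem s) (Nat.zero_le l)
      (P.subset_closedLayers_zero TH z h))

lemma layers_eq (ω : Set (Pt d)) (l : ℕ) :
    P.T.layers ω (l + 1) = interior (P.T.cellHull (P.T.closedLayers ω l)) :=
  P.T.layers_succ P.r_pos P.inradius ω l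

/-- The local problems in terms of the bilinear forms. -/
lemma solvesOn_of_cnEquation {ω : Set (Pt d)} {l : ℕ} {τ : ℝ} {z g : ℕ → Pt d → ℝ}
    {w φ : ℕ → P.T.fem} {n : ℕ}
    (h : CNEquation P.A τ (P.T.layers ω (l + 1)) (P.T.femSpaceOn (P.T.layers ω (l + 1))) z g n)
    (h0 : z (n - 1) = w (n - 1)) (h1 : z n = w n) (h2 : z (n + 1) = w (n + 1))
    (hφ : (φ n : Pt d → ℝ) = avg g n) : P.SolvesOn ω l τ w φ n := by
  intro v hv
  rw [P.layers_eq] at h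
  have e := h v hv
  rw [P.T.l2Inner_of_mem_femSpaceOn hv, P.T.l2Inner_of_mem_femSpaceOn hv,
    P.T.aForm_of_mem_femSpaceOn P.r_pos P.inradius hv,
    secondDiff_congr (z' := fun m => (w m : Pt d → ℝ)) h0 h1 h2,
    avg_congr (z' := fun m => (w m : Pt d → ℝ)) h0 h1 h2, ← coe_diff2, ← coe_tavg, ← hφ] at e
  exact e

variable {TH} {τ : ℝ} {nres l : ℕ} {u0 u1 : Pt d → ℝ} {f ubar : ℕ → Pt d → ℝ}
  {w : ℕ → Pt d → ℕ → Pt d → ℝ}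

lemma ubar_mem (hnres : 1 ≤ nres) (hu0 : u0 ∈ P.T.femSpace) (hu1 : u1 ∈ P.T.femSpace)
    (hS : IsLocalSuperposition TH P.T P.A τ nres l u0 u1 f ubar w) (n : ℕ) :
    ubar n ∈ P.T.femSpace := by
  rcases n with _ | _ | n
  · rw [hS.start_zero]; exact hu0
  · rw [zero_add, hS.start_one]; exact hu1
  · have h1 : n / nres * nres + 1 < n + 1 + 1 := by
      have := Nat.div_mul_le_self n nres; omega
    have h2 : n + 1 + 1 ≤ (n / nres + 1) * nres + 1 := by
      have := Nat.lt_div_mul_add (a := n) (b := nres) hnres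
      rw [add_mul, one_mul]; omega
    rw [hS.superpose _ _ h1 h2]
    have : (fun x => ∑ z ∈ TH.nodes, w (n / nres) z (n + 1 + 1) x) =
        ∑ z ∈ TH.nodes, w (n / nres) z (n + 1 + 1) := by ext x; simp
    rw [this]
    exact P.T.fem.sum_mem fun z hz => (hS.local_mem _ z hz _ h1 h2).1

/-- The superposition satisfies the global Crank--Nicolson equation up to a small residual. -/
lemma abs_superposition_residual_le (hdom : P.T.closedDomain = TH.closedDomain)
    (hβ : 0 ≤ P.β) (hnres : 1 ≤ nres) (hu0 : u0 ∈ P.T.femSpace) (hu1 : u1 ∈ P.T.femSpace)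
    (hf : ∀ n, f n ∈ P.T.femSpace)
    (hS : IsLocalSuperposition TH P.T P.A τ nres (l + 1) u0 u1 f ubar w)
    {δ : ℝ} (hδ : 0 < δ) (hδ1 : δ ≤ 1) (hτ : 0 < τ) (hδm : 3 * δ * 64 ^ d ≤ 1 / 4)
    (hδs : τ ^ 2 / 4 * (P.β * (2 * d / P.r) ^ 2 * δ ^ 2 * 64 ^ d) ≤ 1 / 4)
    {U F : ℕ → P.T.fem} (hU : U = fun n => P.T.lift (ubar n)) (hF : F = fun n => P.T.lift (f n))
    (k i : ℕ) (hi : i < nres) (v : P.T.fem) :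
    |P.mass (diff2 τ U (k * nres + i + 1)) v + P.stiff (tavg U (k * nres + i + 1)) v -
      P.mass (tavg F (k * nres + i + 1)) v| ≤
      TH.nodes.card * (((1 + δ) ^ (l + 1))⁻¹ * (2 * (64 ^ d) ^ 2) *
        ((4 / τ ^ 2 + P.β * (2 * d / P.r) ^ 2) * ((3 + 16 * 64 ^ d) ^ (nres + 1) *
          (64 ^ d * P.nrm (U (k * nres)) + 64 ^ d * P.nrm (U (k * nres + 1)) + 4 * 64 ^ d *
            ∑ j ∈ Finset.range (i + 1), τ ^ 2 * (64 ^ d * P.nrm (tavg F (k * nres + j + 1))))) +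
        64 ^ d * P.nrm (tavg F (k * nres + i + 1)))) * P.nrm v := by
  set m := k * nres with hm
  set n := m + i + 1 with hn
  have hub := P.ubar_mem hnres hu0 hu1 hS
  have hUc : ∀ j, (U j : Pt d → ℝ) = ubar j := fun j => by rw [hU]; exact coe_lift (hub j)
  have hFc : ∀ j, (F j : Pt d → ℝ) = f j := fun j => by rw [hF]; exact coe_lift (hf j)
  have hkm : (k + 1) * nres = m + nres := by rw [hm]; ring
  have hw0 : ∀ z ∈ TH.nodes, w k z m = P.loc TH z (U m) := fun z hz => by
    rw [coe_loc, hUc]; exact hS.local_zero k z hz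
  have hw1 : ∀ z ∈ TH.nodes, w k z (m + 1) = P.loc TH z (U (m + 1)) := fun z hz => by
    rw [coe_loc, hUc]; exact hS.local_one k z hz
  have hwmem : ∀ z ∈ TH.nodes, ∀ j, m ≤ j → j ≤ m + nres + 1 → w k z j ∈
      P.T.femSpaceOn (interior (P.T.cellHull (P.T.closedLayers (coarseSupp TH z) l))) := by
    intro z hz j hj1 hj2
    rcases Nat.lt_or_ge (m + 1) j with h | h
    · have := hS.local_mem k z hz j h (by rw [hkm]; exact hj2)
      rwa [P.layers_eq] at this
    · rcases (by omega : j = m ∨ j = m + 1) with rfl | rfl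
      · rw [hw0 z hz]; exact P.loc_mem TH z l _
      · rw [hw1 z hz]; exact P.loc_mem TH z l _
  set W : Pt d → ℕ → P.T.fem := fun z j => P.T.lift (w k z j) with hW
  have hWc : ∀ z ∈ TH.nodes, ∀ j, m ≤ j → j ≤ m + nres + 1 → (W z j : Pt d → ℝ) = w k z j :=
    fun z hz j hj1 hj2 => coe_lift (hwmem z hz j hj1 hj2).1
  have hW0 : ∀ z ∈ TH.nodes, W z m = P.loc TH z (U m) := fun z hz =>
    Subtype.ext ((hWc z hz m le_rfl (by omega)).trans (hw0 z hz))
  have hW1 : ∀ z ∈ TH.nodes, W z (m + 1) = P.loc TH z (U (m + 1)) := fun z hz =>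
    Subtype.ext ((hWc z hz (m + 1) (by omega) (by omega)).trans (hw1 z hz))
  set φ : Pt d → ℕ → P.T.fem := fun z j => P.loc TH z (tavg F j) with hφ
  have hUsum : ∀ j, m ≤ j → j ≤ m + nres + 1 → U j = ∑ z ∈ TH.nodes, W z j := by
    intro j hj1 hj2
    rcases Nat.lt_or_ge (m + 1) j with h | h
    · refine Subtype.ext ?_
      rw [hUc, hS.superpose k j h (by rw [hkm]; exact hj2), Submodule.coe_sum]
      ext x
      rw [Finset.sum_apply]
      exact Finset.sum_congr rfl fun z hz => by rw [hWc z hz j hj1 hj2]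
    · rcases (by omega : j = m ∨ j = m + 1) with rfl | rfl
      · rw [Finset.sum_congr rfl hW0, P.sum_loc hdom]
      · rw [Finset.sum_congr rfl hW1, P.sum_loc hdom]
  have hsolve : ∀ z ∈ TH.nodes, ∀ j, m + 1 ≤ j → j ≤ m + nres →
      P.SolvesOn (coarseSupp TH z) l τ (W z) (φ z) j := by
    intro z hz j hj1 hj2
    refine P.solvesOn_of_cnEquation (hS.local_eqn k z hz j hj1 (by rw [hkm]; exact hj2))
      (hWc z hz _ (by omega) (by omega)).symm (hWc z hz _ (by omega) (by omega)).symm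
      (hWc z hz _ (by omega) (by omega)).symm ?_
    have h1 : φ z j = tavg (fun q => P.loc TH z (F q)) j := by
      simp only [hφ, tavg, map_smul, map_add]
    rw [h1, coe_tavg]
    congr 1
    funext q
    rw [coe_loc, hFc]
  -- The scheme is linear and both iterates and sources are sums of their localized parts, so the
  -- global residual is the sum of the local ones.
  have hsplit : P.mass (diff2 τ U n) v + P.stiff (tavg U n) v - P.mass (tavg F n) v =
      ∑ z ∈ TH.nodes, (P.mass (diff2 τ (W z) n) v + P.stiff (tavg (W z) n) v -
        P.mass (φ z n) v) := by
    have a0 := hUsum (n - 1) (by omega) (by omega)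
    have a1 := hUsum n (by omega) (by omega)
    have a2 := hUsum (n + 1) (by omega) (by omega)
    rw [diff2_sum τ TH.nodes a0 a1 a2, tavg_sum TH.nodes a0 a1 a2, ← P.sum_loc hdom (tavg F n)]
    simp only [map_sum, LinearMap.sum_apply, Finset.sum_add_distrib, Finset.sum_sub_distrib]
    rfl
  rw [hsplit, mul_assoc (TH.nodes.card : ℝ), ← nsmul_eq_mul]
  refine (Finset.abs_sum_le_sum_abs _ _).trans (Finset.sum_le_card_nsmul _ _ _ fun z hz => ?_)
  have hgrow := P.nrm_wt_growth (ω := coarseSupp TH z) (l := l) hδ hδ1 hτ hδm hδs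
    (w := W z) (φ := φ z) (m := m) (N := nres) (fun j hj1 hj2 => by
      rw [hWc z hz j hj1 hj2]; exact hwmem z hz j hj1 hj2) (hsolve z hz) (l + 1) (i + 1) hi
  set Γ : ℝ := 64 ^ d with hΓ
  have hΓ0 : 0 ≤ Γ := by positivity
  set Z := (3 + 16 * Γ) ^ (nres + 1) * (Γ * P.nrm (U m) + Γ * P.nrm (U (m + 1)) + 4 * Γ *
    ∑ j ∈ Finset.range (i + 1), τ ^ 2 * (Γ * P.nrm (tavg F (m + j + 1)))) with hZ
  -- The weights disappear on the right because the initial data and sources are localized; one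
  -- bound `Z` covers all three time levels in the equation.
  have hgrow' : ∀ q ≤ i + 2, P.nrm (P.wt (coarseSupp TH z) (l + 1) δ (W z (m + q))) ≤ Z := by
    intro q hq
    refine (hgrow q hq).trans ?_
    rw [hW0 z hz, hW1 z hz, wt_loc, wt_loc]
    simp only [hφ, wt_loc]
    refine mul_le_mul (pow_le_pow_right₀ (by linarith) (by omega)) (add_le_add (add_le_add
      (P.nrm_loc_le TH z _) (P.nrm_loc_le TH z _)) (mul_le_mul_of_nonneg_left ?_ (by positivity)))
      ?_ (by positivity)
    · exact Finset.sum_le_sum fun j _ =>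
        mul_le_mul_of_nonneg_left (P.nrm_loc_le TH z _) (sq_nonneg τ)
    · refine add_nonneg (add_nonneg (P.nrm_nonneg _) (P.nrm_nonneg _)) (mul_nonneg (by positivity)
        (Finset.sum_nonneg fun j _ => mul_nonneg (sq_nonneg τ) (P.nrm_nonneg _)))
  have hres := P.abs_residual_le (ω := coarseSupp TH z) (l := l) hδ hδ1 (w := W z) (φ := φ z)
    (n := n) (Z := Z) hτ hβ (hsolve z hz n (by omega) (by omega))
    (by have := hgrow' i (by omega); exact this) (by have := hgrow' (i + 1) (by omega); exact this)
    (by have := hgrow' (i + 2) (by omega); exact this) v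
  refine hres.trans (mul_le_mul_of_nonneg_right (mul_le_mul_of_nonneg_left (add_le_add le_rfl ?_)
    (by positivity)) (P.nrm_nonneg v))
  simp only [hφ, wt_loc]
  exact P.nrm_loc_le TH z _

end Problem

/-! ### Counting cells and coarse nodes. -/

namespace Mesh

variable {d : ℕ}

/-- The number of cells of a mesh with a given inradius in a domain with a given diameter. -/
lemma card_cells_mul_le (T : Mesh d) {r D : ℝ} (hr : 0 < r) (hT : T.HasInradius r)
    (hD : Metric.diam T.domain ≤ D) : (T.cells.card : ℝ) * r ^ d ≤ D ^ d := by
  have hD0 : 0 ≤ D := Metric.diam_nonneg.trans hD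
  rcases T.cells.eq_empty_or_nonempty with hemp | ⟨K0, hK0⟩
  · rw [hemp]; simp; positivity
  obtain ⟨a, ha⟩ := hT.interior_nonempty hr hK0
  have had : a ∈ T.domain := T.interior_carrier_subset hK0 ha
  have hbdd : Bornology.IsBounded T.domain :=
    T.isCompact_closedDomain.isBounded.subset T.domain_subset
  have hsub : T.domain ⊆ Metric.closedBall a D := fun x hx =>
    Metric.mem_closedBall.2 ((Metric.dist_le_diam_of_mem hbdd hx had).trans hD)
  have h1 : ∑ K ∈ T.cells, volume (interior K.carrier) ≤ volume (Metric.closedBall a D) := by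
    rw [← measure_biUnion_finset (fun K hK K' hK' hne => T.nonoverlapping K hK K' hK' hne)
      fun K _ => isOpen_interior.measurableSet]
    exact measure_mono (Set.iUnion₂_subset fun K hK =>
      (T.interior_carrier_subset hK).trans hsub)
  set b := volume (Metric.ball (0 : Pt d) 1) with hb
  have hb0 : b ≠ 0 := (Metric.measure_ball_pos volume (0 : Pt d) one_pos).ne'
  have hbt : b ≠ ⊤ := measure_ball_lt_top.ne
  have hfin : Module.finrank ℝ (Pt d) = d := by simp
  have h2 : ∀ K ∈ T.cells, ENNReal.ofReal (r ^ d) * b ≤ volume (interior K.carrier) := by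
    intro K hK
    obtain ⟨c, hc⟩ := hT K hK
    have := Measure.addHaar_ball_of_pos (volume : Measure (Pt d)) c hr
    rw [hfin] at this
    rw [hb, ← this]
    exact measure_mono (interior_maximal hc Metric.isOpen_ball)
  have h3 := (Finset.card_nsmul_le_sum _ _ _ h2).trans h1
  -- Disjoint balls of radius `r` inside a ball of radius `D`: the volume of the unit ball cancels.
  rw [Measure.addHaar_closedBall (volume : Measure (Pt d)) a hD0, hfin, ← hb, nsmul_eq_mul,
    ← mul_assoc, ENNReal.mul_le_mul_iff_left hb0 hbt,
    ← ENNReal.ofReal_natCast, ← ENNReal.ofReal_mul (by positivity)] at h3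
  exact (ENNReal.ofReal_le_ofReal_iff (by positivity)).1 h3

lemma card_nodes_mul_le (T : Mesh d) {r D : ℝ} (hr : 0 < r) (hT : T.HasInradius r)
    (hD : Metric.diam T.domain ≤ D) : (T.nodes.card : ℝ) * r ^ d ≤ (2 * D) ^ d := by
  classical
  have h1 : T.nodes.card ≤ T.cells.card * 2 ^ d := by
    unfold Mesh.nodes
    refine Finset.card_biUnion_le_card_mul _ _ _ fun K _ => Finset.card_image_le.trans ?_
    simp
  have h2 : (T.nodes.card : ℝ) ≤ T.cells.card * 2 ^ d := by exact_mod_cast h1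
  have h3 := T.card_cells_mul_le hr hT hD
  calc (T.nodes.card : ℝ) * r ^ d ≤ T.cells.card * 2 ^ d * r ^ d :=
        mul_le_mul_of_nonneg_right h2 (by positivity)
    _ = 2 ^ d * (T.cells.card * r ^ d) := by ring
    _ ≤ 2 ^ d * D ^ d := mul_le_mul_of_nonneg_left h3 (by positivity)
    _ = _ := (mul_pow _ _ _).symm

end Mesh

lemma diff2_sub {V : Type*} [AddCommGroup V] [Module ℝ V] (τ : ℝ) (z w : ℕ → V) (n : ℕ) :
    diff2 τ (z - w) n = diff2 τ z n - diff2 τ w n := by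
  simp only [diff2, Pi.sub_apply]; module

lemma tavg_sub {V : Type*} [AddCommGroup V] [Module ℝ V] (z w : ℕ → V) (n : ℕ) :
    tavg (z - w) n = tavg z n - tavg w n := by
  simp only [tavg, Pi.sub_apply]; module

/-! ### Stability and the global error estimate. -/

namespace Problem

open Mesh

variable {d : ℕ} (P : Problem d)

lemma energyNorm_eq (τ : ℝ) (z : ℕ → P.T.fem) (n : ℕ) :
    energyNorm P.A P.T.domain τ (fun m => (z m : Pt d → ℝ)) n = energy P.mass P.stiff τ z n := by
  have h1 : (fun x => ((z (n + 1) : Pt d → ℝ) x - (z n : Pt d → ℝ) x) / τ) =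
      ((energyPair τ z n).1 : Pt d → ℝ) := by
    ext x; simp [energyPair]; ring
  have h2 : (fun x => ((z (n + 1) : Pt d → ℝ) x + (z n : Pt d → ℝ) x) / 2) =
      ((energyPair τ z n).2 : Pt d → ℝ) := by
    ext x; simp [energyPair]; ring
  have h3 : 0 ≤ l2Inner P.T.domain ((energyPair τ z n).1 : Pt d → ℝ)
      ((energyPair τ z n).1 : Pt d → ℝ) := P.mass_self_nonneg (energyPair τ z n).1
  rw [energyNorm, h1, h2, l2Norm, Real.sq_sqrt h3]
  rfl

/-- The `L²` norms at two consecutive time steps are bounded by the energy. -/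
lemma nrm_add_nrm_le_energy (hd : 1 ≤ d) {D τ : ℝ} (hτ : 0 < τ)
    (hD : Metric.diam P.T.domain ≤ D) (z : ℕ → P.T.fem) (n : ℕ) :
    P.nrm (z n) + P.nrm (z (n + 1)) ≤ (2 * √(4 * D ^ 2 / P.α) + τ) *
      energy P.mass P.stiff τ z n := by
  set p := energyPair τ z n with hp
  have hp1 : P.nrm p.1 ≤ energy P.mass P.stiff τ z n := formNorm_fst_le P.isPSD_stiff p
  have hp2 : P.nrm p.2 ≤ √(4 * D ^ 2 / P.α) * energy P.mass P.stiff τ z n := by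
    have h1 : P.nrm p.2 ≤ √(4 * D ^ 2 / P.α) * formNorm P.stiff p.2 := by
      rw [nrm, formNorm, ← Real.sqrt_mul (div_nonneg (by positivity) P.α_pos.le)]
      exact Real.sqrt_le_sqrt (P.mass_le_stiff hd hD p.2)
    exact h1.trans (mul_le_mul_of_nonneg_left (formNorm_snd_le P.isPSD_mass p)
      (Real.sqrt_nonneg _))
  have e1 : τ • p.1 = z (n + 1) - z n := by
    rw [hp, energyPair]; exact smul_inv_smul₀ hτ.ne' _
  have e0 : z n = p.2 - (2 : ℝ)⁻¹ • (τ • p.1) := by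
    rw [e1, hp, energyPair]; module
  have e2 : z (n + 1) = p.2 + (2 : ℝ)⁻¹ • (τ • p.1) := by
    rw [e1, hp, energyPair]; module
  have h0 : P.nrm (z n) ≤ P.nrm p.2 + 2⁻¹ * (τ * P.nrm p.1) := by
    rw [e0]
    refine (P.nrm_sub_le _ _).trans (le_of_eq ?_)
    rw [nrm_smul, nrm_smul, abs_of_pos hτ, abs_of_pos (by norm_num)]
  have h1 : P.nrm (z (n + 1)) ≤ P.nrm p.2 + 2⁻¹ * (τ * P.nrm p.1) := by
    rw [e2]
    refine (P.nrm_add_le _ _).trans (le_of_eq ?_)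
    rw [nrm_smul, nrm_smul, abs_of_pos hτ, abs_of_pos (by norm_num)]
  have := mul_le_mul_of_nonneg_left hp1 hτ.le
  linarith

/-- Stability of the global Crank--Nicolson solution. -/
lemma energy_le_of_solves {τ : ℝ} (hτ : 0 < τ) {V F : ℕ → P.T.fem}
    (h : ∀ n v, P.mass (diff2 τ V (n + 1)) v + P.stiff (tavg V (n + 1)) v =
      P.mass (tavg F (n + 1)) v) (n : ℕ) :
    energy P.mass P.stiff τ V n ≤ energy P.mass P.stiff τ V 0 +
      ∑ j ∈ Finset.Icc 1 n, τ * P.nrm (tavg F j) := by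
  induction n with
  | zero => simp
  | succ n ih =>
    have h1 := energy_succ_le P.isPSD_mass P.isPSD_stiff hτ (P.nrm_nonneg (tavg F (n + 1)))
      (z := V) (n := n) fun v => by
        rw [h n v]
        exact (le_abs_self _).trans (abs_form_le P.isPSD_mass _ _)
    rw [Finset.sum_Icc_succ_top (by omega)]
    linarith

variable {TH : Mesh d} {τ : ℝ} {nres l : ℕ} {f u ubar : ℕ → Pt d → ℝ}
  {w : ℕ → Pt d → ℕ → Pt d → ℝ}

variable (TH τ nres l) in
/-- The relative error that is committed in one time step. -/
def stepError (δ D : ℝ) : ℝ :=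
  τ * (TH.nodes.card * (((1 + δ) ^ (l + 1))⁻¹ * (2 * (64 ^ d) ^ 2) *
    ((4 / τ ^ 2 + P.β * (2 * d / P.r) ^ 2) * ((3 + 16 * 64 ^ d) ^ (nres + 1) *
      (64 ^ d * (2 * √(4 * D ^ 2 / P.α) + τ) + 4 * (64 ^ d) ^ 2 * τ)) + 64 ^ d / τ)))

/-- The error of the local superposition method in terms of the one-step error. -/
lemma energy_error_le (hd : 1 ≤ d) (hdom : P.T.closedDomain = TH.closedDomain)
    (hβ : 0 ≤ P.β) (hnres : 1 ≤ nres) (hf : ∀ n, f n ∈ P.T.femSpace)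
    (hu : IsCNSolution P.T P.A τ f u)
    (hS : IsLocalSuperposition TH P.T P.A τ nres (l + 1) (u 0) (u 1) f ubar w)
    {δ : ℝ} (hδ : 0 < δ) (hδ1 : δ ≤ 1) (hτ : 0 < τ) (hδm : 3 * δ * 64 ^ d ≤ 1 / 4)
    (hδs : τ ^ 2 / 4 * (P.β * (2 * d / P.r) ^ 2 * δ ^ 2 * 64 ^ d) ≤ 1 / 4)
    {D : ℝ} (hD : Metric.diam P.T.domain ≤ D) {n N : ℕ} (hn : n ≤ N) :
    energyNorm P.A P.T.domain τ (fun m x => ubar m x - u m x) n ≤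
      ((1 + P.stepError TH τ nres l δ D) ^ n - 1) * (energyNorm P.A P.T.domain τ u 0 +
        ∑ j ∈ Finset.Icc 1 N, τ * l2Norm P.T.domain (avg f j)) := by
  have hub := P.ubar_mem hnres (hu.mem 0) (hu.mem 1) hS
  set U : ℕ → P.T.fem := fun n => P.T.lift (ubar n) with hU
  set V : ℕ → P.T.fem := fun n => P.T.lift (u n) with hV
  set F : ℕ → P.T.fem := fun n => P.T.lift (f n) with hF
  have hUc : ∀ j, (U j : Pt d → ℝ) = ubar j := fun j => coe_lift (hub j)
  have hVc : ∀ j, (V j : Pt d → ℝ) = u j := fun j => coe_lift (hu.mem j)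
  have hFc : ∀ j, (F j : Pt d → ℝ) = f j := fun j => coe_lift (hf j)
  have hVf : (fun j => (V j : Pt d → ℝ)) = u := funext hVc
  have hFf : (fun j => (F j : Pt d → ℝ)) = f := funext hFc
  have herr : (fun m x => ubar m x - u m x) = fun m => ((U - V) m : Pt d → ℝ) := by
    funext m x
    rw [← hUc, ← hVc]
    rfl
  have hl2 : ∀ j, l2Norm P.T.domain (avg f j) = P.nrm (tavg F j) := by
    intro j
    rw [nrm, mass_apply, coe_tavg, hFf]
    rfl
  rw [herr, energyNorm_eq]
  conv_rhs => rw [← hVf, energyNorm_eq]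
  simp only [hl2]
  set X : ℕ → ℝ := energy P.mass P.stiff τ (U - V) with hX
  set S : ℝ := energy P.mass P.stiff τ V 0 + ∑ j ∈ Finset.Icc 1 N, τ * P.nrm (tavg F j) with hSdef
  have hterm : ∀ j, 0 ≤ τ * P.nrm (tavg F j) := fun j => mul_nonneg hτ.le (P.nrm_nonneg _)
  have hS0 : 0 ≤ S := add_nonneg (energy_nonneg _ _ _) (Finset.sum_nonneg fun j _ => hterm j)
  have hVeq : ∀ n v, P.mass (diff2 τ V (n + 1)) v + P.stiff (tavg V (n + 1)) v =
      P.mass (tavg F (n + 1)) v := by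
    intro n v
    have := hu.eqn (n + 1) (by omega) v v.2
    rw [← hVf, ← hFf, ← coe_diff2, ← coe_tavg, ← coe_tavg] at this
    exact this
  have hVS : ∀ m ≤ N, energy P.mass P.stiff τ V m ≤ S := fun m hm =>
    (P.energy_le_of_solves hτ hVeq m).trans (add_le_add le_rfl
      (Finset.sum_le_sum_of_subset_of_nonneg (Finset.Icc_subset_Icc le_rfl hm)
        fun j _ _ => hterm j))
  have hX0 : X 0 ≤ 0 := by
    have e0 : U 0 = V 0 := Subtype.ext (by rw [hUc, hVc, hS.start_zero])
    have e1 : U 1 = V 1 := Subtype.ext (by rw [hUc, hVc, hS.start_one])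
    have : energyPair τ (U - V) 0 = 0 := by
      simp [energyPair, e0, e1]
    rw [hX, energy, this]
    simp [formNorm]
  set Q : ℝ := TH.nodes.card * (((1 + δ) ^ (l + 1))⁻¹ * (2 * (64 ^ d) ^ 2) *
    ((4 / τ ^ 2 + P.β * (2 * d / P.r) ^ 2) * ((3 + 16 * 64 ^ d) ^ (nres + 1) *
      (64 ^ d * (2 * √(4 * D ^ 2 / P.α) + τ) + 4 * (64 ^ d) ^ 2 * τ)) + 64 ^ d / τ)) with hQ
  have hQ0 : 0 ≤ Q := by positivity
  have hstep : P.stepError TH τ nres l δ D = τ * Q := rfl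
  rw [hstep]
  -- The delayed index is the last reset not after `n`, where the current local problems were
  -- started.
  refine gronwall_delay (p := fun n => n / nres * nres) hS0 (mul_nonneg hτ.le hQ0) hX0
    (fun n => Nat.div_mul_le_self n nres) (fun n hnN => ?_) n hn
  set k := n / nres with hk
  set i := n % nres with hi
  have hki : n = k * nres + i := by rw [hk, hi, mul_comm]; exact (Nat.div_add_mod n nres).symm
  set m := k * nres with hm
  have hi' : i < nres := Nat.mod_lt _ hnres
  -- The superposition is error plus exact solution, and the latter is bounded by the data. This
  -- feeds the error at the reset back into the residual.
  have hEm : energy P.mass P.stiff τ U m ≤ X m + S := by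
    have h1 := energy_add_le P.isPSD_mass P.isPSD_stiff τ (U - V) V m
    rw [sub_add_cancel] at h1
    exact h1.trans (add_le_add le_rfl (hVS m (by omega)))
  have hXS : 0 ≤ X m + S := (energy_nonneg _ _ _).trans hEm
  have hpartial : ∀ s : Finset ℕ, s ⊆ Finset.Icc 1 N →
      ∑ j ∈ s, τ * P.nrm (tavg F j) ≤ X m + S := fun s hs => by
    have h1 := Finset.sum_le_sum_of_subset_of_nonneg hs
      (f := fun j => τ * P.nrm (tavg F j)) fun j _ _ => hterm j
    have h2 : 0 ≤ X m := energy_nonneg _ _ _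
    have h3 : 0 ≤ energy P.mass P.stiff τ V 0 := energy_nonneg _ _ _
    linarith
  have hsucc := energy_succ_le P.isPSD_mass P.isPSD_stiff hτ (z := U - V) (n := n)
    (ρ := Q * (X m + S)) (mul_nonneg hQ0 hXS) fun v => by
      have hres := P.abs_superposition_residual_le hdom hβ hnres (hu.mem 0) (hu.mem 1) hf hS hδ hδ1
        hτ hδm hδs hU hF k i hi' v
      rw [← hm, ← hki] at hres
      have e : P.mass (diff2 τ (U - V) (n + 1)) v + P.stiff (tavg (U - V) (n + 1)) v =
          P.mass (diff2 τ U (n + 1)) v + P.stiff (tavg U (n + 1)) v -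
            P.mass (tavg F (n + 1)) v := by
        rw [diff2_sub, tavg_sub, ← hVeq n v]
        simp only [map_sub, LinearMap.sub_apply]
        ring
      rw [e]
      refine (le_abs_self _).trans (hres.trans (mul_le_mul_of_nonneg_right ?_ (P.nrm_nonneg v)))
      have hnn := (P.nrm_add_nrm_le_energy hd hτ hD U m).trans
        (mul_le_mul_of_nonneg_left hEm (by positivity))
      have hsum : ∑ j ∈ Finset.range (i + 1), τ * P.nrm (tavg F (m + j + 1)) ≤ X m + S := by
        have h1 : ∑ j ∈ Finset.range (i + 1), τ * P.nrm (tavg F (m + j + 1)) =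
            ∑ j ∈ (Finset.range (i + 1)).image (fun j => m + j + 1), τ * P.nrm (tavg F j) := by
          rw [Finset.sum_image]
          intro a _ b _ hab
          simp only at hab
          omega
        rw [h1]
        refine hpartial _ fun j hj => ?_
        obtain ⟨a, ha, rfl⟩ := Finset.mem_image.1 hj
        rw [Finset.mem_range] at ha
        rw [Finset.mem_Icc]
        omega
      -- The current source enters the residual without a factor `τ`, while the data contain it with
      -- one; hence the term `64 ^ d / τ` in `stepError`.
      have hsingle : P.nrm (tavg F (n + 1)) ≤ (X m + S) / τ := by
        rw [le_div_iff₀ hτ, mul_comm]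
        have := hpartial {n + 1} (by
          intro j hj
          rw [Finset.mem_singleton] at hj
          rw [Finset.mem_Icc]
          omega)
        simpa using this
      have hsum2 : ∑ j ∈ Finset.range (i + 1), τ ^ 2 * (64 ^ d * P.nrm (tavg F (m + j + 1))) =
          64 ^ d * τ * ∑ j ∈ Finset.range (i + 1), τ * P.nrm (tavg F (m + j + 1)) := by
        rw [Finset.mul_sum]
        exact Finset.sum_congr rfl fun j _ => by ring
      rw [hsum2]
      have hA : 64 ^ d * P.nrm (U m) + 64 ^ d * P.nrm (U (m + 1)) + 4 * 64 ^ d * (64 ^ d * τ *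
          ∑ j ∈ Finset.range (i + 1), τ * P.nrm (tavg F (m + j + 1))) ≤
          (64 ^ d * (2 * √(4 * D ^ 2 / P.α) + τ) + 4 * (64 ^ d) ^ 2 * τ) * (X m + S) := by
        have h1 := mul_le_mul_of_nonneg_left hnn (by positivity : (0 : ℝ) ≤ 64 ^ d)
        have h2 := mul_le_mul_of_nonneg_left hsum
          (by positivity : (0 : ℝ) ≤ 4 * (64 ^ d) ^ 2 * τ)
        linarith
      have hB : 64 ^ d * P.nrm (tavg F (n + 1)) ≤ 64 ^ d / τ * (X m + S) := by
        refine (mul_le_mul_of_nonneg_left hsingle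
          (by positivity : (0 : ℝ) ≤ 64 ^ d)).trans (le_of_eq ?_)
        ring
      refine (mul_le_mul_of_nonneg_left (mul_le_mul_of_nonneg_left (add_le_add
        (mul_le_mul_of_nonneg_left (mul_le_mul_of_nonneg_left hA (by positivity))
          (by positivity)) hB) (by positivity)) (Nat.cast_nonneg _)).trans (le_of_eq ?_)
      rw [hQ]
      ring
  refine hsucc.trans (le_of_eq ?_)
  ring

end Problem

/-! ### Absorbing growth factors by the decay rate. -/

lemma exp_half_le_one_add {δ : ℝ} (h0 : 0 ≤ δ) (h1 : δ ≤ 1) : Real.exp (δ / 2) ≤ 1 + δ := by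
  refine (Real.exp_bound_div_one_sub_of_interval (by linarith) (by linarith)).trans ?_
  rw [div_le_iff₀ (by linarith)]
  nlinarith

lemma one_add_pow_sub_one_le {ε x : ℝ} {n : ℕ} (hε : 0 ≤ ε) (hx : n * ε ≤ x) (hx1 : x ≤ 1) :
    (1 + ε) ^ n - 1 ≤ 2 * x := by
  have hx0 : 0 ≤ x := le_trans (by positivity) hx
  have h1 : (1 + ε) ^ n ≤ Real.exp x := by
    calc (1 + ε) ^ n ≤ Real.exp ε ^ n := by
          gcongr; linarith [Real.add_one_le_exp ε]
      _ = Real.exp (n * ε) := (Real.exp_nat_mul ε n).symm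
      _ ≤ Real.exp x := Real.exp_le_exp.2 hx
  have h2 := Real.abs_exp_sub_one_le (x := x) (by rwa [abs_of_nonneg hx0])
  rw [abs_of_nonneg hx0] at h2
  linarith [le_abs_self (Real.exp x - 1)]

/-- The logarithm may vanish, so `m` is not bounded by the first term alone; but `q * m < e` forces
`m < 3`. This serves to absorb the geometric growth in the number of steps. -/
lemma le_mul_log_add_three {q m : ℝ} (hq : 1 ≤ q) (hm : 1 ≤ m) :
    m ≤ m * Real.log (q * m) + 3 := by
  have hqm : 0 < q * m := by positivity
  rcases le_or_gt (Real.exp 1) (q * m) with h | h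
  · have := (Real.le_log_iff_exp_le hqm).2 h
    nlinarith
  · have h0 : 0 ≤ Real.log (q * m) := Real.log_nonneg (one_le_mul_of_one_le_of_one_le hq hm)
    have := Real.exp_one_lt_d9
    nlinarith

/-- Exponential decay with a sufficiently large rate absorbs all polynomial factors. -/
lemma exists_decay_rate {K g lam : ℝ} (p : ℕ) (hg : 0 ≤ g) (hlam : 0 < lam) :
    ∃ c > (0 : ℝ), ∀ q m b s t S : ℝ, 1 ≤ q → 1 ≤ m → 0 < b → lam ≤ s → 0 ≤ t → lam ≤ S →
      K * Real.exp (-(c * (m * Real.log (q * m) + s + t + b * S))) * Real.exp (g * m) * q ^ 4 *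
        Real.exp s ^ p * (m * b) ≤ Real.exp (-t) := by
  set k := Real.log (max K 1) with hk
  have hk0 : 0 ≤ k := Real.log_nonneg (le_max_right _ _)
  have hK : K ≤ Real.exp k := by
    rw [hk, Real.exp_log (lt_of_lt_of_le one_pos (le_max_right _ _))]
    exact le_max_left _ _
  -- In the rate, `g` is for the geometric growth, 4 for `q ^ 4` and 1 for the factor `m`, all paid
  -- by `m log (q m)`. The terms `(k + 3 g) / lam` and `p` are paid by `s`, `1 / lam` is for `b ≤
  -- exp b` and is paid by `b S`, and the last 1 leaves `exp (-t)`.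
  refine ⟨g + 5 + (k + 3 * g) / lam + p + 1 / lam + 1, by positivity, ?_⟩
  intro q m b s t S hq hm hb hs ht hS
  set c := g + 5 + (k + 3 * g) / lam + p + 1 / lam + 1 with hc
  set a := m * Real.log (q * m) with ha
  have hq0 : 0 < q := by linarith
  have hm0 : 0 < m := by linarith
  have hlq : 0 ≤ Real.log q := Real.log_nonneg hq
  have hlm : 0 ≤ Real.log m := Real.log_nonneg hm
  have hlog : Real.log (q * m) = Real.log q + Real.log m := Real.log_mul hq0.ne' hm0.ne'
  have hla : Real.log q + Real.log m ≤ a := by rw [ha, hlog]; nlinarith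
  have ha0 : 0 ≤ a := by linarith
  have hqa : q ≤ Real.exp a := (Real.log_le_iff_le_exp hq0).1 (by linarith)
  have hma : m ≤ Real.exp a := (Real.log_le_iff_le_exp hm0).1 (by linarith)
  have hbe : b ≤ Real.exp b := by linarith [Real.add_one_le_exp b]
  have hs0 : 0 < s := hlam.trans_le hs
  have hS0 : 0 < S := hlam.trans_le hS
  have hmain : K * Real.exp (-(c * (a + s + t + b * S))) * Real.exp (g * m) * q ^ 4 *
      Real.exp s ^ p * (m * b) ≤
      Real.exp k * Real.exp (-(c * (a + s + t + b * S))) * Real.exp (g * m) * Real.exp a ^ 4 *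
      Real.exp s ^ p * (Real.exp a * Real.exp b) := by gcongr
  refine hmain.trans ?_
  rw [← Real.exp_nat_mul, ← Real.exp_nat_mul]
  simp only [← Real.exp_add]
  refine Real.exp_le_exp.2 ?_
  have h1 : g * m ≤ g * a + 3 * g := by
    have := mul_le_mul_of_nonneg_left (le_mul_log_add_three hq hm) hg
    rw [← ha] at this
    linarith
  have h2 : k + 3 * g ≤ (k + 3 * g) / lam * s := by
    rw [div_mul_eq_mul_div, le_div_iff₀ hlam]
    exact mul_le_mul_of_nonneg_left hs (by positivity)
  have h3 : b ≤ 1 / lam * (b * S) := by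
    rw [div_mul_eq_mul_div, le_div_iff₀ hlam, one_mul]
    exact mul_le_mul_of_nonneg_left hS hb.le
  have hp : (0 : ℝ) ≤ p := Nat.cast_nonneg p
  have e1 : (0 : ℝ) ≤ (k + 3 * g) / lam := by positivity
  have e2 : (0 : ℝ) ≤ 1 / lam := by positivity
  have hbS : 0 ≤ b * S := by positivity
  have c1 : (g + 5) * a ≤ c * a := mul_le_mul_of_nonneg_right (by linarith) ha0
  have c2 : ((k + 3 * g) / lam + p) * s ≤ c * s := mul_le_mul_of_nonneg_right (by linarith) hs0.le
  have c3 : 1 * t ≤ c * t := mul_le_mul_of_nonneg_right (by linarith) ht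
  have c4 : 1 / lam * (b * S) ≤ c * (b * S) := mul_le_mul_of_nonneg_right (by linarith) hbS
  push_cast
  linarith

namespace Problem

variable {d : ℕ} (P : Problem d)

/-- The one-step error in terms of the mesh size `h = 1 / y` and the ratio `q` of the
discretization parameters. -/
lemma stepError_le {TH : Mesh d} {τ : ℝ} {nres l : ℕ} {δ D ρ y q : ℝ} (hτ : 0 < τ)
    (hδ : 0 < δ) (hβ : 0 ≤ P.β) (hρ : 0 < ρ) (hD : 0 ≤ D) (hy : 1 ≤ y) (hq : 1 ≤ q)
    (hr : P.r = 1 / (ρ * y)) (hτq : τ ≤ q) (hτy : 1 / τ ≤ q * y)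
    (hcard : (TH.nodes.card : ℝ) ≤ (2 * ρ * D) ^ d * y ^ d) :
    P.stepError TH τ nres l δ D ≤ (2 * ρ * D) ^ d * (2 * (64 ^ d) ^ 2) *
      ((4 + P.β * (2 * d * ρ) ^ 2) * (3 + 16 * 64 ^ d) * (2 * 64 ^ d * √(4 * D ^ 2 / P.α) + 64 ^ d +
        4 * (64 ^ d) ^ 2) + 64 ^ d) * ((1 + δ) ^ (l + 1))⁻¹ * (3 + 16 * 64 ^ d) ^ nres * q ^ 4 *
        y ^ (d + 2) := by
  set Γ : ℝ := 64 ^ d with hΓ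
  have hΓ0 : 0 < Γ := by positivity
  set G : ℝ := 3 + 16 * Γ with hG
  have hG1 : 1 ≤ G := by linarith
  have hGn : 1 ≤ G ^ nres := one_le_pow₀ hG1
  set B : ℝ := √(4 * D ^ 2 / P.α) with hB
  have hB0 : 0 ≤ B := Real.sqrt_nonneg _
  set E : ℝ := ((1 + δ) ^ (l + 1))⁻¹ with hE
  have hE0 : 0 ≤ E := by positivity
  have hq0 : 0 < q := by linarith
  have hy0 : 0 < y := by linarith
  -- Powers: this factor costs `q² y²`, the bound on the data one more `q`, and the leading `τ`
  -- another, which makes `q ^ 4`. The number of coarse nodes contributes the remaining `y ^ d`.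
  have h1 : 4 / τ ^ 2 + P.β * (2 * d / P.r) ^ 2 ≤
      (4 + P.β * (2 * d * ρ) ^ 2) * (q ^ 2 * y ^ 2) := by
    have e1 : 4 / τ ^ 2 ≤ 4 * (q * y) ^ 2 := by
      have : 4 / τ ^ 2 = 4 * (1 / τ) ^ 2 := by field_simp
      rw [this]
      gcongr
    have e2 : 2 * d / P.r = 2 * d * ρ * y := by rw [hr]; field_simp
    have e3 : y ^ 2 ≤ q ^ 2 * y ^ 2 := le_mul_of_one_le_left (by positivity) (one_le_pow₀ hq)
    rw [e2]
    have e4 := mul_le_mul_of_nonneg_left e3 (by positivity : 0 ≤ P.β * (2 * d * ρ) ^ 2)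
    nlinarith
  have h2 : Γ * (2 * B + τ) + 4 * Γ ^ 2 * τ ≤ (2 * Γ * B + Γ + 4 * Γ ^ 2) * q := by
    have e1 : Γ * τ ≤ Γ * q := by gcongr
    have e2 : 4 * Γ ^ 2 * τ ≤ 4 * Γ ^ 2 * q := by gcongr
    have e3 : 2 * Γ * B * 1 ≤ 2 * Γ * B * q := by gcongr
    linarith
  have h3 : Γ / τ ≤ Γ * (G ^ nres * q ^ 3 * y ^ 2) := by
    have e1 : Γ / τ = Γ * (1 / τ) := by ring
    rw [e1]
    refine mul_le_mul_of_nonneg_left (hτy.trans ?_) hΓ0.le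
    calc q * y = 1 * q ^ 1 * y ^ 1 := by ring
      _ ≤ G ^ nres * q ^ 3 * y ^ 2 := by
        gcongr <;> first | assumption | norm_num
  have h4 : (4 / τ ^ 2 + P.β * (2 * d / P.r) ^ 2) * (G ^ (nres + 1) *
      (Γ * (2 * B + τ) + 4 * Γ ^ 2 * τ)) + Γ / τ ≤
      ((4 + P.β * (2 * d * ρ) ^ 2) * G * (2 * Γ * B + Γ + 4 * Γ ^ 2) + Γ) *
        (G ^ nres * q ^ 3 * y ^ 2) := by
    have := mul_le_mul h1 (mul_le_mul_of_nonneg_left h2 (by positivity : 0 ≤ G ^ (nres + 1)))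
      (by positivity) (by positivity)
    refine (add_le_add this h3).trans (le_of_eq ?_)
    rw [pow_succ]
    ring
  rw [stepError, ← hΓ, ← hG, ← hB, ← hE]
  calc _ ≤ q * ((2 * ρ * D) ^ d * y ^ d * (E * (2 * Γ ^ 2) *
        (((4 + P.β * (2 * d * ρ) ^ 2) * G * (2 * Γ * B + Γ + 4 * Γ ^ 2) + Γ) *
        (G ^ nres * q ^ 3 * y ^ 2)))) := by
        have := P.α_pos
        gcongr
    _ = _ := by rw [pow_add]; ring

end Problem

end LSM

end

/-- Error of the local superposition method. The constants `c` (hidden in the choice of the number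
of layers) and `C` depend only on `d`, `α`, `β`, on the regularity constant `ρ` of the meshes, and
on the normalizations `diam Ω ∈ [1 / D, D]` and `H ≤ H₀ < 1`. -/
theorem theorem4p1 (d : ℕ) (hd : 1 ≤ d) (α β ρ D H₀ : ℝ) (hα : 0 < α) (hαβ : α ≤ β)
    (hρ : 1 ≤ ρ) (hD : 1 ≤ D) (hH₀ : H₀ < 1) :
    ∃ c > (0 : ℝ), ∃ C > (0 : ℝ),
      ∀ (TH Th : LSM.Mesh d) (H h : ℝ), 0 < h → 0 < H → H ≤ H₀ → (∃ r : ℕ, H / h = r) →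
      TH.IsQuasiUniform ρ H → Th.IsQuasiUniform ρ h → Th.IsRefinement TH →
      1 / D ≤ Metric.diam Th.domain → Metric.diam Th.domain ≤ D →
      ∀ A : LSM.Pt d → ℝ, AEMeasurable A (MeasureTheory.volume.restrict Th.domain) →
      (∀ᵐ x ∂(MeasureTheory.volume.restrict Th.domain), α ≤ A x ∧ A x ≤ β) →
      ∀ (τ T tfin ϑ : ℝ) (nres l : ℕ), 0 < τ → 0 < T → 0 < tfin → 0 < ϑ →
      T / τ = nres →
      c * (LSM.scaleRatio τ h * (T / τ * Real.log (LSM.scaleRatio τ h * (T / τ)) + |Real.log h|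
        + |Real.log ϑ| + tfin / T * |Real.log H|)) ≤ l →
      ∀ f u ubar : ℕ → LSM.Pt d → ℝ, ∀ w : ℕ → LSM.Pt d → ℕ → LSM.Pt d → ℝ,
      (∀ n, f n ∈ Th.femSpace) →
      LSM.IsCNSolution Th A τ f u →
      LSM.IsLocalSuperposition TH Th A τ nres l (u 0) (u 1) f ubar w →
      ∀ n : ℕ, (n : ℝ) ≤ tfin / τ →
        LSM.energyNorm A Th.domain τ (fun m x => ubar m x - u m x) n ≤
          C * ϑ * (LSM.energyNorm A Th.domain τ u 0 +
            ∑ j ∈ Finset.Icc 1 ⌊tfin / τ⌋₊, τ * LSM.l2Norm Th.domain (LSM.avg f j)) := by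
  obtain hneg | hpos := le_or_gt H₀ 0
  -- For `H₀ ≤ 0` no mesh size is admissible.
  · exact ⟨1, one_pos, 1, one_pos, fun TH Th H h _ hH hHH => absurd hH (by linarith)⟩
  have hβ : 0 < β := hα.trans_le hαβ
  set lam : ℝ := -Real.log H₀ with hlam
  have hlam0 : 0 < lam := by rw [hlam]; linarith [Real.log_neg hpos hH₀]
  set Γ : ℝ := 64 ^ d with hΓ
  have hΓ0 : 0 < Γ := by positivity
  set G : ℝ := 3 + 16 * Γ with hG
  have hG1 : 1 ≤ G := by linarith
  -- Chosen so that `δ = c₀ / q` meets both smallness conditions of the weighted estimate: `3 c₀ Γ ≤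
  -- 1/4` for the mass form and `β (2dρ)² c₀² Γ ≤ 1` for the stiffness form.
  set c₀ : ℝ := 1 / (12 * Γ * (1 + β) * (1 + (2 * d * ρ) ^ 2)) with hc₀
  have hc₀0 : 0 < c₀ := by positivity
  have hc₀1 : 3 * c₀ * Γ ≤ 1 / 4 := by
    rw [hc₀]
    have : 1 ≤ (1 + β) * (1 + (2 * d * ρ) ^ 2) :=
      one_le_mul_of_one_le_of_one_le (by linarith) (by nlinarith [sq_nonneg (2 * d * ρ)])
    rw [mul_one_div, div_mul_eq_mul_div, div_le_div_iff₀ (by positivity) (by norm_num)]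
    nlinarith
  have hΓ1 : 1 ≤ Γ := one_le_pow₀ (by norm_num)
  have hc₀2 : c₀ ≤ 1 := by nlinarith
  have hc₀3 : β * (2 * d * ρ) ^ 2 * c₀ ^ 2 * Γ ≤ 1 := by
    have e1 : β * (2 * d * ρ) ^ 2 * c₀ * Γ ≤ 1 := by
      rw [hc₀, mul_one_div, div_mul_eq_mul_div, div_le_one (by positivity)]
      nlinarith [mul_nonneg hΓ0.le (sq_nonneg (2 * d * ρ)), mul_nonneg hΓ0.le hβ.le,
        mul_nonneg (mul_nonneg hΓ0.le hβ.le) (sq_nonneg (2 * d * ρ))]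
    calc _ = β * (2 * d * ρ) ^ 2 * c₀ * Γ * c₀ := by ring
      _ ≤ 1 * 1 := mul_le_mul e1 hc₀2 hc₀0.le one_pos.le
      _ = 1 := one_mul 1
  set K : ℝ := (2 * ρ * D) ^ d * (2 * Γ ^ 2) * ((4 + β * (2 * d * ρ) ^ 2) * G *
    (2 * Γ * √(4 * D ^ 2 / α) + Γ + 4 * Γ ^ 2) + Γ) with hK
  obtain ⟨c₁, hc₁, hdecay⟩ := LSM.exists_decay_rate (K := K) (d + 2) (Real.log_nonneg hG1) hlam0
  -- Since `1 + δ ≥ exp (δ / 2)` with `δ = c₀ / q`, this many layers give the decay `exp (-c₁ X)`.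
  -- The constant `C = 2` comes from `exp x - 1 ≤ 2 x` on `[0, 1]`.
  refine ⟨2 * c₁ / c₀, by positivity, 2, two_pos, ?_⟩
  intro TH Th H h hh hH hHH₀ hrat hqH hqh hrefine _ hdiam A hA hbound τ T tfin ϑ nres l hτ hT htfin
    hϑ hTτ hl f u ubar w hf hu hS n hn
  obtain ⟨r, hr⟩ := hrat
  have hhH : h ≤ H := by
    have h1 : (0 : ℝ) < r := by rw [← hr]; positivity
    have h2 : (1 : ℝ) ≤ r := by exact_mod_cast Nat.cast_pos.1 h1
    rw [← hr, le_div_iff₀ hh, one_mul] at h2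
    exact h2
  have hlog : ∀ x, 0 < x → x ≤ H₀ → |Real.log x| = -Real.log x ∧ lam ≤ |Real.log x| := by
    intro x hx hxH
    have h1 := Real.log_le_log hx hxH
    have h2 : |Real.log x| = -Real.log x := abs_of_neg (by linarith)
    exact ⟨h2, by rw [h2]; linarith⟩
  have hexp : Real.exp |Real.log h| = 1 / h := by
    rw [(hlog h hh (hhH.trans hHH₀)).1, Real.exp_neg, Real.exp_log hh, one_div]
  have hρ0 : 0 < ρ := by linarith
  set q := LSM.scaleRatio τ h with hq
  have hτh : τ / h ≤ q := le_max_left _ _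
  have hhτ : h / τ ≤ q := le_max_right _ _
  have hq1 : 1 ≤ q := by
    rcases le_total h τ with hle | hle
    · exact ((one_le_div hh).2 hle).trans hτh
    · exact ((one_le_div hτ).2 hle).trans hhτ
  have hq0 : 0 < q := by linarith
  have hnres0 : (0 : ℝ) < nres := by rw [← hTτ]; positivity
  have hnres : 1 ≤ nres := Nat.cast_pos.1 hnres0
  have hnres1 : (1 : ℝ) ≤ nres := by exact_mod_cast hnres
  rw [hTτ] at hl
  have hb : 0 < tfin / T := by positivity
  have hs := (hlog h hh (hhH.trans hHH₀)).2
  have hSH := (hlog H hH hHH₀).2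
  have hdec := hdecay q nres (tfin / T) |Real.log h| |Real.log ϑ| |Real.log H| hq1 hnres1 hb hs
    (abs_nonneg _) hSH
  set X : ℝ := nres * Real.log (q * nres) + |Real.log h| + |Real.log ϑ| + tfin / T * |Real.log H|
    with hX
  have hX0 : 0 < X := by
    have h1 : 0 ≤ nres * Real.log (q * nres) :=
      mul_nonneg hnres0.le (Real.log_nonneg (one_le_mul_of_one_le_of_one_le hq1 hnres1))
    have h2 : 0 ≤ tfin / T * |Real.log H| := by positivity
    linarith [abs_nonneg (Real.log ϑ)]
  -- At least one layer is forced because `|log h| ≥ -log H₀ > 0`. This rules out the exceptional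
  -- patch with zero layers, which is not defined as a union of fine cells.
  have hlpos : 0 < l := by
    have : (0 : ℝ) < l := lt_of_lt_of_le (by positivity) hl
    exact_mod_cast this
  obtain ⟨l, rfl⟩ : ∃ l', l = l' + 1 := ⟨l - 1, by omega⟩
  set δ : ℝ := c₀ / q with hδ
  have hδ0 : 0 < δ := by positivity
  have hδc : δ ≤ c₀ := div_le_self hc₀0.le hq1
  have hδ1 : δ ≤ 1 := hδc.trans hc₀2
  have hpow : ((1 + δ) ^ (l + 1))⁻¹ ≤ Real.exp (-(c₁ * X)) := by
    rw [Real.exp_neg]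
    refine inv_anti₀ (Real.exp_pos _) ?_
    calc Real.exp (c₁ * X) ≤ Real.exp (((l + 1 : ℕ) : ℝ) * (δ / 2)) := by
          refine Real.exp_le_exp.2 ?_
          have := mul_le_mul_of_nonneg_right hl (by positivity : 0 ≤ δ / 2)
          refine (le_of_eq ?_).trans this
          rw [hδ]
          field_simp
      _ = Real.exp (δ / 2) ^ (l + 1) := Real.exp_nat_mul _ _
      _ ≤ (1 + δ) ^ (l + 1) := by
          gcongr
          exact LSM.exp_half_le_one_add hδ0.le hδ1
  let P : LSM.Problem d :=
    { T := Th, A := A, r := h / ρ, α := α, β := β, r_pos := by positivity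
      inradius := fun K hK => (hqh K hK).2, α_pos := hα, measA := hA, boundA := hbound }
  have hdomH : Metric.diam TH.domain ≤ D := by
    rw [LSM.Mesh.domain, ← hrefine.1]
    exact hdiam
  have hcard : (TH.nodes.card : ℝ) ≤ (2 * ρ * D) ^ d * (1 / h) ^ d := by
    have h1 := TH.card_nodes_mul_le (r := H / ρ) (by positivity) (fun K hK => (hqH K hK).2) hdomH
    have h2 : (TH.nodes.card : ℝ) * (h / ρ) ^ d ≤ (2 * D) ^ d := by
      refine le_trans ?_ h1
      gcongr
    rw [← mul_pow]
    have h3 : (2 * ρ * D * (1 / h)) = 2 * D / (h / ρ) := by field_simp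
    rw [h3, div_pow, le_div_iff₀ (by positivity)]
    exact h2
  have hh1 : h ≤ 1 := (hhH.trans hHH₀).trans hH₀.le
  have hstep := P.stepError_le (TH := TH) (nres := nres) (l := l) (D := D) (ρ := ρ) (y := 1 / h)
    (q := q) hτ hδ0 hβ.le hρ0 (by linarith) ((one_le_div hh).2 hh1) hq1
    (show h / ρ = _ by field_simp)
    (by rw [div_le_iff₀ hh] at hτh; exact hτh.trans (mul_le_of_le_one_right hq0.le hh1))
    (by
      rw [div_le_iff₀ hτ] at hhτ ⊢
      rw [mul_one_div, div_mul_eq_mul_div, le_div_iff₀ hh, one_mul]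
      exact hhτ) hcard
  have herr := P.energy_error_le (TH := TH) (l := l) (f := f) (u := u) (ubar := ubar) (w := w)
    (N := ⌊tfin / τ⌋₊) (n := n) hd hrefine.1 hβ.le hnres hf hu hS hδ0 hδ1 hτ
    -- The inverse inequality contributes `(ρ τ / h)²`, and `τ / h ≤ q` is compensated by the factor
    -- `1 / q` in `δ`.
    (le_trans (by gcongr) hc₀1) (by
      change τ ^ 2 / 4 * (β * (2 * d / (h / ρ)) ^ 2 * δ ^ 2 * Γ) ≤ 1 / 4
      have e1 : τ ^ 2 / 4 * (β * (2 * d / (h / ρ)) ^ 2 * δ ^ 2 * Γ) =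
          1 / 4 * ((τ / h / q) ^ 2 * (β * (2 * d * ρ) ^ 2 * c₀ ^ 2 * Γ)) := by
        rw [hδ]; field_simp
      have e2 : (τ / h / q) ^ 2 ≤ 1 :=
        pow_le_one₀ (by positivity) ((div_le_one hq0).2 hτh)
      rw [e1]
      have := mul_le_one₀ e2 (by positivity) hc₀3
      linarith) hdiam (Nat.le_floor hn)
  refine herr.trans ?_
  set ε := P.stepError TH τ nres l δ D with hε
  have hε0 : 0 ≤ ε := by
    have := P.α_pos
    rw [hε, LSM.Problem.stepError]
    have hβ' : 0 ≤ P.β := hβ.le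
    positivity
  -- The exponential is `min (ϑ, 1/ϑ)`, so it is at most 1, as needed to linearize the power, and at
  -- most `ϑ`, the required accuracy.
  have hnε : n * ε ≤ Real.exp (-|Real.log ϑ|) := by
    refine le_trans ?_ hdec
    have e1 : (n : ℝ) ≤ nres * (tfin / T) := by
      refine hn.trans (le_of_eq ?_)
      rw [← hTτ]; field_simp
    have e2 : Real.exp (Real.log G * nres) = G ^ nres := by
      rw [mul_comm, Real.exp_nat_mul, Real.exp_log (by linarith)]
    rw [hexp, e2, mul_comm _ (nres * (tfin / T))]
    refine mul_le_mul e1 (hstep.trans ?_) hε0 (by positivity)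
    change K * ((1 + δ) ^ (l + 1))⁻¹ * G ^ nres * q ^ 4 * (1 / h) ^ (d + 2) ≤ _
    gcongr
  have hθ1 : Real.exp (-|Real.log ϑ|) ≤ 1 := Real.exp_le_one_iff.2 (by simp)
  have hθ2 : Real.exp (-|Real.log ϑ|) ≤ ϑ := by
    calc Real.exp (-|Real.log ϑ|) ≤ Real.exp (Real.log ϑ) :=
          Real.exp_le_exp.2 (neg_abs_le _)
      _ = ϑ := Real.exp_log hϑ
  have hgrow := LSM.one_add_pow_sub_one_le hε0 hnε hθ1
  refine mul_le_mul_of_nonneg_right (by linarith) (add_nonneg (Real.sqrt_nonneg _)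
    (Finset.sum_nonneg fun j _ => mul_nonneg hτ.le (Real.sqrt_nonneg _)))
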